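/- Let $1<\alpha<2$. There is a constant $C_\alpha>0$, depending only on $\alpha$, such that the following holds for every $T>0$, every $d\in\{1,2,3\}$ and every convex $d$-polytope $\Omega\subset\mathbb R^d$ (open, non-empty). **Notation.** Let $\{\phi_n\}_{n\ge 0}$ be an orthonormal basis of $L^2(\Omega)$ with $\phi_n\in H_0^1(\Omega)$ and $-\Delta\phi_n=\lambda_n\phi_n$ (weakly), where $0<\lambda_0\le\lambda_1\le\cdots\to\infty$. For $s\in\mathbb R$ let $\dot H^s(\Omega)$ be the space of all series $\sum_n c_n\phi_n$ with $\sum_n\lambda_n^s c_n^2<\infty$. For an integer $m\ge 0$, let ${}_0H^m(0,T)$ (respectively ${}^0\!H^m(0,T)$) be the space of all $v\in H^m(0,T)$ with $v^{(k)}(0)=0$ (respectively $v^{(k)}(T)=0$) for $0\le k<m$, normed by $\|v^{(m)}\|_{L^2(0,T)}$. For $k-1<\gamma<k$ with an integer $k\ge1$, let ${}_0H^\gamma:=[{}_0H^{k-1},{}_0H^k]_{\gamma-k+1,2}$ and ${}^0\!H^\gamma:=[{}^0\!H^{k-1},{}^0\!H^k]_{\gamma-k+1,2}$ by the $K$-method,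 where $[X_0,X_1]_{\theta,2}$ has the norm $$\Big(\int_0^\infty (t^{-\theta}K(t,w))^2\,\tfrac{dt}{t}\Big)^{1/2},\qquad K(t,w)=\inf_{w=w_0+w_1}\big(\|w_0\|_{X_0}+t\|w_1\|_{X_1}\big).$$ For $\gamma>0$ let ${}_0H^{-\gamma}:=({}^0\!H^{\gamma})^*$ and ${}^0\!H^{-\gamma}:=({}_0H^{\gamma})^*$. The norm of $v=\sum_n v_n(t)\phi_n$ in ${}_0H^\gamma(0,T;\dot H^s(\Omega))$ is $\big(\sum_n\lambda_n^s\|v_n\|^2_{{}_0H^\gamma(0,T)}\big)^{1/2}$, and similarly for ${}^0\!H^\gamma(0,T;\dot H^s(\Omega))$. Define $$W={}_0H^{\alpha/4}(0,T;L^2(\Omega))\cap{}_0H^{-\alpha/4}(0,T;\dot H^1(\Omega)),\qquad \widehat W={}^0\!H^{3\alpha/4}(0,T;L^2(\Omega))\cap{}^0\!H^{\alpha/4}(0,T;\dot H^1(\Omega)),$$ where an intersection carries the square root of the sum of the squares of the two norms. For $\gamma>0$ put $$(D_{0+}^{-\gamma}v)(t)=\tfrac1{\Gamma(\gamma)}\int_0^t(t-s)^{\gamma-1}v(s)\,ds,\qquad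 (D_{T-}^{-\gamma}v)(t)=\tfrac1{\Gamma(\gamma)}\int_t^T(s-t)^{\gamma-1}v(s)\,ds,$$ and let $D_{0+}^{\alpha/2}v=\frac{d}{dt}D_{0+}^{\alpha/2-1}v$, with $\frac{d}{dt}$ the distributional derivative on $(0,T)$. Write $\langle\cdot,\cdot\rangle_X$ for the duality pairing between $X^*$ and $X$. **Theorem.** Let $f\in\widehat W^*$, and let $u_0\in\dot H^{r}(\Omega)$, $u_1\in\dot H^{s}(\Omega)$ for some $r,s\in\mathbb R$ be such that $D_{0+}^{\alpha/2}(u_0+tu_1)\in W^*$. Then there is exactly one $u\in W$ such that $$\big\langle D_{0+}^{\alpha/2}u,v\big\rangle_{{}^0\!H^{\alpha/4}(0,T;L^2(\Omega))}+\int_0^T\!\!\int_\Omega\nabla D_{0+}^{-\alpha/4}u\cdot\nabla D_{T-}^{-\alpha/4}v\,dx\,dt=\big\langle f,D_{T-}^{-\alpha/2}v\big\rangle_{\widehat W}+\big\langle D_{0+}^{\alpha/2}(u_0+tu_1),v\big\rangle_W\qquad\text{for all }v\in W$$ (all terms being well defined), and it satisfies $$\|u\|_W\le C_\alpha\big(\|f\|_{\widehat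 W^*}+\|D_{0+}^{\alpha/2}(u_0+tu_1)\|_{W^*}\big).$$ -/

import Mathlib

open MeasureTheory Set Filter Topology
open scoped ENNReal

noncomputable section

namespace FracWave

/-! ## Extended norms: the value `∞` means "not in the space" -/

/-- An extended seminorm on a real vector space; the associated space is `N.space = {N < ∞}`. -/
structure ExtSeminorm (E : Type*) [AddCommGroup E] [Module ℝ E] where
  toFun : E → ℝ≥0∞
  add_le' : ∀ u v, toFun (u + v) ≤ toFun u + toFun v
  smul_le' : ∀ (c : ℝ) u, toFun (c • u) ≤ ‖c‖ₑ * toFun u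

instance {E : Type*} [AddCommGroup E] [Module ℝ E] :
    CoeFun (ExtSeminorm E) (fun _ => E → ℝ≥0∞) := ⟨ExtSeminorm.toFun⟩

namespace ExtSeminorm

variable {E : Type*} [AddCommGroup E] [Module ℝ E]

/-- The vector space of all elements of finite norm. -/
def space (N : ExtSeminorm E) : Submodule ℝ E where
  carrier := {u | N u < ∞}
  add_mem' := fun {u v} hu hv =>
    lt_of_le_of_lt (N.add_le' u v) (ENNReal.add_lt_top.2 ⟨hu, hv⟩)
  zero_mem' := by
    have h := N.smul_le' 0 0
    simp only [zero_smul, enorm_zero, zero_mul] at h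
    exact lt_of_le_of_lt h ENNReal.zero_lt_top
  smul_mem' := fun c u hu =>
    lt_of_le_of_lt (N.smul_le' c u) (ENNReal.mul_lt_top enorm_lt_top hu)

/-- The dual (operator) norm of a linear functional on the space of `N`. The dual space consists
of the linear functionals for which it is finite. -/
def opNorm (N : ExtSeminorm E) (F : N.space →ₗ[ℝ] ℝ) : ℝ≥0∞ :=
  ⨆ (w : N.space) (_ : N (w : E) ≤ 1), ‖F w‖ₑ

/-- The norm `(N₀² + N₁²)^{1/2}` of the intersection of two spaces. -/
def inter (N₀ N₁ : ExtSeminorm E) : ExtSeminorm E where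
  toFun u := (N₀ u ^ (2 : ℝ) + N₁ u ^ (2 : ℝ)) ^ (1 / 2 : ℝ)
  add_le' u v := by
    have h := ENNReal.Lp_add_le Finset.univ (fun i : Fin 2 => if i = 0 then N₀ u else N₁ u)
      (fun i : Fin 2 => if i = 0 then N₀ v else N₁ v) (p := 2) (by norm_num)
    simp only [Fin.sum_univ_two, if_true, Fin.isValue, one_ne_zero, if_false] at h
    refine le_trans ?_ h
    gcongr
    · exact N₀.add_le' u v
    · exact N₁.add_le' u v
  smul_le' c u := by
    have h0 : N₀ (c • u) ^ (2 : ℝ) ≤ ‖c‖ₑ ^ (2 : ℝ) * N₀ u ^ (2 : ℝ) := by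
      rw [← ENNReal.mul_rpow_of_nonneg _ _ (by norm_num)]
      gcongr
      exact N₀.smul_le' c u
    have h1 : N₁ (c • u) ^ (2 : ℝ) ≤ ‖c‖ₑ ^ (2 : ℝ) * N₁ u ^ (2 : ℝ) := by
      rw [← ENNReal.mul_rpow_of_nonneg _ _ (by norm_num)]
      gcongr
      exact N₁.smul_le' c u
    calc _ ≤ (‖c‖ₑ ^ (2 : ℝ) * (N₀ u ^ (2 : ℝ) + N₁ u ^ (2 : ℝ))) ^ (1 / 2 : ℝ) := by
          rw [mul_add]; gcongr
      _ = _ := by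
          rw [ENNReal.mul_rpow_of_nonneg _ _ (by norm_num), ← ENNReal.rpow_mul]
          norm_num

/-- The `K`-functional `inf {N₀ w₀ + t N₁ w₁ : w = w₀ + w₁}`. -/
def kFun (N₀ N₁ : ExtSeminorm E) (t : ℝ) (w : E) : ℝ≥0∞ :=
  ⨅ w₀ : E, N₀ w₀ + ENNReal.ofReal t * N₁ (w - w₀)

theorem kFun_mono (N₀ N₁ : ExtSeminorm E) (w : E) : Monotone fun t => kFun N₀ N₁ t w := by
  intro s t hst
  simp only [kFun]
  gcongr

theorem kFun_add_le (N₀ N₁ : ExtSeminorm E) (t : ℝ) (u v : E) :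
    kFun N₀ N₁ t (u + v) ≤ kFun N₀ N₁ t u + kFun N₀ N₁ t v := by
  refine ENNReal.le_iInf_add_iInf fun a b => ?_
  refine (iInf_le _ (a + b)).trans ?_
  have h0 := N₀.add_le' a b
  have h1 := N₁.add_le' (u - a) (v - b)
  have e : u + v - (a + b) = u - a + (v - b) := by abel
  rw [e]
  calc _ ≤ (N₀ a + N₀ b) + ENNReal.ofReal t * (N₁ (u - a) + N₁ (v - b)) := by gcongr
    _ = _ := by ring

theorem kFun_smul_le (N₀ N₁ : ExtSeminorm E) (t c : ℝ) (u : E) :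
    kFun N₀ N₁ t (c • u) ≤ ‖c‖ₑ * kFun N₀ N₁ t u := by
  unfold kFun
  rw [ENNReal.mul_iInf' (fun h => absurd h enorm_ne_top) (fun _ => ⟨0⟩)]
  refine le_iInf fun a => (iInf_le _ (c • a)).trans ?_
  have h0 := N₀.smul_le' c a
  have h1 := N₁.smul_le' c (u - a)
  rw [← smul_sub]
  calc _ ≤ ‖c‖ₑ * N₀ a + ENNReal.ofReal t * (‖c‖ₑ * N₁ (u - a)) := by gcongr
    _ = _ := by ring

/-- The norm `(∫₀^∞ (t^{-θ} K(t, w))² dt/t)^{1/2}` of the real interpolation space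
`[X₀, X₁]_{θ,2}`. -/
def interp (N₀ N₁ : ExtSeminorm E) (θ : ℝ) : ExtSeminorm E where
  toFun w := (∫⁻ t in Ioi (0 : ℝ),
    ENNReal.ofReal t⁻¹ * (ENNReal.ofReal (t ^ (-θ)) * kFun N₀ N₁ t w) ^ (2 : ℝ)) ^ (1 / 2 : ℝ)
  add_le' u v := by
    have hm : ∀ w, Measurable fun t : ℝ => ENNReal.ofReal (t ^ (-θ)) * kFun N₀ N₁ t w :=
      fun w => (by fun_prop : Measurable fun t : ℝ => ENNReal.ofReal (t ^ (-θ))).mul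
        (kFun_mono N₀ N₁ w).measurable
    have hi : Measurable fun t : ℝ => ENNReal.ofReal t⁻¹ := by fun_prop
    have hw : ∀ g : ℝ → ℝ≥0∞, Measurable g →
        ∫⁻ t in Ioi (0 : ℝ), ENNReal.ofReal t⁻¹ * g t =
        ∫⁻ t, g t ∂((volume.restrict (Ioi (0 : ℝ))).withDensity fun t => ENNReal.ofReal t⁻¹) := by
      intro g hg
      rw [lintegral_withDensity_eq_lintegral_mul _ hi hg]
      rfl
    rw [hw _ ((hm _).pow_const _), hw _ ((hm _).pow_const _), hw _ ((hm _).pow_const _)]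
    refine le_trans ?_ (ENNReal.lintegral_Lp_add_le (hm u).aemeasurable (hm v).aemeasurable
      (by norm_num))
    gcongr with t
    rw [Pi.add_apply, ← mul_add]
    gcongr
    exact kFun_add_le N₀ N₁ t u v
  smul_le' c u := by
    have h : ∀ t : ℝ, ENNReal.ofReal t⁻¹ *
        (ENNReal.ofReal (t ^ (-θ)) * kFun N₀ N₁ t (c • u)) ^ (2 : ℝ) ≤ ‖c‖ₑ ^ (2 : ℝ) *
        (ENNReal.ofReal t⁻¹ * (ENNReal.ofReal (t ^ (-θ)) * kFun N₀ N₁ t u) ^ (2 : ℝ)) := by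
      intro t
      rw [mul_left_comm, ← ENNReal.mul_rpow_of_nonneg _ _ (by norm_num : (0 : ℝ) ≤ 2),
        mul_left_comm]
      gcongr
      exact kFun_smul_le N₀ N₁ t c u
    calc _ ≤ (∫⁻ t in Ioi (0 : ℝ), ‖c‖ₑ ^ (2 : ℝ) * (ENNReal.ofReal t⁻¹ *
          (ENNReal.ofReal (t ^ (-θ)) * kFun N₀ N₁ t u) ^ (2 : ℝ))) ^ (1 / 2 : ℝ) := by
          exact ENNReal.rpow_le_rpow (lintegral_mono h) (by norm_num)
      _ = _ := by
          rw [lintegral_const_mul' _ _ (by simp), ENNReal.mul_rpow_of_nonneg _ _ (by norm_num),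
            ← ENNReal.rpow_mul]
          norm_num

end ExtSeminorm

/-! ## Sobolev spaces on the interval `(0, T)` -/

/-- Lebesgue measure on `(0, T)`. -/
abbrev timeMeasure (T : ℝ) : Measure ℝ := volume.restrict (Ioo 0 T)

/-- The space `L²(0, T)`. -/
abbrev L2Time (T : ℝ) := Lp ℝ 2 (timeMeasure T)

/-- Test functions: `ψ ∈ C_c^∞(0, T)`. -/
def IsTest (T : ℝ) (ψ : ℝ → ℝ) : Prop :=
  ContDiff ℝ ((⊤ : ℕ∞) : WithTop ℕ∞) ψ ∧ HasCompactSupport ψ ∧ tsupport ψ ⊆ Ioo 0 T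

/-- `g ∈ L²(0, T)` is the weak derivative of `v ∈ L²(0, T)`. -/
def HasWeakDeriv (T : ℝ) (v g : L2Time T) : Prop :=
  ∀ ψ, IsTest T ψ →
    ∫ t, v t * deriv ψ t ∂(timeMeasure T) = -∫ t, g t * ψ t ∂(timeMeasure T)

/-- `v` has a representative that is continuous on `[0, T]` and vanishes at `c`. -/
def VanishesAt (T c : ℝ) (v : L2Time T) : Prop :=
  ∃ V : ℝ → ℝ, ContinuousOn V (Icc 0 T) ∧ (∀ᵐ t ∂(timeMeasure T), v t = V t) ∧ V c = 0

/-- `D 0 = v, D 1, …, D m` are the weak derivatives of `v ∈ H^m(0, T)`, and those of order `< m`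
vanish at the endpoint `c`. -/
def IsDerivChain (T c : ℝ) (m : ℕ) (v : L2Time T) (D : ℕ → L2Time T) : Prop :=
  D 0 = v ∧ ∀ k < m, HasWeakDeriv T (D k) (D (k + 1)) ∧ VanishesAt T c (D k)

theorem integrable_mul_test {T : ℝ} (v : L2Time T) {ψ : ℝ → ℝ} (hc : Continuous ψ)
    (hs : HasCompactSupport ψ) : Integrable (fun t => v t * ψ t) (timeMeasure T) :=
  MemLp.integrable_mul (p := 2) (q := 2) (Lp.memLp v) (hc.memLp_of_hasCompactSupport hs)

theorem IsTest.continuous_deriv {T : ℝ} {ψ : ℝ → ℝ} (h : IsTest T ψ) : Continuous (deriv ψ) :=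
  h.1.continuous_deriv (by norm_num)

theorem HasWeakDeriv.add {T : ℝ} {v w g h : L2Time T} (hv : HasWeakDeriv T v g)
    (hw : HasWeakDeriv T w h) : HasWeakDeriv T (v + w) (g + h) := by
  intro ψ hψ
  have e : ∀ (a b : L2Time T) {χ : ℝ → ℝ}, Continuous χ → HasCompactSupport χ →
      ∫ t, (a + b : L2Time T) t * χ t ∂(timeMeasure T) =
      ∫ t, a t * χ t ∂(timeMeasure T) + ∫ t, b t * χ t ∂(timeMeasure T) := by
    intro a b χ h1 h2
    rw [← integral_add (integrable_mul_test a h1 h2) (integrable_mul_test b h1 h2)]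
    refine integral_congr_ae ?_
    filter_upwards [Lp.coeFn_add a b] with t ht
    rw [ht, Pi.add_apply, add_mul]
  rw [e _ _ hψ.continuous_deriv hψ.2.1.deriv, e _ _ hψ.1.continuous hψ.2.1, hv ψ hψ, hw ψ hψ]
  ring

theorem HasWeakDeriv.smul {T : ℝ} {v g : L2Time T} (c : ℝ) (hv : HasWeakDeriv T v g) :
    HasWeakDeriv T (c • v) (c • g) := by
  intro ψ hψ
  have e : ∀ (a : L2Time T) (χ : ℝ → ℝ),
      ∫ t, (c • a : L2Time T) t * χ t ∂(timeMeasure T) =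
      c * ∫ t, a t * χ t ∂(timeMeasure T) := by
    intro a χ
    rw [← integral_const_mul]
    refine integral_congr_ae ?_
    filter_upwards [Lp.coeFn_smul c a] with t ht
    rw [ht, Pi.smul_apply, smul_eq_mul, mul_assoc]
  rw [e, e, hv ψ hψ]
  ring

theorem VanishesAt.add {T c : ℝ} {v w : L2Time T} (hv : VanishesAt T c v)
    (hw : VanishesAt T c w) : VanishesAt T c (v + w) := by
  obtain ⟨V, hV, hv, hVc⟩ := hv
  obtain ⟨W, hW, hw, hWc⟩ := hw
  refine ⟨V + W, hV.add hW, ?_, by simp [hVc, hWc]⟩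
  filter_upwards [hv, hw, Lp.coeFn_add v w] with t h1 h2 h3
  rw [h3, Pi.add_apply, Pi.add_apply, h1, h2]

theorem VanishesAt.smul {T c : ℝ} {v : L2Time T} (a : ℝ) (hv : VanishesAt T c v) :
    VanishesAt T c (a • v) := by
  obtain ⟨V, hV, hv, hVc⟩ := hv
  refine ⟨a • V, hV.const_smul a, ?_, by simp [hVc]⟩
  filter_upwards [hv, Lp.coeFn_smul a v] with t h1 h3
  rw [h3, Pi.smul_apply, Pi.smul_apply, h1]

theorem hasWeakDeriv_zero (T : ℝ) : HasWeakDeriv T 0 0 := by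
  intro ψ _
  have e : ∀ χ : ℝ → ℝ, ∫ t, (0 : L2Time T) t * χ t ∂(timeMeasure T) = 0 := by
    intro χ
    rw [← integral_zero ℝ ℝ (μ := timeMeasure T)]
    refine integral_congr_ae ?_
    filter_upwards [Lp.coeFn_zero ℝ 2 (timeMeasure T)] with t ht
    rw [ht, Pi.zero_apply, zero_mul]
  rw [e, e, neg_zero]

theorem vanishesAt_zero (T c : ℝ) : VanishesAt T c 0 := by
  refine ⟨0, continuousOn_const, ?_, rfl⟩
  filter_upwards [Lp.coeFn_zero ℝ 2 (timeMeasure T)] with t ht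
  rw [ht]

theorem isDerivChain_zero (T c : ℝ) (m : ℕ) : IsDerivChain T c m 0 (fun _ => 0) :=
  ⟨rfl, fun _ _ => ⟨hasWeakDeriv_zero T, vanishesAt_zero T c⟩⟩

theorem IsDerivChain.add {T c : ℝ} {m : ℕ} {v w : L2Time T} {D D' : ℕ → L2Time T}
    (h : IsDerivChain T c m v D) (h' : IsDerivChain T c m w D') :
    IsDerivChain T c m (v + w) (fun k => D k + D' k) :=
  ⟨congrArg₂ _ h.1 h'.1, fun k hk =>
    ⟨(h.2 k hk).1.add (h'.2 k hk).1, (h.2 k hk).2.add (h'.2 k hk).2⟩⟩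

theorem IsDerivChain.smul {T c : ℝ} {m : ℕ} {v : L2Time T} {D : ℕ → L2Time T} (a : ℝ)
    (h : IsDerivChain T c m v D) : IsDerivChain T c m (a • v) (fun k => a • D k) :=
  ⟨congrArg _ h.1, fun k hk => ⟨(h.2 k hk).1.smul a, (h.2 k hk).2.smul a⟩⟩

/-- The norm `‖v^{(m)}‖_{L²(0,T)}` of the space
`{v ∈ H^m(0, T) : v^{(k)}(c) = 0 for 0 ≤ k < m}`, and `∞` for `v` outside this space. -/
def sob (T c : ℝ) (m : ℕ) : ExtSeminorm (L2Time T) where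
  toFun v := ⨅ D : {D : ℕ → L2Time T // IsDerivChain T c m v D}, ‖D.1 m‖ₑ
  add_le' u v := ENNReal.le_iInf_add_iInf fun D D' =>
    (iInf_le (fun D : {D : ℕ → L2Time T // IsDerivChain T c m (u + v) D} => ‖D.1 m‖ₑ)
      ⟨_, D.2.add D'.2⟩).trans (enorm_add_le _ _)
  smul_le' a v := by
    rcases eq_or_ne a 0 with rfl | ha
    · rw [zero_smul]
      refine (iInf_le (fun D : {D : ℕ → L2Time T // IsDerivChain T c m 0 D} => ‖D.1 m‖ₑ)
        ⟨_, isDerivChain_zero T c m⟩).trans ?_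
      simp
    · rw [ENNReal.mul_iInf' (fun h => absurd h enorm_ne_top) (fun h => by simp [ha] at h)]
      refine le_iInf fun D =>
        (iInf_le (fun D : {D : ℕ → L2Time T // IsDerivChain T c m (a • v) D} => ‖D.1 m‖ₑ)
          ⟨_, D.2.smul a⟩).trans ?_
      exact (enorm_smul a (D.1 m)).le

/-- The norm of order `γ ≥ 0` with vanishing conditions at `c`: `sob` if `γ` is an integer, and
`[H^k, H^{k+1}]_{γ-k,2}` with `k = ⌊γ⌋` otherwise. -/
def sobNonneg (T c γ : ℝ) : ExtSeminorm (L2Time T) :=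
  if γ = (⌊γ⌋₊ : ℝ) then sob T c ⌊γ⌋₊
  else (sob T c ⌊γ⌋₊).interp (sob T c (⌊γ⌋₊ + 1)) (γ - ⌊γ⌋₊)

/-- The norm of the dual space of `N.space`, on functions in `L²(0, T)`, which act on `N.space`
through the integral `∫₀ᵀ w z`. -/
def dualNorm {T : ℝ} (N : ExtSeminorm (L2Time T)) : ExtSeminorm (L2Time T) where
  toFun w := ⨆ (z : L2Time T) (_ : N z ≤ 1), ‖∫ t, w t * z t ∂(timeMeasure T)‖ₑ
  add_le' u v := by
    refine iSup₂_le fun z hz => ?_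
    have e : ∫ t, (u + v : L2Time T) t * z t ∂(timeMeasure T) =
        ∫ t, u t * z t ∂(timeMeasure T) + ∫ t, v t * z t ∂(timeMeasure T) := by
      have hi : ∀ a : L2Time T, Integrable (fun t => a t * z t) (timeMeasure T) := fun a =>
        MemLp.integrable_mul (p := 2) (q := 2) (Lp.memLp a) (Lp.memLp z)
      rw [← integral_add (hi u) (hi v)]
      refine integral_congr_ae ?_
      filter_upwards [Lp.coeFn_add u v] with t ht
      rw [ht, Pi.add_apply, add_mul]
    rw [e]
    refine (enorm_add_le _ _).trans ?_
    gcongr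
    · exact le_iSup₂ (f := fun (z : L2Time T) (_ : N z ≤ 1) =>
        ‖∫ t, u t * z t ∂(timeMeasure T)‖ₑ) z hz
    · exact le_iSup₂ (f := fun (z : L2Time T) (_ : N z ≤ 1) =>
        ‖∫ t, v t * z t ∂(timeMeasure T)‖ₑ) z hz
  smul_le' c u := by
    refine iSup₂_le fun z hz => ?_
    have e : ∫ t, (c • u : L2Time T) t * z t ∂(timeMeasure T) =
        c * ∫ t, u t * z t ∂(timeMeasure T) := by
      rw [← integral_const_mul]
      refine integral_congr_ae ?_
      filter_upwards [Lp.coeFn_smul c u] with t ht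
      rw [ht, Pi.smul_apply, smul_eq_mul, mul_assoc]
    rw [e, enorm_mul]
    gcongr
    exact le_iSup₂ (f := fun (z : L2Time T) (_ : N z ≤ 1) =>
      ‖∫ t, u t * z t ∂(timeMeasure T)‖ₑ) z hz

/-- The norm of `₀H^γ(0, T)`, `γ ∈ ℝ` (vanishing conditions at `0`), on functions in `L²(0, T)`;
for `γ < 0` this space is the dual of `⁰H^{-γ}(0, T)`. -/
def leftH (T γ : ℝ) : ExtSeminorm (L2Time T) :=
  if 0 ≤ γ then sobNonneg T 0 γ else dualNorm (sobNonneg T T (-γ))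

/-- The norm of `⁰H^γ(0, T)`, `γ ∈ ℝ` (vanishing conditions at `T`), on functions in `L²(0, T)`;
for `γ < 0` this space is the dual of `₀H^{-γ}(0, T)`. -/
def rightH (T γ : ℝ) : ExtSeminorm (L2Time T) :=
  if 0 ≤ γ then sobNonneg T T γ else dualNorm (sobNonneg T 0 (-γ))

/-! ## The domain `Ω` and the Dirichlet eigenfunctions -/

/-- Euclidean space `ℝ^d`. -/
abbrev Sp (d : ℕ) := EuclideanSpace ℝ (Fin d)

/-- `Ω` is a (nonempty, open) convex `d`-polytope in `ℝ^d`. -/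
def IsConvexPolytope {d : ℕ} (Ω : Set (Sp d)) : Prop :=
  Ω.Nonempty ∧ ∃ s : Finset (Sp d), Ω = interior (convexHull ℝ (s : Set (Sp d)))

/-- The space `L²(Ω)`. -/
abbrev L2 {d : ℕ} (Ω : Set (Sp d)) := Lp ℝ 2 (volume.restrict Ω)

/-- The space `L²(Ω; ℝ^d)`. -/
abbrev L2Vec {d : ℕ} (Ω : Set (Sp d)) := Lp (Sp d) 2 (volume.restrict Ω)

/-- The graph of the weak gradient `∇ : H₀¹(Ω) → L²(Ω; ℝ^d)`: since `H₀¹(Ω)` is the closure of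
`C_c^∞(Ω)` in `H¹(Ω)`, it is the closure of `{(ψ, ∇ψ) : ψ ∈ C_c^∞(Ω)}` in
`L²(Ω) × L²(Ω; ℝ^d)`. -/
def gradGraph {d : ℕ} (Ω : Set (Sp d)) : Set (L2 Ω × L2Vec Ω) :=
  closure {p | ∃ ψ : Sp d → ℝ, ContDiff ℝ ((⊤ : ℕ∞) : WithTop ℕ∞) ψ ∧ HasCompactSupport ψ ∧
    tsupport ψ ⊆ Ω ∧ (∀ᵐ x ∂(volume.restrict Ω), p.1 x = ψ x) ∧
    (∀ᵐ x ∂(volume.restrict Ω), p.2 x = gradient ψ x)}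

/-- `φ₀, φ₁, …` is an orthonormal basis of `L²(Ω)` of eigenfunctions of `-Δ` with homogeneous
Dirichlet conditions, with eigenvalues `ev 0 ≤ ev 1 ≤ …`. -/
structure IsDirichletEigenbasis {d : ℕ} (Ω : Set (Sp d)) (φ : HilbertBasis ℕ ℝ (L2 Ω))
    (ev : ℕ → ℝ) : Prop where
  pos : ∀ n, 0 < ev n
  mono : Monotone ev
  tendsto : Tendsto ev atTop atTop
  eigen : ∀ n, ∃ g, (φ n, g) ∈ gradGraph Ω ∧
    ∀ p ∈ gradGraph Ω, inner ℝ g p.2 = ev n * inner ℝ (φ n) p.1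

/-- The space `Ḣ^s(Ω)` of all series `∑ cₙ φₙ` with `∑ λₙ^s cₙ² < ∞`, as a set of coefficient
sequences. -/
def dotH (ev : ℕ → ℝ) (s : ℝ) : Set (ℕ → ℝ) := {c | Summable fun n => ev n ^ s * c n ^ 2}

/-! ## Vector-valued spaces -/

/-- The space `L²(0, T; L²(Ω))`. -/
abbrev L2TS (T : ℝ) {d : ℕ} (Ω : Set (Sp d)) := Lp (L2 Ω) 2 (timeMeasure T)

/-- The space `L²(0, T; L²(Ω; ℝ^d))`. -/
abbrev L2TSVec (T : ℝ) {d : ℕ} (Ω : Set (Sp d)) := Lp (L2Vec Ω) 2 (timeMeasure T)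

/-- The coefficient `t ↦ ⟨φₙ, u(t)⟩` of `u`, so that `u = ∑ₙ (coeff φ n u) φₙ`. -/
def coeff {T : ℝ} {d : ℕ} {Ω : Set (Sp d)} (φ : HilbertBasis ℕ ℝ (L2 Ω)) (n : ℕ)
    (u : L2TS T Ω) : L2Time T :=
  (innerSL ℝ (φ n)).compLpL 2 (timeMeasure T) u

/-- If `N` is the norm of `H^γ(0, T)` (of left or right type), this is the norm of
`H^γ(0, T; Ḣ^s(Ω))`. The orthonormal basis `λₙ^{-s/2} φₙ` of `Ḣ^s(Ω)` turns
`u = ∑ₙ cₙ φₙ` into `∑ₙ (λₙ^{s/2} cₙ) (λₙ^{-s/2} φₙ)`, so the squared norm is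
`∑ₙ λₙ^s N(cₙ)²`. -/
def vecH {T : ℝ} {d : ℕ} {Ω : Set (Sp d)} (φ : HilbertBasis ℕ ℝ (L2 Ω)) (ev : ℕ → ℝ)
    (N : ExtSeminorm (L2Time T)) (s : ℝ) : ExtSeminorm (L2TS T Ω) where
  toFun u := (∑' n, ENNReal.ofReal (ev n ^ s) * N (coeff φ n u) ^ (2 : ℝ)) ^ (1 / 2 : ℝ)
  add_le' u v := by
    have hw : ∀ w : L2TS T Ω, ∑' n, ENNReal.ofReal (ev n ^ s) * N (coeff φ n w) ^ (2 : ℝ) =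
        ∫⁻ n, (ENNReal.ofReal (ev n ^ s) ^ (1 / 2 : ℝ) * N (coeff φ n w)) ^ (2 : ℝ)
          ∂(Measure.count : Measure ℕ) := by
      intro w
      rw [lintegral_count]
      congr 1
      ext n
      rw [ENNReal.mul_rpow_of_nonneg _ _ (by norm_num), ← ENNReal.rpow_mul]
      norm_num
    rw [hw, hw, hw]
    refine le_trans ?_ (ENNReal.lintegral_Lp_add_le (measurable_of_countable _).aemeasurable
      (measurable_of_countable _).aemeasurable (by norm_num))
    gcongr with n
    rw [Pi.add_apply, ← mul_add]
    gcongr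
    have e : coeff φ n (u + v) = coeff φ n u + coeff φ n v :=
      map_add ((innerSL ℝ (φ n)).compLpL 2 (timeMeasure T)) u v
    rw [e]
    exact N.add_le' _ _
  smul_le' c u := by
    have h : ∀ n, ENNReal.ofReal (ev n ^ s) * N (coeff φ n (c • u)) ^ (2 : ℝ) ≤
        ‖c‖ₑ ^ (2 : ℝ) * (ENNReal.ofReal (ev n ^ s) * N (coeff φ n u) ^ (2 : ℝ)) := by
      intro n
      have e : coeff φ n (c • u) = c • coeff φ n u :=
        map_smul ((innerSL ℝ (φ n)).compLpL 2 (timeMeasure T)) c u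
      rw [e, mul_left_comm, ← ENNReal.mul_rpow_of_nonneg _ _ (by norm_num : (0 : ℝ) ≤ 2)]
      gcongr
      exact N.smul_le' _ _
    calc _ ≤ (∑' n, ‖c‖ₑ ^ (2 : ℝ) *
          (ENNReal.ofReal (ev n ^ s) * N (coeff φ n u) ^ (2 : ℝ))) ^ (1 / 2 : ℝ) := by
          exact ENNReal.rpow_le_rpow (ENNReal.tsum_le_tsum h) (by norm_num)
      _ = _ := by
          rw [ENNReal.tsum_mul_left, ENNReal.mul_rpow_of_nonneg _ _ (by norm_num),
            ← ENNReal.rpow_mul]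
          norm_num

/-- The norm of `W = ₀H^{α/4}(0, T; L²(Ω)) ∩ ₀H^{-α/4}(0, T; Ḣ¹(Ω))`. -/
def normW (α T : ℝ) {d : ℕ} {Ω : Set (Sp d)} (φ : HilbertBasis ℕ ℝ (L2 Ω)) (ev : ℕ → ℝ) :
    ExtSeminorm (L2TS T Ω) :=
  (vecH φ ev (leftH T (α / 4)) 0).inter (vecH φ ev (leftH T (-(α / 4))) 1)

/-- The norm of `Ŵ = ⁰H^{3α/4}(0, T; L²(Ω)) ∩ ⁰H^{α/4}(0, T; Ḣ¹(Ω))`. -/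
def normWhat (α T : ℝ) {d : ℕ} {Ω : Set (Sp d)} (φ : HilbertBasis ℕ ℝ (L2 Ω)) (ev : ℕ → ℝ) :
    ExtSeminorm (L2TS T Ω) :=
  (vecH φ ev (rightH T (3 * α / 4)) 0).inter (vecH φ ev (rightH T (α / 4)) 1)

/-! ## Fractional calculus -/

/-- The left-sided Riemann-Liouville integral `D_{0+}^{-γ} v`, `γ > 0`. -/
def intLeft {X : Type*} [NormedAddCommGroup X] [NormedSpace ℝ X] (γ : ℝ) (v : ℝ → X) (t : ℝ) :
    X :=
  (1 / Real.Gamma γ) • ∫ s in Ioo 0 t, (t - s) ^ (γ - 1) • v s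

/-- The right-sided Riemann-Liouville integral `D_{T-}^{-γ} v`, `γ > 0`. -/
def intRight {X : Type*} [NormedAddCommGroup X] [NormedSpace ℝ X] (T γ : ℝ) (v : ℝ → X) (t : ℝ) :
    X :=
  (1 / Real.Gamma γ) • ∫ s in Ioo t T, (s - t) ^ (γ - 1) • v s

/-- The functional `F` is (the extension to `N.space` of) the Riemann-Liouville derivative
`D_{0+}^β c = D D_{0+}^{β-1} c`, `0 < β < 1`, of the series `c = ∑ₙ cₙ(t) φₙ`, where `D` is the
distributional derivative in time: `⟨F, ψ φₙ⟩ = -∫₀ᵀ (D_{0+}^{β-1} cₙ) ψ'` for all `n` and all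
`ψ ∈ C_c^∞(0, T)`. -/
def IsFracDeriv {T : ℝ} {d : ℕ} {Ω : Set (Sp d)} (φ : HilbertBasis ℕ ℝ (L2 Ω)) (β : ℝ)
    (c : ℕ → ℝ → ℝ) (N : ExtSeminorm (L2TS T Ω)) (F : N.space →ₗ[ℝ] ℝ) : Prop :=
  ∀ n ψ, IsTest T ψ → ∀ w : N.space,
    (∀ᵐ t ∂(timeMeasure T), (w : L2TS T Ω) t = ψ t • φ n) →
      F w = -∫ t, intLeft (1 - β) (c n) t * deriv ψ t ∂(timeMeasure T)

/-! ## The weak formulation -/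

/-- `P` is the spatial gradient `∇U` of `U`, where `U(t) ∈ H₀¹(Ω)` for almost every `t`. -/
def IsSpaceGrad {T : ℝ} {d : ℕ} {Ω : Set (Sp d)} (U : ℝ → L2 Ω) (P : L2TSVec T Ω) : Prop :=
  ∀ᵐ t ∂(timeMeasure T), (U t, P t) ∈ gradGraph Ω

/-- `u ∈ W` is a weak solution for `f ∈ Ŵ*` and the data functional
`G = D_{0+}^{α/2}(u₀ + t u₁) ∈ W*`: for all `v ∈ W`,
`⟨D_{0+}^{α/2} u, v⟩ + ⟨∇D_{0+}^{-α/4} u, ∇D_{T-}^{-α/4} v⟩_{Ω×(0,T)}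
  = ⟨f, D_{T-}^{-α/2} v⟩ + ⟨G, v⟩`. Here
* `L` is `D_{0+}^{α/2} u` in the dual space of `⁰H^{α/4}(0, T; L²(Ω))`, and
  `v'` is `v`, as an element of that space;
* `P` and `Q` are the gradients of `D_{0+}^{-α/4} u` and `D_{T-}^{-α/4} v`;
* `w` is `D_{T-}^{-α/2} v`, as an element of `Ŵ`. -/
def IsWeakSolution (α T : ℝ) {d : ℕ} {Ω : Set (Sp d)} (φ : HilbertBasis ℕ ℝ (L2 Ω)) (ev : ℕ → ℝ)
    (f : (normWhat α T φ ev).space →ₗ[ℝ] ℝ) (G : (normW α T φ ev).space →ₗ[ℝ] ℝ)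
    (u : (normW α T φ ev).space) : Prop :=
  ∃ (L : (vecH φ ev (rightH T (α / 4)) 0).space →ₗ[ℝ] ℝ) (P : L2TSVec T Ω),
    (vecH φ ev (rightH T (α / 4)) 0).opNorm L < ∞ ∧
    IsFracDeriv φ (α / 2) (fun n t => coeff φ n (u : L2TS T Ω) t)
      (vecH φ ev (rightH T (α / 4)) 0) L ∧
    IsSpaceGrad (intLeft (α / 4) (u : L2TS T Ω)) P ∧
    ∀ v : (normW α T φ ev).space,
      ∃ (v' : (vecH φ ev (rightH T (α / 4)) 0).space) (Q : L2TSVec T Ω)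
        (w : (normWhat α T φ ev).space),
        (v' : L2TS T Ω) = v ∧
        IsSpaceGrad (intRight T (α / 4) (v : L2TS T Ω)) Q ∧
        (∀ᵐ t ∂(timeMeasure T),
          (w : L2TS T Ω) t = intRight T (α / 2) (v : L2TS T Ω) t) ∧
        L v' + ∫ t, inner ℝ (P t) (Q t) ∂(timeMeasure T) = f w + G v

end FracWave

end

open FracWave
open scoped ENNReal

/-!
The weak formulation is turned into a variational equation with a coercive form on a closed subspace
of a Hilbert space, to which the Lax–Milgram lemma applies. Write `γ = α / 4`, so that
`1/4 < γ < 1/2`, and `J = D_{0+}^{-γ}`, `J^* = D_{T-}^{-γ}` on `L²(0, T)`.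

*Fractional norms.* The interpolation norms of the couple `L²`, `H¹` with a vanishing condition are
equivalent to the `L²` norm of the density in a Riemann–Liouville integral, with constants that do
not depend on `T`. The primitive `V = D_{0+}^{-1}` is accretive, and `H¹` with vanishing condition
is the range of `V`, so the `K`-functional is that of `V`. The moment inequality
`‖D_{0+}^{-γ} x‖ ≤ C (δ^γ ‖x‖ + δ^{γ-1} ‖V x‖)` (`momentBound_rlOp`) yields a square function estimate
by almost orthogonality of the resolvents of `V` at dyadic scales
(`Accretive.tsum_square_function_le`). This gives one of the two embeddings
(`Accretive.kInt_kOp_le`); the other follows by duality from the same estimate for `V^*` and `1 - γ`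
(`exists_apply_eq_of_kInt`).

*Coercivity.* For `γ < 1/2` the square of the `L²(ℝ)` norm of the convolution of `u` with the kernel
of `J` is a multiple of `∬ |s - s'|^{2γ-1} u(s) u(s')`, which is `2 Γ(2γ) ⟪D_{0+}^{-2γ} u, u⟫`. Hence
`⟪J u, J^* u⟫` controls `‖J u‖²` and, by time reversal, `‖J^* u‖²` (`adjointCoercive_rlOp`). It
follows that there is a bounded operator `S` with `J^* S = J` that is coercive on `L²(0, T)`
(`swapOp`).

*Gradient.* On `H₀¹(Ω)` the gradient is the spectral square root of `-Δ` followed by an isometry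
(`exists_gradient_isometry`), so `∇ D_{0+}^{-γ} u` has the coordinates `pₙ = λₙ^{1/2} J uₙ`.

*Conclusion.* With `uₙ = J gₙ` the space `W` becomes the closed subspace `pₙ = λₙ^{1/2} J² gₙ` of the
space of pairs of square-summable sequences (`solSpace`). The functional `D_{0+}^{α/2} u` on
`⁰H^γ(0, T; L²(Ω))` is determined by its values on test functions, because `D_{T-}^γ` of test
functions are dense (`eq_zero_of_inner_rlOpR_derivLp`), and it pairs `J^* kₙ` with `gₙ`. For a test
function with coordinates `(h, q)` the left-hand side is therefore `⟪g, S h⟫ + ⟪p, S^* q⟫`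
(`isWeakSolution_iff`), a coercive form. The right-hand side is bounded since
`D_{T-}^{-α/2} J = D_{T-}^{-3γ} S` and `‖J^* x‖ ≤ C ‖J x‖` (`normWhat_solFun_le`).
-/


namespace FracWave

/-! ### Resolvents of an accretive operator -/

section Resolvent

variable {H : Type*} [NormedAddCommGroup H] [InnerProductSpace ℝ H]

/-- `⟨V x, x⟩ ≥ 0` for all `x`. -/
def Accretive (V : H →L[ℝ] H) : Prop := ∀ x, 0 ≤ inner ℝ (V x) x

/-- `e_t = t (V + t)⁻¹`, which is `t A (1 + t A)⁻¹` for `A = V⁻¹`. -/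
noncomputable def resE (V : H →L[ℝ] H) (t : ℝ) : H →L[ℝ] H :=
  t • Ring.inverse (V + t • (1 : H →L[ℝ] H))

/-- `ρ_t = V (V + t)⁻¹`, which is `(1 + t A)⁻¹` for `A = V⁻¹`. -/
noncomputable def resR (V : H →L[ℝ] H) (t : ℝ) : H →L[ℝ] H :=
  V * Ring.inverse (V + t • (1 : H →L[ℝ] H))

variable {V : H →L[ℝ] H} {s t : ℝ}

theorem Accretive.norm_sq_le (hV : Accretive V) (ht : 0 < t) (x : H) :
    ‖V x‖ ^ 2 + t ^ 2 * ‖x‖ ^ 2 ≤ ‖(V + t • (1 : H →L[ℝ] H)) x‖ ^ 2 := by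
  have h : (V + t • (1 : H →L[ℝ] H)) x = V x + t • x := rfl
  rw [h, norm_add_sq_real, inner_smul_right, norm_smul, mul_pow, Real.norm_eq_abs, sq_abs]
  nlinarith [mul_nonneg ht.le (hV x)]

theorem commute_inverse_shift {W : H →L[ℝ] H} (h : Commute W V) (t : ℝ) :
    Commute W (Ring.inverse (V + t • (1 : H →L[ℝ] H))) := by
  have h1 : Commute W (V + t • (1 : H →L[ℝ] H)) := h.add_right ((Commute.one_right W).smul_right t)
  by_cases hu : IsUnit (V + t • (1 : H →L[ℝ] H))
  · obtain ⟨u, hu⟩ := hu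
    rw [← hu] at h1 ⊢
    rw [Ring.inverse_unit]
    exact h1.units_inv_right
  · rw [Ring.inverse_non_unit _ hu]
    exact Commute.zero_right W

theorem commute_resE_right {W : H →L[ℝ] H} (h : Commute W V) (t : ℝ) : Commute W (resE V t) :=
  (commute_inverse_shift h t).smul_right t

theorem commute_resR_right {W : H →L[ℝ] H} (h : Commute W V) (t : ℝ) : Commute W (resR V t) :=
  h.mul_right (commute_inverse_shift h t)

theorem smul_resR (t : ℝ) : t • resR V t = V * resE V t := by
  rw [resR, resE, mul_smul_comm]

theorem commute_resR_resR (s t : ℝ) : Commute (resR V s) (resR V t) :=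
  commute_resR_right (commute_resR_right (Commute.refl V) s).symm t

/-- `e_t ρ_s = (t / s) ρ_t e_s`. -/
theorem resE_mul_resR (hs : s ≠ 0) :
    resE V t * resR V s = (t / s) • (resR V t * resE V s) := by
  have h : Commute V (Ring.inverse (V + t • (1 : H →L[ℝ] H))) :=
    commute_inverse_shift (Commute.refl V) t
  simp only [resE, resR, smul_mul_assoc, mul_smul_comm, smul_smul]
  rw [div_mul_cancel₀ _ hs, ← mul_assoc, h.eq]

variable [CompleteSpace H]

theorem Accretive.isUnit (hV : Accretive V) (ht : 0 < t) :
    IsUnit (V + t • (1 : H →L[ℝ] H)) := by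
  refine ContinuousLinearMap.isUnit_of_forall_le_norm_inner_map _ (c := Real.toNNReal t)
    (Real.toNNReal_pos.2 ht) fun x => ?_
  have h : (V + t • (1 : H →L[ℝ] H)) x = V x + t • x := rfl
  rw [h, inner_add_left, real_inner_smul_left, real_inner_self_eq_norm_sq]
  refine le_trans ?_ (le_abs_self _)
  have := hV x
  rw [Real.coe_toNNReal t ht.le]
  linarith

theorem Accretive.apply_resE (hV : Accretive V) (ht : 0 < t) (x : H) :
    V (Ring.inverse (V + t • (1 : H →L[ℝ] H)) x) +
      t • Ring.inverse (V + t • (1 : H →L[ℝ] H)) x = x := by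
  have h := Ring.mul_inverse_cancel _ (hV.isUnit ht)
  exact congrArg (fun W : H →L[ℝ] H => W x) h

theorem Accretive.resR_add_resE (hV : Accretive V) (ht : 0 < t) : resR V t + resE V t = 1 := by
  ext x
  exact hV.apply_resE ht x

theorem Accretive.norm_resR_apply_le (hV : Accretive V) (ht : 0 < t) (x : H) :
    ‖resR V t x‖ ≤ ‖x‖ := by
  have h := hV.norm_sq_le ht (Ring.inverse (V + t • (1 : H →L[ℝ] H)) x)
  have h2 : (V + t • (1 : H →L[ℝ] H)) (Ring.inverse (V + t • (1 : H →L[ℝ] H)) x) = x :=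
    hV.apply_resE ht x
  rw [h2] at h
  refine le_of_sq_le_sq ?_ (norm_nonneg _)
  change ‖V (Ring.inverse (V + t • (1 : H →L[ℝ] H)) x)‖ ^ 2 ≤ _
  nlinarith [sq_nonneg (t * ‖Ring.inverse (V + t • (1 : H →L[ℝ] H)) x‖)]

theorem Accretive.norm_resE_apply_le (hV : Accretive V) (ht : 0 < t) (x : H) :
    ‖resE V t x‖ ≤ ‖x‖ := by
  have h := hV.norm_sq_le ht (Ring.inverse (V + t • (1 : H →L[ℝ] H)) x)
  have h2 : (V + t • (1 : H →L[ℝ] H)) (Ring.inverse (V + t • (1 : H →L[ℝ] H)) x) = x :=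
    hV.apply_resE ht x
  rw [h2] at h
  refine le_of_sq_le_sq ?_ (norm_nonneg _)
  change ‖t • (Ring.inverse (V + t • (1 : H →L[ℝ] H)) x)‖ ^ 2 ≤ _
  rw [norm_smul, mul_pow, Real.norm_eq_abs, sq_abs]
  nlinarith [sq_nonneg ‖V (Ring.inverse (V + t • (1 : H →L[ℝ] H)) x)‖]

theorem Accretive.norm_apply_resE_le (hV : Accretive V) (ht : 0 < t) (x : H) :
    ‖V (resE V t x)‖ ≤ t * ‖x‖ := by
  have h : V (resE V t x) = t • resR V t x :=
    congrArg (fun W : H →L[ℝ] H => W x) (smul_resR (V := V) t).symm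
  rw [h, norm_smul, Real.norm_of_nonneg ht.le]
  exact mul_le_mul_of_nonneg_left (hV.norm_resR_apply_le ht x) ht.le

/-- `ρ_t - ρ_{2t} = ρ_{2t} e_t`. -/
theorem Accretive.resR_sub_resR_two (hV : Accretive V) (ht : 0 < t) :
    resR V t - resR V (2 * t) = resR V (2 * t) * resE V t := by
  have h1 := hV.resR_add_resE ht
  have h2 := hV.resR_add_resE (t := 2 * t) (by positivity)
  have h3 := resE_mul_resR (V := V) (s := 2 * t) (t := t) (by positivity)
  have h5 : t / (2 * t) = 1 / 2 := by field_simp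
  rw [h5] at h3
  have e2 : resE V (2 * t) = 1 - resR V (2 * t) := by rw [← h2]; abel
  have e1 : resE V t = 1 - resR V t := by rw [← h1]; abel
  have hc := (commute_resR_resR (V := V) (2 * t) t).eq
  rw [e1, e2, mul_sub, sub_mul, one_mul, mul_one, smul_sub] at h3
  rw [e1, mul_sub, mul_one, hc]
  have h4 : (2 : ℝ) • (resR V (2 * t) - resR V t * resR V (2 * t)) =
      resR V t - resR V t * resR V (2 * t) := by
    rw [h3, ← smul_sub, smul_smul]; norm_num
  rw [two_smul] at h4
  have h6 : resR V t = resR V (2 * t) - resR V t * resR V (2 * t) +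
      (resR V (2 * t) - resR V t * resR V (2 * t)) + resR V t * resR V (2 * t) := by
    rw [h4]; abel
  nth_rewrite 1 [h6]
  abel

/-- The differences `q = ρ_t - ρ_{2t}` are square summable along `t = 2^j`, since
`3 ‖q x‖²` is at most the decrease of `‖ρ x‖²`. -/
theorem Accretive.three_mul_norm_sq_le (hV : Accretive V) (ht : 0 < t) (x : H) :
    3 * ‖(resR V t - resR V (2 * t)) x‖ ^ 2 ≤ ‖resR V t x‖ ^ 2 - ‖resR V (2 * t) x‖ ^ 2 := by
  have h2t : 0 < 2 * t := by positivity
  set R := Ring.inverse (V + t • (1 : H →L[ℝ] H)) with hR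
  set R' := Ring.inverse (V + (2 * t) • (1 : H →L[ℝ] H)) with hR'
  have hRR : Commute R' R := commute_inverse_shift
    (commute_inverse_shift (Commute.refl V) _).symm _
  -- all vectors are expressed through `z = V (V + t)⁻¹ (V + 2t)⁻¹ x`
  set y := R (R' x) with hy
  have ha : resR V t x = V (V y) + (2 * t) • V y := by
    have h := hV.apply_resE h2t (R x)
    rw [← hR'] at h
    have hc : R' (R x) = y := congrArg (fun W : H →L[ℝ] H => W x) hRR.eq
    rw [hc] at h
    change V (R x) = _
    rw [← h, map_add, map_smul]
  have hb : resR V (2 * t) x = V (V y) + t • V y := by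
    have h := hV.apply_resE ht (R' x)
    rw [← hR] at h
    change V (R' x) = _
    rw [← h, map_add, map_smul]
  rw [sub_apply, ha, hb]
  set z := V y
  have hd : V z + (2 * t) • z - (V z + t • z) = t • z := by
    rw [two_mul, add_smul]; abel
  rw [hd, norm_add_sq_real, norm_add_sq_real, norm_smul, norm_smul,
    real_inner_smul_right, real_inner_smul_right, Real.norm_of_nonneg ht.le,
    Real.norm_of_nonneg h2t.le]
  nlinarith [mul_nonneg ht.le (hV z)]

/-- `e_t` is bounded and tends to zero on the range of `V`, hence everywhere by density. -/
theorem Accretive.tendsto_resE_zpow (hV : Accretive V) (hd : DenseRange V) (x : H) :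
    Tendsto (fun N : ℕ => resE V ((2 : ℝ) ^ (-(N : ℤ))) x) atTop (𝓝 0) := by
  have hpos : ∀ N : ℕ, (0 : ℝ) < 2 ^ (-(N : ℤ)) := fun N => by positivity
  rw [Metric.tendsto_atTop]
  intro ε hε
  obtain ⟨y, hy⟩ := hd.exists_dist_lt x (half_pos hε)
  have h0 : Tendsto (fun N : ℕ => (2 : ℝ) ^ (-(N : ℤ)) * ‖y‖) atTop (𝓝 0) := by
    have h1 : Tendsto (fun N : ℕ => ((1 : ℝ) / 2) ^ N) atTop (𝓝 0) :=
      tendsto_pow_atTop_nhds_zero_of_lt_one (by norm_num) (by norm_num)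
    have h2 := h1.mul_const ‖y‖
    rw [zero_mul] at h2
    refine h2.congr fun N => ?_
    rw [zpow_neg, zpow_natCast, one_div, inv_pow]
  obtain ⟨N₀, hN₀⟩ := (Metric.tendsto_atTop.1 h0) (ε / 2) (half_pos hε)
  refine ⟨N₀, fun N hN => ?_⟩
  rw [dist_zero_right]
  have e : resE V ((2 : ℝ) ^ (-(N : ℤ))) x = resE V ((2 : ℝ) ^ (-(N : ℤ))) (x - V y) +
      V (resE V ((2 : ℝ) ^ (-(N : ℤ))) y) := by
    have hc : resE V ((2 : ℝ) ^ (-(N : ℤ))) (V y) = V (resE V ((2 : ℝ) ^ (-(N : ℤ))) y) :=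
      congrArg (fun W : H →L[ℝ] H => W y) (commute_resE_right (Commute.refl V) _).eq.symm
    rw [map_sub, hc]; abel
  rw [e]
  have h1 := hN₀ N hN
  rw [dist_zero_right, Real.norm_of_nonneg (by positivity)] at h1
  calc _ ≤ _ := norm_add_le _ _
    _ ≤ ‖x - V y‖ + 2 ^ (-(N : ℤ)) * ‖y‖ :=
      add_le_add (hV.norm_resE_apply_le (hpos N) _) (hV.norm_apply_resE_le (hpos N) _)
    _ < ε / 2 + ε / 2 := by rw [dist_eq_norm] at hy; exact add_lt_add hy h1
    _ = ε := by ring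

theorem Accretive.tendsto_resR_zpow (hV : Accretive V) (x : H) :
    Tendsto (fun N : ℕ => resR V ((2 : ℝ) ^ (N : ℤ)) x) atTop (𝓝 0) := by
  rw [tendsto_zero_iff_norm_tendsto_zero]
  have h1 : Tendsto (fun N : ℕ => ((1 : ℝ) / 2) ^ N * (‖V‖ * ‖x‖)) atTop (𝓝 0) := by
    have h2 := (tendsto_pow_atTop_nhds_zero_of_lt_one (r := (1 : ℝ) / 2)
      (by norm_num) (by norm_num)).mul_const (‖V‖ * ‖x‖)
    rwa [zero_mul] at h2
  refine squeeze_zero (fun _ => norm_nonneg _) (fun N => ?_) h1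
  have hpos : (0 : ℝ) < 2 ^ (N : ℤ) := by positivity
  have h : ((2 : ℝ) ^ (N : ℤ)) • resR V ((2 : ℝ) ^ (N : ℤ)) x = V (resE V ((2 : ℝ) ^ (N : ℤ)) x) :=
    congrArg (fun W : H →L[ℝ] H => W x) (smul_resR (V := V) _)
  have h3 : ‖((2 : ℝ) ^ (N : ℤ)) • resR V ((2 : ℝ) ^ (N : ℤ)) x‖ ≤ ‖V‖ * ‖x‖ := by
    rw [h]
    refine (V.le_opNorm _).trans ?_
    gcongr
    exact hV.norm_resE_apply_le hpos x
  rw [norm_smul, Real.norm_of_nonneg hpos.le, zpow_natCast] at h3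
  rw [one_div, inv_pow, ← div_eq_inv_mul, le_div_iff₀ (by positivity), zpow_natCast, mul_comm]
  exact h3

end Resolvent

end FracWave

namespace FracWave

/-! ### The square function estimate -/

theorem lintegral_mul_sq_le {β : Type*} [MeasurableSpace β] (μ : Measure β) {w f : β → ℝ≥0∞}
    (hw : AEMeasurable w μ) (hf : AEMeasurable f μ) :
    (∫⁻ x, w x * f x ∂μ) ^ 2 ≤ (∫⁻ x, w x ∂μ) * ∫⁻ x, w x * f x ^ 2 ∂μ := by
  have h := ENNReal.lintegral_mul_le_Lp_mul_Lq μ Real.HolderConjugate.two_two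
    (f := fun x => w x ^ (1 / 2 : ℝ)) (g := fun x => w x ^ (1 / 2 : ℝ) * f x)
    (hw.pow_const _) ((hw.pow_const _).mul hf)
  have e1 : ∀ x, w x ^ (1 / 2 : ℝ) * (w x ^ (1 / 2 : ℝ) * f x) = w x * f x := fun x => by
    rw [← mul_assoc, ← ENNReal.rpow_add_of_nonneg _ _ (by norm_num) (by norm_num)]; norm_num
  have e2 : ∀ x, (w x ^ (1 / 2 : ℝ)) ^ (2 : ℝ) = w x := fun x => by
    rw [← ENNReal.rpow_mul]; norm_num
  have e3 : ∀ x, (w x ^ (1 / 2 : ℝ) * f x) ^ (2 : ℝ) = w x * f x ^ 2 := fun x => by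
    rw [ENNReal.mul_rpow_of_nonneg _ _ (by norm_num), e2, ENNReal.rpow_two]
  simp only [Pi.mul_apply, e1, e2, e3] at h
  calc _ ≤ ((∫⁻ x, w x ∂μ) ^ (1 / 2 : ℝ) * (∫⁻ x, w x * f x ^ 2 ∂μ) ^ (1 / 2 : ℝ)) ^ 2 := by
        gcongr
    _ = _ := by
        rw [mul_pow, ← ENNReal.rpow_two, ← ENNReal.rpow_two, ← ENNReal.rpow_mul,
          ← ENNReal.rpow_mul]
        norm_num

theorem tsum_mul_sq_le {ι : Type*} (w f : ι → ℝ≥0∞) :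
    (∑' i, w i * f i) ^ 2 ≤ (∑' i, w i) * ∑' i, w i * f i ^ 2 := by
  let _ : MeasurableSpace ι := ⊤
  simpa only [lintegral_count] using
    lintegral_mul_sq_le (Measure.count : Measure ι) (measurable_from_top (f := w)).aemeasurable
      (measurable_from_top (f := f)).aemeasurable

/-- Young's inequality `ℓ¹ * ℓ² ⊆ ℓ²` on `ℤ`. -/
theorem tsum_conv_sq_le (a x : ℤ → ℝ≥0∞) :
    ∑' k, (∑' j, a (k - j) * x j) ^ 2 ≤ (∑' m, a m) ^ 2 * ∑' j, x j ^ 2 := by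
  have h1 : ∀ k, ∑' j, a (k - j) = ∑' m, a m := fun k =>
    (Equiv.subLeft k).tsum_eq a
  have h2 : ∀ j, ∑' k, a (k - j) = ∑' m, a m := fun j =>
    (Equiv.subRight j).tsum_eq a
  calc _ ≤ ∑' k, (∑' m, a m) * ∑' j, a (k - j) * x j ^ 2 := by
        refine ENNReal.tsum_le_tsum fun k => ?_
        rw [← h1 k]
        exact tsum_mul_sq_le _ _
    _ = (∑' m, a m) * ∑' j, (∑' k, a (k - j)) * x j ^ 2 := by
        rw [ENNReal.tsum_mul_left, ENNReal.tsum_comm]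
        simp only [ENNReal.tsum_mul_right]
    _ = _ := by
        simp only [h2, ENNReal.tsum_mul_left]
        rw [← mul_assoc, ← pow_two]

/-- The factor `a - b` is a difference of resolvents in the application; the other factor is a
sum of products of `ρ = a, b` with `e = 1 - a, 1 - b`. -/
theorem cubic_sub_cubic {R : Type*} [Ring R] {a b : R} (h : b * a = a * b) :
    (a * a * (3 - 2 * a)) - (b * b * (3 - 2 * b)) =
      (a * (1 - a) + a * (1 - a) + (b * (1 - b) + b * (1 - b)) + a * (1 - b) + b * (1 - a)) *
        (a - b) := by
  have h' : ∀ x, b * (a * x) = a * (b * x) := fun x => by rw [← mul_assoc, h, mul_assoc]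
  have e3 : (3 : R) = 1 + 1 + 1 := by norm_num
  have e2 : (2 : R) = 1 + 1 := by norm_num
  rw [e3, e2]
  simp only [mul_add, add_mul, mul_sub, sub_mul, mul_one, one_mul, mul_assoc, h, h']
  abel

/-- The constant of the square function estimate of order `θ` for an operator with constant `C`
in the moment inequality. -/
noncomputable def squareConst (θ C : ℝ) : ℝ :=
  (24 * C * ∑' m : ℤ, ((2 : ℝ) ^ (-(min θ (1 - θ)))) ^ m.natAbs) ^ 2

theorem summable_pow_natAbs {r : ℝ} (h0 : 0 ≤ r) (h1 : r < 1) :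
    Summable fun m : ℤ => r ^ m.natAbs := by
  refine Summable.of_nat_of_neg ?_ ?_ <;> simpa using summable_geometric_of_lt_one h0 h1

section

variable {H : Type*} [NormedAddCommGroup H] [InnerProductSpace ℝ H] [CompleteSpace H]
  {V J : H →L[ℝ] H} {θ C : ℝ}

/-- The moment inequality `‖J x‖ ≤ C (δ^θ ‖x‖ + δ^{θ-1} ‖V x‖)`, expressing that `J` behaves like
the fractional power `V^θ`. -/
def MomentBound (V J : H →L[ℝ] H) (θ C : ℝ) : Prop :=
  ∀ δ : ℝ, 0 < δ → ∀ x, ‖J x‖ ≤ C * (δ ^ θ * ‖x‖ + δ ^ (θ - 1) * ‖V x‖)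

/-- The moment inequality at the scale `s'` of the factor `e_{s'}`; the bound is useful for large
`t`. -/
theorem Accretive.norm_resE_J_le_small (hV : Accretive V) (hJ : Commute J V) (hC : 0 ≤ C)
    (hm : MomentBound V J θ C) {t s s' : ℝ} (ht : 0 < t) (hs : 0 < s) (hs' : 0 < s') (y : H) :
    ‖resE V t (J (resR V s (resE V s' y)))‖ ≤ 2 * C * s' ^ θ * ‖y‖ := by
  have hc : ∀ z, resE V t (J z) = J (resE V t z) := fun z =>
    congrArg (fun W : H →L[ℝ] H => W z) (commute_resE_right hJ t).eq.symm
  have hcE : ∀ z, V (resE V t z) = resE V t (V z) := fun z =>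
    congrArg (fun W : H →L[ℝ] H => W z) (commute_resE_right (Commute.refl V) t).eq
  have hcR : ∀ z, V (resR V s z) = resR V s (V z) := fun z =>
    congrArg (fun W : H →L[ℝ] H => W z) (commute_resR_right (Commute.refl V) s).eq
  rw [hc]
  have h1 : ‖resE V t (resR V s (resE V s' y))‖ ≤ ‖y‖ :=
    (hV.norm_resE_apply_le ht _).trans
      ((hV.norm_resR_apply_le hs _).trans (hV.norm_resE_apply_le hs' _))
  have h2 : ‖V (resE V t (resR V s (resE V s' y)))‖ ≤ s' * ‖y‖ := by
    rw [hcE, hcR]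
    exact (hV.norm_resE_apply_le ht _).trans
      ((hV.norm_resR_apply_le hs _).trans (hV.norm_apply_resE_le hs' _))
  have e : s' ^ (θ - 1) * s' = s' ^ θ := by
    rw [Real.rpow_sub_one hs'.ne']; field_simp
  calc _ ≤ C * (s' ^ θ * _ + s' ^ (θ - 1) * _) := hm s' hs' _
    _ ≤ C * (s' ^ θ * ‖y‖ + s' ^ (θ - 1) * (s' * ‖y‖)) := by gcongr
    _ = _ := by rw [← mul_assoc (s' ^ (θ - 1)), e]; ring

/-- The factor `e_t` is moved past `ρ_s` with a gain of `t / s`, and the moment inequality is used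
at the scale `s`; the bound is useful for small `t`. -/
theorem Accretive.norm_resE_J_le_large (hV : Accretive V) (hJ : Commute J V) (hC : 0 ≤ C)
    (hm : MomentBound V J θ C) {t s s' : ℝ} (ht : 0 < t) (hs : 0 < s) (hs' : 0 < s') (y : H) :
    ‖resE V t (J (resR V s (resE V s' y)))‖ ≤ 2 * C * (t * s ^ (θ - 1)) * ‖y‖ := by
  have hc : ∀ z, resE V t (J z) = J (resE V t z) := fun z =>
    congrArg (fun W : H →L[ℝ] H => W z) (commute_resE_right hJ t).eq.symm
  have hcR : ∀ z, V (resR V t z) = resR V t (V z) := fun z =>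
    congrArg (fun W : H →L[ℝ] H => W z) (commute_resR_right (Commute.refl V) t).eq
  have hER : ∀ z, resE V t (resR V s z) = (t / s) • resR V t (resE V s z) := fun z =>
    congrArg (fun W : H →L[ℝ] H => W z) (resE_mul_resR (V := V) (t := t) hs.ne')
  rw [hc, hER]
  have hts : 0 < t / s := by positivity
  have h1 : ‖(t / s) • resR V t (resE V s (resE V s' y))‖ ≤ t / s * ‖y‖ := by
    rw [norm_smul, Real.norm_of_nonneg hts.le]
    gcongr
    exact (hV.norm_resR_apply_le ht _).trans
      ((hV.norm_resE_apply_le hs _).trans (hV.norm_resE_apply_le hs' _))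
  have h2 : ‖V ((t / s) • resR V t (resE V s (resE V s' y)))‖ ≤ t / s * (s * ‖y‖) := by
    rw [map_smul, norm_smul, Real.norm_of_nonneg hts.le, hcR]
    gcongr
    refine (hV.norm_resR_apply_le ht _).trans ((hV.norm_apply_resE_le hs _).trans ?_)
    gcongr
    exact hV.norm_resE_apply_le hs' _
  calc _ ≤ C * (s ^ θ * _ + s ^ (θ - 1) * _) := hm s hs _
    _ ≤ C * (s ^ θ * (t / s * ‖y‖) + s ^ (θ - 1) * (t / s * (s * ‖y‖))) := by gcongr
    _ = _ := by
      rw [Real.rpow_sub_one hs.ne']; field_simp; ring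

/-- Almost orthogonality: at scales `2^k` and `2^j` the interaction decays geometrically
in `|k - j|`. -/
theorem Accretive.norm_resE_J_le_decay (hV : Accretive V) (hJ : Commute J V) (hC : 0 ≤ C)
    (hm : MomentBound V J θ C) (hθ0 : 0 < θ) (hθ1 : θ < 1) (k j : ℤ) {s s' : ℝ}
    (hs : (2 : ℝ) ^ j ≤ s) (hs' : 0 < s') (hs2 : s' ≤ 2 * 2 ^ j) (y : H) :
    ((2 : ℝ) ^ k) ^ (-θ) * ‖resE V (2 ^ k) (J (resR V s (resE V s' y)))‖ ≤
      4 * C * ((2 : ℝ) ^ (-(min θ (1 - θ)))) ^ (k - j).natAbs * ‖y‖ := by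
  have hk : (0 : ℝ) < 2 ^ k := by positivity
  have hj : (0 : ℝ) < 2 ^ j := by positivity
  have hs0 : 0 < s := hj.trans_le hs
  have z2 : ∀ (m : ℤ) (x : ℝ), ((2 : ℝ) ^ m) ^ x = 2 ^ (m * x) := fun m x => by
    rw [← Real.rpow_intCast, ← Real.rpow_mul (by norm_num)]
  have n2 : ∀ (m : ℕ) (x : ℝ), ((2 : ℝ) ^ x) ^ m = 2 ^ (m * x) := fun m x => by
    rw [← Real.rpow_natCast, ← Real.rpow_mul (by norm_num), mul_comm]
  rcases le_total j k with hjk | hjk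
  · have hn : (((k - j).natAbs : ℕ) : ℝ) = (k : ℝ) - j := by
      rw [Nat.cast_natAbs, abs_of_nonneg (by lia)]; push_cast; ring
    have hkj : (0 : ℝ) ≤ (k : ℝ) - j := by rw [← hn]; positivity
    have h1 : s' ^ θ ≤ 2 * (2 ^ j) ^ θ := by
      calc s' ^ θ ≤ (2 * 2 ^ j) ^ θ := Real.rpow_le_rpow hs'.le hs2 hθ0.le
        _ = 2 ^ θ * (2 ^ j) ^ θ := Real.mul_rpow (by norm_num) hj.le
        _ ≤ 2 ^ (1 : ℝ) * (2 ^ j) ^ θ := by gcongr; norm_num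
        _ = _ := by rw [Real.rpow_one]
    have h2 : ((2 : ℝ) ^ k) ^ (-θ) * (2 ^ j) ^ θ ≤
        ((2 : ℝ) ^ (-(min θ (1 - θ)))) ^ (k - j).natAbs := by
      rw [z2, z2, n2, ← Real.rpow_add (by norm_num), hn]
      refine Real.rpow_le_rpow_of_exponent_le (by norm_num) ?_
      nlinarith [min_le_left θ (1 - θ)]
    calc _ ≤ ((2 : ℝ) ^ k) ^ (-θ) * (2 * C * (2 * (2 ^ j) ^ θ) * ‖y‖) := by
          gcongr
          refine (hV.norm_resE_J_le_small hJ hC hm hk hs0 hs' y).trans ?_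
          gcongr
      _ = 4 * C * (((2 : ℝ) ^ k) ^ (-θ) * (2 ^ j) ^ θ) * ‖y‖ := by ring
      _ ≤ _ := by gcongr
  · have hn : (((k - j).natAbs : ℕ) : ℝ) = (j : ℝ) - k := by
      rw [Nat.cast_natAbs, abs_of_nonpos (by lia)]; push_cast; ring
    have hkj : (0 : ℝ) ≤ (j : ℝ) - k := by rw [← hn]; positivity
    have h1 : s ^ (θ - 1) ≤ (2 ^ j) ^ (θ - 1) :=
      Real.rpow_le_rpow_of_nonpos hj hs (by linarith)
    have h2 : ((2 : ℝ) ^ k) ^ (-θ) * (2 ^ k * (2 ^ j) ^ (θ - 1)) ≤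
        ((2 : ℝ) ^ (-(min θ (1 - θ)))) ^ (k - j).natAbs := by
      have e : (2 : ℝ) ^ k = 2 ^ ((k : ℝ)) := (Real.rpow_intCast 2 k).symm
      rw [z2, z2, n2, e, ← Real.rpow_add (by norm_num), ← Real.rpow_add (by norm_num), hn]
      refine Real.rpow_le_rpow_of_exponent_le (by norm_num) ?_
      nlinarith [min_le_right θ (1 - θ)]
    calc _ ≤ ((2 : ℝ) ^ k) ^ (-θ) * (2 * C * (2 ^ k * (2 ^ j) ^ (θ - 1)) * ‖y‖) := by
          gcongr
          refine (hV.norm_resE_J_le_large hJ hC hm hk hs0 hs' y).trans ?_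
          gcongr
      _ = 2 * C * (((2 : ℝ) ^ k) ^ (-θ) * (2 ^ k * (2 ^ j) ^ (θ - 1))) * ‖y‖ := by ring
      _ ≤ 2 * C * ((2 : ℝ) ^ (-(min θ (1 - θ)))) ^ (k - j).natAbs * ‖y‖ := by gcongr
      _ ≤ _ := by gcongr; norm_num

/-- The difference `ρ_t - ρ_{2t}` at `t = 2^j`. -/
noncomputable def resD (V : H →L[ℝ] H) (j : ℤ) : H →L[ℝ] H :=
  resR V (2 ^ j) - resR V (2 * 2 ^ j)

/-- `3 ρ_t² - 2 ρ_t³` at `t = 2^j`; it interpolates between `1` (`j → -∞`) and `0` (`j → ∞`), and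
its increments factor through `resD`. -/
noncomputable def resF (V : H →L[ℝ] H) (j : ℤ) : H →L[ℝ] H :=
  resR V (2 ^ j) * resR V (2 ^ j) * (3 - 2 * resR V (2 ^ j))

theorem two_zpow_add_one (j : ℤ) : (2 : ℝ) ^ (j + 1) = 2 * 2 ^ j := by
  rw [zpow_add_one₀ (by norm_num), mul_comm]

theorem Accretive.norm_resE_J_resF_sub_le (hV : Accretive V) (hJ : Commute J V) (hC : 0 ≤ C)
    (hm : MomentBound V J θ C) (hθ0 : 0 < θ) (hθ1 : θ < 1) (k j : ℤ) (g : H) :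
    ((2 : ℝ) ^ k) ^ (-θ) * ‖resE V (2 ^ k) (J ((resF V j - resF V (j + 1)) g))‖ ≤
      24 * C * ((2 : ℝ) ^ (-(min θ (1 - θ)))) ^ (k - j).natAbs * ‖resD V j g‖ := by
  have hj : (0 : ℝ) < 2 ^ j := by positivity
  have e1 : resE V (2 ^ j) = 1 - resR V (2 ^ j) := by
    rw [← hV.resR_add_resE hj]; abel
  have e2 : resE V (2 * 2 ^ j) = 1 - resR V (2 * 2 ^ j) := by
    rw [← hV.resR_add_resE (t := 2 * 2 ^ j) (by positivity)]; abel
  have h := cubic_sub_cubic (commute_resR_resR (V := V) (2 * 2 ^ j) (2 ^ j)).eq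
  rw [← e1, ← e2] at h
  have h' : (resF V j - resF V (j + 1)) g =
      resR V (2 ^ j) (resE V (2 ^ j) (resD V j g)) + resR V (2 ^ j) (resE V (2 ^ j) (resD V j g)) +
      (resR V (2 * 2 ^ j) (resE V (2 * 2 ^ j) (resD V j g)) +
        resR V (2 * 2 ^ j) (resE V (2 * 2 ^ j) (resD V j g))) +
      resR V (2 ^ j) (resE V (2 * 2 ^ j) (resD V j g)) +
      resR V (2 * 2 ^ j) (resE V (2 ^ j) (resD V j g)) := by
    rw [resF, resF, two_zpow_add_one, h]; rfl
  set y := resD V j g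
  rw [h']
  simp only [map_add]
  have b := fun (s s' : ℝ) (hs : (2 : ℝ) ^ j ≤ s) (hs' : 0 < s') (hs2 : s' ≤ 2 * 2 ^ j) =>
    hV.norm_resE_J_le_decay hJ hC hm hθ0 hθ1 k j hs hs' hs2 y
  have i1 : (2 : ℝ) ^ j ≤ 2 * 2 ^ j := by linarith
  have b1 := b (2 ^ j) (2 ^ j) le_rfl hj i1
  have b2 := b (2 * 2 ^ j) (2 * 2 ^ j) i1 (by positivity) le_rfl
  have b3 := b (2 ^ j) (2 * 2 ^ j) le_rfl (by positivity) le_rfl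
  have b4 := b (2 * 2 ^ j) (2 ^ j) i1 hj i1
  set A := resE V (2 ^ k) (J (resR V (2 ^ j) (resE V (2 ^ j) y)))
  set B := resE V (2 ^ k) (J (resR V (2 * 2 ^ j) (resE V (2 * 2 ^ j) y)))
  set D := resE V (2 ^ k) (J (resR V (2 ^ j) (resE V (2 * 2 ^ j) y)))
  set E := resE V (2 ^ k) (J (resR V (2 * 2 ^ j) (resE V (2 ^ j) y)))
  have hn : ‖A + A + (B + B) + D + E‖ ≤ ‖A‖ + ‖A‖ + (‖B‖ + ‖B‖) + ‖D‖ + ‖E‖ := by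
    refine (norm_add_le _ _).trans (add_le_add_left ((norm_add_le _ _).trans
      (add_le_add_left ((norm_add_le _ _).trans (add_le_add (norm_add_le _ _)
        (norm_add_le _ _))) _)) _)
  have hp : 0 ≤ ((2 : ℝ) ^ k) ^ (-θ) := by positivity
  have := mul_le_mul_of_nonneg_left hn hp
  linarith

theorem Accretive.sum_norm_resD_sq_le (hV : Accretive V) (m : ℤ) (N : ℕ) (g : H) :
    ∑ i ∈ Finset.range N, ‖resD V (m + i) g‖ ^ 2 ≤ ‖g‖ ^ 2 := by
  have h : ∀ i ∈ Finset.range N, ‖resD V (m + i) g‖ ^ 2 ≤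
      ‖resR V (2 ^ (m + (i : ℤ))) g‖ ^ 2 - ‖resR V (2 ^ (m + ((i + 1 : ℕ) : ℤ))) g‖ ^ 2 := by
    intro i _
    have h1 := hV.three_mul_norm_sq_le (t := 2 ^ (m + (i : ℤ))) (by positivity) g
    rw [← two_zpow_add_one, add_assoc] at h1
    rw [resD, ← two_zpow_add_one, add_assoc]
    rw [Nat.cast_add, Nat.cast_one]
    nlinarith [sq_nonneg ‖(resR V (2 ^ (m + (i : ℤ))) - resR V (2 ^ (m + ((i : ℤ) + 1)))) g‖]
  refine (Finset.sum_le_sum h).trans ?_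
  rw [Finset.sum_range_sub' (fun i : ℕ => ‖resR V (2 ^ (m + (i : ℤ))) g‖ ^ 2)]
  have h2 := hV.norm_resR_apply_le (t := 2 ^ (m + ((0 : ℕ) : ℤ))) (by positivity) g
  have h3 := pow_le_pow_left₀ (norm_nonneg _) h2 2
  linarith [sq_nonneg ‖resR V (2 ^ (m + (N : ℤ))) g‖]

theorem ENNReal_tsum_int_le {f : ℤ → ℝ≥0∞} {c : ℝ≥0∞}
    (h : ∀ (m : ℤ) (N : ℕ), ∑ i ∈ Finset.range N, f (m + i) ≤ c) : ∑' j, f j ≤ c := by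
  rw [ENNReal.tsum_eq_iSup_sum]
  refine iSup_le fun s => ?_
  obtain ⟨M, hM⟩ : ∃ M : ℕ, ∀ x ∈ s, x.natAbs ≤ M :=
    ⟨s.sup Int.natAbs, fun x hx => Finset.le_sup (f := Int.natAbs) hx⟩
  refine le_trans ?_ (h (-M) (2 * M + 1))
  have e : ∑ i ∈ Finset.range (2 * M + 1), f (-M + i) =
      ∑ j ∈ (Finset.range (2 * M + 1)).image (fun i : ℕ => (-M + i : ℤ)), f j := by
    rw [Finset.sum_image]
    intro a _ b _ hab
    simpa using hab
  rw [e]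
  refine Finset.sum_le_sum_of_subset fun x hx => ?_
  have := hM x hx
  rw [Finset.mem_image]
  exact ⟨(x + M).toNat, by rw [Finset.mem_range]; lia, by lia⟩

theorem Accretive.tsum_enorm_resD_sq_le (hV : Accretive V) (g : H) :
    ∑' j : ℤ, ‖resD V j g‖ₑ ^ 2 ≤ ‖g‖ₑ ^ 2 := by
  refine ENNReal_tsum_int_le fun m N => ?_
  have h := ENNReal.ofReal_le_ofReal (hV.sum_norm_resD_sq_le m N g)
  rw [ENNReal.ofReal_sum_of_nonneg fun i _ => sq_nonneg _] at h
  simpa only [ENNReal.ofReal_pow (norm_nonneg _), ofReal_norm] using h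

theorem Accretive.tendsto_resF_atTop (hV : Accretive V) (g : H) :
    Tendsto (fun N : ℕ => resF V (N : ℤ) g) atTop (𝓝 0) := by
  have h : ∀ N : ℕ, resF V (N : ℤ) g =
      resR V (2 ^ (N : ℤ)) (3 • resR V (2 ^ (N : ℤ)) g -
        2 • resR V (2 ^ (N : ℤ)) (resR V (2 ^ (N : ℤ)) g)) := by
    intro N
    set R := resR V (2 ^ (N : ℤ))
    have e : resF V (N : ℤ) = R * (3 • R - 2 • (R * R)) := by
      rw [resF]; noncomm_ring
    rw [e]; rfl
  have h1 := hV.tendsto_resR_zpow g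
  rw [tendsto_zero_iff_norm_tendsto_zero] at h1 ⊢
  refine squeeze_zero (fun _ => norm_nonneg _) (fun N => ?_)
    (by simpa using h1.const_mul 5)
  rw [h]
  have hp : (0 : ℝ) < 2 ^ (N : ℤ) := by positivity
  refine (hV.norm_resR_apply_le hp _).trans ((norm_sub_le _ _).trans ?_)
  rw [← Nat.cast_smul_eq_nsmul ℝ, ← Nat.cast_smul_eq_nsmul ℝ, norm_smul, norm_smul]
  have := hV.norm_resR_apply_le hp (resR V (2 ^ (N : ℤ)) g)
  norm_num at this ⊢
  linarith

theorem Accretive.tendsto_resF_atBot (hV : Accretive V) (hd : DenseRange V) (g : H) :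
    Tendsto (fun N : ℕ => resF V (-(N : ℤ)) g) atTop (𝓝 g) := by
  have h : ∀ N : ℕ, g - resF V (-(N : ℤ)) g =
      resE V (2 ^ (-(N : ℤ))) (resE V (2 ^ (-(N : ℤ))) g +
        2 • resR V (2 ^ (-(N : ℤ))) (resE V (2 ^ (-(N : ℤ))) g)) := by
    intro N
    have e1 := hV.resR_add_resE (t := 2 ^ (-(N : ℤ))) (by positivity)
    set R := resR V (2 ^ (-(N : ℤ))) with hR
    set E := resE V (2 ^ (-(N : ℤ)))
    have e2 : E = 1 - R := by rw [← e1]; abel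
    have e : 1 - resF V (-(N : ℤ)) = E * (E + 2 • (R * E)) := by
      rw [resF, ← hR, e2]; noncomm_ring
    have e3 := congrArg (fun W : H →L[ℝ] H => W g) e
    exact e3
  have h1 := hV.tendsto_resE_zpow hd g
  have h2 : Tendsto (fun N : ℕ => g - resF V (-(N : ℤ)) g) atTop (𝓝 0) := by
    rw [tendsto_zero_iff_norm_tendsto_zero] at h1 ⊢
    refine squeeze_zero (fun _ => norm_nonneg _) (fun N => ?_)
      (by simpa using h1.const_mul 3)
    rw [h]
    have hp : (0 : ℝ) < 2 ^ (-(N : ℤ)) := by positivity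
    refine (hV.norm_resE_apply_le hp _).trans ((norm_add_le _ _).trans ?_)
    rw [← Nat.cast_smul_eq_nsmul ℝ, norm_smul]
    have := hV.norm_resR_apply_le hp (resE V (2 ^ (-(N : ℤ))) g)
    norm_num at this ⊢
    linarith
  have h3 := h2.const_sub g
  simpa using h3

/-- The square function estimate `∑ₖ (2^{-kθ} ‖e_{2^k} J g‖)² ≤ K ‖g‖²`, where `J` behaves
like `V^θ`. -/
theorem Accretive.tsum_square_function_le (hV : Accretive V) (hd : DenseRange V)
    (hJ : Commute J V) (hC : 0 ≤ C) (hm : MomentBound V J θ C) (hθ0 : 0 < θ) (hθ1 : θ < 1)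
    (g : H) :
    ∑' k : ℤ, (ENNReal.ofReal (((2 : ℝ) ^ k) ^ (-θ)) * ‖resE V (2 ^ k) (J g)‖ₑ) ^ 2 ≤
      ENNReal.ofReal (squareConst θ C) * ‖g‖ₑ ^ 2 := by
  set r := (2 : ℝ) ^ (-(min θ (1 - θ))) with hr
  have hr0 : 0 ≤ r := by positivity
  have hr1 : r < 1 := Real.rpow_lt_one_of_one_lt_of_neg (by norm_num)
    (by rw [neg_lt_zero]; exact lt_min hθ0 (by linarith))
  set a : ℤ → ℝ≥0∞ := fun m => ENNReal.ofReal (24 * C * r ^ m.natAbs) with ha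
  have hsum : (∑' m, a m) ^ 2 = ENNReal.ofReal (squareConst θ C) := by
    rw [squareConst, ← ENNReal.ofReal_tsum_of_nonneg (fun m => by positivity)
      ((summable_pow_natAbs hr0 hr1).mul_left _), tsum_mul_left, ENNReal.ofReal_pow]
    have : 0 ≤ ∑' m : ℤ, r ^ m.natAbs := tsum_nonneg fun m => by positivity
    positivity
  have key : ∀ k : ℤ, ENNReal.ofReal (((2 : ℝ) ^ k) ^ (-θ)) * ‖resE V (2 ^ k) (J g)‖ₑ ≤
      ∑' j, a (k - j) * ‖resD V j g‖ₑ := by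
    intro k
    have hlim : Tendsto (fun N : ℕ => ENNReal.ofReal (((2 : ℝ) ^ k) ^ (-θ)) *
        ‖resE V (2 ^ k) (J (resF V (-(N : ℤ)) g - resF V (N : ℤ) g))‖ₑ) atTop
        (𝓝 (ENNReal.ofReal (((2 : ℝ) ^ k) ^ (-θ)) * ‖resE V (2 ^ k) (J g)‖ₑ)) := by
      refine ENNReal.Tendsto.const_mul ?_ (Or.inr ENNReal.ofReal_ne_top)
      have h1 := (hV.tendsto_resF_atBot hd g).sub (hV.tendsto_resF_atTop g)
      rw [sub_zero] at h1
      exact ((((resE V (2 ^ k)).comp J).continuous.tendsto g).comp h1).enorm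
    refine le_of_tendsto hlim (Eventually.of_forall fun N => ?_)
    have htel : resF V (-(N : ℤ)) g - resF V (N : ℤ) g = ∑ i ∈ Finset.range (2 * N),
        (resF V (-(N : ℤ) + i) - resF V (-(N : ℤ) + i + 1)) g := by
      have h1 := Finset.sum_range_sub' (fun i : ℕ => resF V (-(N : ℤ) + i) g) (2 * N)
      have e1 : -(N : ℤ) + ((2 * N : ℕ) : ℤ) = N := by push_cast; ring
      rw [e1, Nat.cast_zero, add_zero] at h1
      rw [← h1]
      refine Finset.sum_congr rfl fun i _ => ?_
      rw [sub_apply]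
      push_cast
      rw [add_assoc]
    rw [htel, map_sum, map_sum]
    calc _ ≤ ENNReal.ofReal (((2 : ℝ) ^ k) ^ (-θ)) * ∑ i ∈ Finset.range (2 * N),
          ‖resE V (2 ^ k) (J ((resF V (-(N : ℤ) + i) - resF V (-(N : ℤ) + i + 1)) g))‖ₑ := by
          gcongr; exact enorm_sum_le _ _
      _ ≤ ∑ i ∈ Finset.range (2 * N), a (k - (-(N : ℤ) + i)) * ‖resD V (-(N : ℤ) + i) g‖ₑ := by
          rw [Finset.mul_sum]
          refine Finset.sum_le_sum fun i _ => ?_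
          have h1 := ENNReal.ofReal_le_ofReal
            (hV.norm_resE_J_resF_sub_le hJ hC hm hθ0 hθ1 k (-(N : ℤ) + i) g)
          rwa [ENNReal.ofReal_mul (by positivity), ENNReal.ofReal_mul (by positivity), ofReal_norm,
            ofReal_norm] at h1
      _ = ∑ j ∈ (Finset.range (2 * N)).image (fun i : ℕ => (-(N : ℤ) + i)),
            a (k - j) * ‖resD V j g‖ₑ := by
          rw [Finset.sum_image]
          intro x _ y _ hxy
          simpa using hxy
      _ ≤ _ := ENNReal.sum_le_tsum _
  calc _ ≤ ∑' k, (∑' j, a (k - j) * ‖resD V j g‖ₑ) ^ 2 :=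
        ENNReal.tsum_le_tsum fun k => by gcongr; exact key k
    _ ≤ (∑' m, a m) ^ 2 * ∑' j, ‖resD V j g‖ₑ ^ 2 := tsum_conv_sq_le _ _
    _ ≤ _ := by rw [hsum]; gcongr; exact hV.tsum_enorm_resD_sq_le g

end

end FracWave

namespace FracWave

/-! ### The `K`-method for the graph of an accretive operator -/

/-- The weighted norm `(∫₀^∞ (t^{-θ} K(t))² dt/t)^{1/2}` of a function `K`. -/
noncomputable def kInt (θ : ℝ) (K : ℝ → ℝ≥0∞) : ℝ≥0∞ :=
  (∫⁻ t in Ioi (0 : ℝ),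
    ENNReal.ofReal t⁻¹ * (ENNReal.ofReal (t ^ (-θ)) * K t) ^ (2 : ℝ)) ^ (1 / 2 : ℝ)

theorem kInt_sq (θ : ℝ) (K : ℝ → ℝ≥0∞) :
    kInt θ K ^ 2 = ∫⁻ t in Ioi (0 : ℝ),
      ENNReal.ofReal t⁻¹ * (ENNReal.ofReal (t ^ (-θ)) * K t) ^ 2 := by
  rw [kInt, ← ENNReal.rpow_two, ← ENNReal.rpow_mul]
  simp

theorem kInt_mono {θ : ℝ} {K K' : ℝ → ℝ≥0∞} (h : ∀ t, 0 < t → K t ≤ K' t) :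
    kInt θ K ≤ kInt θ K' := by
  refine ENNReal.rpow_le_rpow (setLIntegral_mono' measurableSet_Ioi fun t ht => ?_) (by norm_num)
  gcongr
  exact h t ht

theorem iUnion_Ico_two_zpow : ⋃ k : ℤ, Ico ((2 : ℝ) ^ k) (2 ^ (k + 1)) = Ioi 0 := by
  ext x
  simp only [mem_iUnion, mem_Ioi]
  constructor
  · rintro ⟨k, hk, -⟩
    exact lt_of_lt_of_le (by positivity) hk
  · intro hx
    exact exists_mem_Ico_zpow hx (by norm_num)

theorem lintegral_Ioi_eq_tsum (F : ℝ → ℝ≥0∞) :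
    ∫⁻ t in Ioi (0 : ℝ), F t = ∑' k : ℤ, ∫⁻ t in Ico ((2 : ℝ) ^ k) (2 ^ (k + 1)), F t := by
  rw [← iUnion_Ico_two_zpow, lintegral_iUnion (fun _ => measurableSet_Ico)]
  exact (zpow_right_mono₀ (a := (2 : ℝ)) (by norm_num)).pairwise_disjoint_on_Ico_succ

theorem volume_Ico_two_zpow (k : ℤ) :
    volume (Ico ((2 : ℝ) ^ k) (2 ^ (k + 1))) = ENNReal.ofReal (2 ^ k) := by
  rw [Real.volume_Ico, two_zpow_add_one]
  congr 1; ring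

theorem kInt_sq_le_tsum {θ : ℝ} (hθ : 0 ≤ θ) {K : ℝ → ℝ≥0∞} (hK : Monotone K) :
    kInt θ K ^ 2 ≤ ∑' k : ℤ, (ENNReal.ofReal (((2 : ℝ) ^ k) ^ (-θ)) * K (2 ^ (k + 1))) ^ 2 := by
  rw [kInt_sq, lintegral_Ioi_eq_tsum]
  refine ENNReal.tsum_le_tsum fun k => ?_
  have hk : (0 : ℝ) < 2 ^ k := by positivity
  calc _ ≤ ∫⁻ _ in Ico ((2 : ℝ) ^ k) (2 ^ (k + 1)), ENNReal.ofReal ((2 : ℝ) ^ k)⁻¹ *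
        (ENNReal.ofReal (((2 : ℝ) ^ k) ^ (-θ)) * K (2 ^ (k + 1))) ^ 2 := by
        refine setLIntegral_mono' measurableSet_Ico fun t ht => ?_
        gcongr ENNReal.ofReal ?_ * (ENNReal.ofReal ?_ * ?_) ^ 2
        · exact inv_anti₀ hk ht.1
        · exact Real.rpow_le_rpow_of_nonpos hk ht.1 (by linarith)
        · exact hK ht.2.le
    _ = _ := by
        rw [setLIntegral_const, volume_Ico_two_zpow, mul_right_comm, ← ENNReal.ofReal_mul
          (by positivity), inv_mul_cancel₀ hk.ne', ENNReal.ofReal_one, one_mul]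

theorem tsum_le_kInt_sq {θ : ℝ} (hθ : 0 ≤ θ) (hθ1 : θ ≤ 1) {K : ℝ → ℝ≥0∞} (hK : Monotone K) :
    ∑' k : ℤ, (ENNReal.ofReal (((2 : ℝ) ^ k) ^ (-θ)) * K (2 ^ k)) ^ 2 ≤ 8 * kInt θ K ^ 2 := by
  rw [kInt_sq, lintegral_Ioi_eq_tsum, ← ENNReal.tsum_mul_left]
  refine ENNReal.tsum_le_tsum fun k => ?_
  have hk : (0 : ℝ) < 2 ^ k := by positivity
  have h2 : ((2 : ℝ) ^ k) ^ (-θ) ≤ 2 * ((2 : ℝ) ^ (k + 1)) ^ (-θ) := by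
    rw [two_zpow_add_one, Real.mul_rpow (by norm_num) hk.le, ← mul_assoc]
    refine le_mul_of_one_le_left (by positivity) ?_
    have e : (2 : ℝ) * 2 ^ (-θ) = 2 ^ (1 + -θ) := by
      rw [Real.rpow_add (by norm_num), Real.rpow_one]
    rw [e]
    exact Real.one_le_rpow (by norm_num) (by linarith)
  have h3 : ENNReal.ofReal ((2 : ℝ) ^ (k + 1))⁻¹ * ENNReal.ofReal (2 ^ k) =
      ENNReal.ofReal (1 / 2) := by
    rw [← ENNReal.ofReal_mul (by positivity), two_zpow_add_one]
    congr 1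
    field_simp
  calc (ENNReal.ofReal (((2 : ℝ) ^ k) ^ (-θ)) * K (2 ^ k)) ^ 2
      ≤ (ENNReal.ofReal (2 * ((2 : ℝ) ^ (k + 1)) ^ (-θ)) * K (2 ^ k)) ^ 2 := by gcongr
    _ = 8 * ∫⁻ _ in Ico ((2 : ℝ) ^ k) (2 ^ (k + 1)), ENNReal.ofReal ((2 : ℝ) ^ (k + 1))⁻¹ *
        (ENNReal.ofReal (((2 : ℝ) ^ (k + 1)) ^ (-θ)) * K (2 ^ k)) ^ 2 := by
        rw [setLIntegral_const, volume_Ico_two_zpow, mul_right_comm, h3,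
          ENNReal.ofReal_mul (by norm_num), mul_assoc (ENNReal.ofReal 2), mul_pow, ← mul_assoc]
        congr 1
        rw [← ENNReal.ofReal_pow (by norm_num), ← ENNReal.ofReal_ofNat 8,
          ← ENNReal.ofReal_mul (by norm_num)]
        norm_num
    _ ≤ _ := by
        gcongr 8 * ?_
        refine setLIntegral_mono' measurableSet_Ico fun t ht => ?_
        have ht0 : 0 < t := hk.trans_le ht.1
        gcongr ENNReal.ofReal ?_ * (ENNReal.ofReal ?_ * ?_) ^ 2
        · exact inv_anti₀ ht0 ht.2.le
        · exact Real.rpow_le_rpow_of_nonpos ht0 ht.2.le (by linarith)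
        · exact hK ht.1

section

variable {H : Type*} [NormedAddCommGroup H] [InnerProductSpace ℝ H]

/-- The `K`-functional of the pair `H`, `range V`, where `V x` has norm `‖x‖` in the second
space. -/
noncomputable def kOp (V : H →L[ℝ] H) (v : H) (t : ℝ) : ℝ≥0∞ :=
  ⨅ x : H, ‖v - V x‖ₑ + ENNReal.ofReal t * ‖x‖ₑ

theorem kOp_mono (V : H →L[ℝ] H) (v : H) : Monotone (kOp V v) := by
  intro s t hst
  simp only [kOp]
  gcongr

variable [CompleteSpace H] {V J : H →L[ℝ] H} {θ C : ℝ}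

/-- With the splitting `v = e_t v + ρ_t v` at each scale, the `K`-functional is controlled by the
square function. -/
theorem Accretive.kOp_le (hV : Accretive V) {t : ℝ} (ht : 0 < t) (v : H) :
    kOp V v (2 * t) ≤ 3 * ‖resE V t v‖ₑ := by
  refine (iInf_le _ (Ring.inverse (V + t • (1 : H →L[ℝ] H)) v)).trans ?_
  have h := hV.apply_resE ht v
  have e : v - V (Ring.inverse (V + t • (1 : H →L[ℝ] H)) v) = resE V t v := by
    nth_rewrite 1 [← h]; rw [add_sub_cancel_left]; rfl
  have e2 : ENNReal.ofReal t * ‖Ring.inverse (V + t • (1 : H →L[ℝ] H)) v‖ₑ = ‖resE V t v‖ₑ := by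
    rw [← Real.enorm_of_nonneg ht.le, ← enorm_smul]; rfl
  rw [e, ENNReal.ofReal_mul (by norm_num), mul_assoc, e2, ENNReal.ofReal_ofNat]
  exact le_of_eq (by ring)

/-- The range of `J ≈ V^θ` embeds into the interpolation space between `H` and `range V`. -/
theorem Accretive.kInt_kOp_le (hV : Accretive V) (hd : DenseRange V)
    (hJ : Commute J V) (hC : 0 ≤ C) (hm : MomentBound V J θ C) (hθ0 : 0 < θ) (hθ1 : θ < 1)
    (g : H) :
    kInt θ (kOp V (J g)) ≤ ENNReal.ofReal (3 * √(squareConst θ C)) * ‖g‖ₑ := by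
  have h0 : 0 ≤ squareConst θ C := sq_nonneg _
  rw [← ENNReal.pow_le_pow_left_iff (two_ne_zero)]
  calc _ ≤ _ := kInt_sq_le_tsum hθ0.le (kOp_mono V (J g))
    _ ≤ ∑' k : ℤ, 9 * (ENNReal.ofReal (((2 : ℝ) ^ k) ^ (-θ)) * ‖resE V (2 ^ k) (J g)‖ₑ) ^ 2 := by
        refine ENNReal.tsum_le_tsum fun k => ?_
        have h := hV.kOp_le (t := 2 ^ k) (by positivity) (J g)
        rw [← two_zpow_add_one] at h
        calc _ ≤ (ENNReal.ofReal (((2 : ℝ) ^ k) ^ (-θ)) * (3 * ‖resE V (2 ^ k) (J g)‖ₑ)) ^ 2 := by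
              gcongr
          _ = _ := by rw [← mul_assoc, mul_comm _ (3 : ℝ≥0∞), mul_assoc, mul_pow]; norm_num
    _ ≤ 9 * (ENNReal.ofReal (squareConst θ C) * ‖g‖ₑ ^ 2) := by
        rw [ENNReal.tsum_mul_left]
        gcongr
        exact hV.tsum_square_function_le hd hJ hC hm hθ0 hθ1 g
    _ = _ := by
        rw [mul_pow, ← ENNReal.ofReal_pow (by positivity), mul_pow, Real.sq_sqrt h0,
          ENNReal.ofReal_mul (by norm_num), ← mul_assoc]
        norm_num

/-- Expansion of `h` as the telescoping sum of `(ρ_t - ρ_{2t}) h` for `V^*` over `t = 2^j`. Each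
term is tested against a splitting `v = (v - V x) + V x`, which gives the `K`-functional. -/
theorem enorm_inner_le_tsum_kOp (hV' : Accretive V.adjoint) (hd : DenseRange V.adjoint)
    (v h : H) :
    ‖inner ℝ v h‖ₑ ≤ ∑' j : ℤ, kOp V v (2 ^ j) *
      (ENNReal.ofReal ((2 : ℝ) ^ j)⁻¹ * ‖resE V.adjoint (2 ^ j) (V.adjoint h)‖ₑ) := by
  have hterm : ∀ j : ℤ, ‖inner ℝ v (resD V.adjoint j h)‖ₑ ≤ kOp V v (2 ^ j) *
      (ENNReal.ofReal ((2 : ℝ) ^ j)⁻¹ * ‖resE V.adjoint (2 ^ j) (V.adjoint h)‖ₑ) := by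
    intro j
    have hj : (0 : ℝ) < 2 ^ j := by positivity
    set t := (2 : ℝ) ^ j with ht
    set W := V.adjoint with hW
    have hq : resD W j h = resR W (2 * t) (resE W t h) :=
      congrArg (fun B : H →L[ℝ] H => B h) (hV'.resR_sub_resR_two hj)
    have hcE : ∀ (s : ℝ) z, W (resE W s z) = resE W s (W z) := fun s z =>
      congrArg (fun B : H →L[ℝ] H => B z) (commute_resE_right (Commute.refl W) s).eq
    have hcR : ∀ (s : ℝ) z, W (resR W s z) = resR W s (W z) := fun s z =>
      congrArg (fun B : H →L[ℝ] H => B z) (commute_resR_right (Commute.refl W) s).eq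
    have h1 : ‖resD W j h‖ ≤ t⁻¹ * ‖resE W t (W h)‖ := by
      have e : (2 * t) • resD W j h = resE W (2 * t) (resE W t (W h)) := by
        rw [hq, ← hcE, ← hcE]
        exact congrArg (fun B : H →L[ℝ] H => B (resE W t h)) (smul_resR (V := W) (2 * t))
      have h2 := hV'.norm_resE_apply_le (t := 2 * t) (by positivity) (resE W t (W h))
      rw [← e, norm_smul, Real.norm_of_nonneg (by positivity)] at h2
      rw [← div_eq_inv_mul, le_div_iff₀ hj]
      nlinarith [norm_nonneg (resD W j h)]
    have h2 : ‖W (resD W j h)‖ ≤ ‖resE W t (W h)‖ := by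
      rw [hq, hcR, hcE]
      exact hV'.norm_resR_apply_le (by positivity) _
    rw [kOp, ENNReal.iInf_mul' (by simp [ENNReal.mul_eq_top]) (fun _ => ⟨0⟩)]
    refine le_iInf fun x => ?_
    have h3 : |inner ℝ v (resD W j h)| ≤
        (‖v - V x‖ + t * ‖x‖) * (t⁻¹ * ‖resE W t (W h)‖) := by
      have e : inner ℝ v (resD W j h) = inner ℝ (v - V x) (resD W j h) +
          inner ℝ x (W (resD W j h)) := by
        rw [hW, ContinuousLinearMap.adjoint_inner_right, inner_sub_left]; ring
      rw [e]
      calc _ ≤ _ := abs_add_le _ _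
        _ ≤ ‖v - V x‖ * ‖resD W j h‖ + ‖x‖ * ‖W (resD W j h)‖ :=
          add_le_add (abs_real_inner_le_norm _ _) (abs_real_inner_le_norm _ _)
        _ ≤ ‖v - V x‖ * (t⁻¹ * ‖resE W t (W h)‖) + ‖x‖ * ‖resE W t (W h)‖ := by gcongr
        _ = _ := by field_simp
    have h4 := ENNReal.ofReal_le_ofReal h3
    rw [ENNReal.ofReal_mul (by positivity), ENNReal.ofReal_add (by positivity) (by positivity),
      ENNReal.ofReal_mul hj.le, ENNReal.ofReal_mul (by positivity), ofReal_norm, ofReal_norm,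
      ofReal_norm, ← Real.enorm_eq_ofReal_abs] at h4
    exact h4
  have hlim : Tendsto (fun N : ℕ => ‖inner ℝ v (resR V.adjoint (2 ^ (-(N : ℤ))) h -
      resR V.adjoint (2 ^ (N : ℤ)) h)‖ₑ) atTop (𝓝 ‖inner ℝ v h‖ₑ) := by
    have h1 : Tendsto (fun N : ℕ => resR V.adjoint (2 ^ (-(N : ℤ))) h) atTop (𝓝 h) := by
      have h2 := (hV'.tendsto_resE_zpow hd h).const_sub h
      rw [sub_zero] at h2
      refine h2.congr fun N => ?_
      have h3 := congrArg (fun B : H →L[ℝ] H => B h)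
        (hV'.resR_add_resE (t := 2 ^ (-(N : ℤ))) (by positivity))
      change _ + _ = h at h3
      nth_rewrite 1 [← h3]
      exact add_sub_cancel_right _ _
    have h4 := h1.sub (hV'.tendsto_resR_zpow h)
    rw [sub_zero] at h4
    exact ((continuous_const.inner continuous_id).tendsto h |>.comp h4).enorm
  refine le_of_tendsto hlim (Eventually.of_forall fun N => ?_)
  have htel : resR V.adjoint (2 ^ (-(N : ℤ))) h - resR V.adjoint (2 ^ (N : ℤ)) h =
      ∑ i ∈ Finset.range (2 * N), resD V.adjoint (-(N : ℤ) + i) h := by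
    have h1 := Finset.sum_range_sub' (fun i : ℕ => resR V.adjoint (2 ^ (-(N : ℤ) + i)) h) (2 * N)
    have e1 : -(N : ℤ) + ((2 * N : ℕ) : ℤ) = N := by push_cast; ring
    rw [e1, Nat.cast_zero, add_zero] at h1
    rw [← h1]
    refine Finset.sum_congr rfl fun i _ => ?_
    rw [resD, sub_apply, ← two_zpow_add_one, Nat.cast_add, Nat.cast_one, add_assoc]
  rw [htel, inner_sum]
  refine (enorm_sum_le _ _).trans ?_
  refine (Finset.sum_le_sum fun i _ => hterm _).trans ?_
  have e : ∀ f : ℤ → ℝ≥0∞, ∑ i ∈ Finset.range (2 * N), f (-(N : ℤ) + i) ≤ ∑' j, f j := by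
    intro f
    have : ∑ i ∈ Finset.range (2 * N), f (-(N : ℤ) + i) =
        ∑ j ∈ (Finset.range (2 * N)).image (fun i : ℕ => (-(N : ℤ) + i)), f j := by
      rw [Finset.sum_image]
      intro x _ y _ hxy
      simpa using hxy
    rw [this]
    exact ENNReal.sum_le_tsum _
  exact e fun j => kOp V v (2 ^ j) *
      (ENNReal.ofReal ((2 : ℝ) ^ j)⁻¹ * ‖resE V.adjoint (2 ^ j) (V.adjoint h)‖ₑ)

theorem tsum_mul_sq_le_mul_tsum_sq {ι : Type*} (f g : ι → ℝ≥0∞) :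
    (∑' i, f i * g i) ^ 2 ≤ (∑' i, f i ^ 2) * ∑' i, g i ^ 2 := by
  let _ : MeasurableSpace ι := ⊤
  have h := ENNReal.lintegral_mul_le_Lp_mul_Lq (Measure.count : Measure ι)
    Real.HolderConjugate.two_two (measurable_from_top (f := f)).aemeasurable
      (measurable_from_top (f := g)).aemeasurable
  simp only [lintegral_count, Pi.mul_apply, ENNReal.rpow_two] at h
  calc _ ≤ ((∑' i, f i ^ 2) ^ (1 / 2 : ℝ) * (∑' i, g i ^ 2) ^ (1 / 2 : ℝ)) ^ 2 := by gcongr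
    _ = _ := by
      rw [mul_pow, ← ENNReal.rpow_two, ← ENNReal.rpow_two, ← ENNReal.rpow_mul,
        ← ENNReal.rpow_mul]
      norm_num

/-- Riesz representation for a functional that is bounded with respect to `‖B h‖`. -/
theorem exists_adjoint_apply_eq {B : H →L[ℝ] H} {v : H} {M : ℝ} (hM : 0 ≤ M)
    (h : ∀ x, |inner ℝ v x| ≤ M * ‖B x‖) : ∃ g, B.adjoint g = v ∧ ‖g‖ ≤ M := by
  obtain ⟨s, hs⟩ := (B.toLinearMap.rangeRestrict).exists_rightInverse_of_surjective
    (LinearMap.range_rangeRestrict _)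
  have hs' : ∀ y, B (s y) = y := fun y => congrArg Subtype.val (LinearMap.congr_fun hs y)
  let F : (LinearMap.range B.toLinearMap) →ₗ[ℝ] ℝ := (innerSL ℝ v).toLinearMap ∘ₗ s
  have hF : ∀ y, ‖F y‖ ≤ M * ‖y‖ := fun y => by
    have := h (s y)
    rw [hs'] at this
    exact this
  obtain ⟨G, hG, hGn⟩ := exists_extension_norm_eq _ (F.mkContinuous M hF)
  refine ⟨(InnerProductSpace.toDual ℝ H).symm G, ?_, ?_⟩
  · refine ext_inner_right ℝ fun x => ?_
    rw [ContinuousLinearMap.adjoint_inner_left, InnerProductSpace.toDual_symm_apply]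
    have h1 := hG ⟨B x, ⟨x, rfl⟩⟩
    change G (B x) = inner ℝ v (s ⟨B x, ⟨x, rfl⟩⟩) at h1
    rw [h1]
    have h2 := h (s ⟨B x, ⟨x, rfl⟩⟩ - x)
    rw [map_sub, hs', sub_self, norm_zero, mul_zero, inner_sub_right] at h2
    exact sub_eq_zero.1 (abs_eq_zero.1 (le_antisymm h2 (abs_nonneg _)))
  · rw [LinearIsometryEquiv.norm_map, hGn]
    exact F.mkContinuous_norm_le hM hF

/-- The interpolation space between `H` and `range V` embeds into the range of `J ≈ V^γ`. Here
`J₂ ≈ (V^*)^{1-γ}`, and the proof is by duality with the square function of `V^*` of order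
`1 - γ`. -/
theorem exists_apply_eq_of_kInt {J₂ : H →L[ℝ] H} {γ : ℝ} (hV' : Accretive V.adjoint)
    (hd : DenseRange V.adjoint) (hJ : Commute J₂ V.adjoint) (hC : 0 ≤ C)
    (hm : MomentBound V.adjoint J₂ (1 - γ) C) (hγ0 : 0 < γ) (hγ1 : γ < 1)
    (hJJ : J₂ * J.adjoint = V.adjoint) {v : H} (hv : kInt γ (kOp V v) < ∞) :
    ∃ g, J g = v ∧
      ‖g‖ₑ ≤ ENNReal.ofReal (3 * √(squareConst (1 - γ) C)) * kInt γ (kOp V v) := by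
  have h0 : 0 ≤ squareConst (1 - γ) C := sq_nonneg _
  set M : ℝ≥0∞ := ENNReal.ofReal (3 * √(squareConst (1 - γ) C)) * kInt γ (kOp V v) with hM
  have hMtop : M ≠ ∞ := ENNReal.mul_ne_top ENNReal.ofReal_ne_top hv.ne
  have key : ∀ h, ‖inner ℝ v h‖ₑ ≤ M * ‖J.adjoint h‖ₑ := by
    intro h
    have hVh : V.adjoint h = J₂ (J.adjoint h) :=
      congrArg (fun B : H →L[ℝ] H => B h) hJJ.symm
    rw [← ENNReal.pow_le_pow_left_iff two_ne_zero]
    calc ‖inner ℝ v h‖ₑ ^ 2 ≤ (∑' j : ℤ, kOp V v (2 ^ j) *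
          (ENNReal.ofReal ((2 : ℝ) ^ j)⁻¹ * ‖resE V.adjoint (2 ^ j) (V.adjoint h)‖ₑ)) ^ 2 := by
          gcongr; exact enorm_inner_le_tsum_kOp hV' hd v h
      _ = (∑' j : ℤ, (ENNReal.ofReal (((2 : ℝ) ^ j) ^ (-γ)) * kOp V v (2 ^ j)) *
          (ENNReal.ofReal (((2 : ℝ) ^ j) ^ (-(1 - γ))) *
            ‖resE V.adjoint (2 ^ j) (V.adjoint h)‖ₑ)) ^ 2 := by
          congr 2; ext j
          have hj : (0 : ℝ) < 2 ^ j := by positivity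
          have e : ((2 : ℝ) ^ j)⁻¹ = ((2 : ℝ) ^ j) ^ (-γ) * ((2 : ℝ) ^ j) ^ (-(1 - γ)) := by
            rw [← Real.rpow_add hj, ← Real.rpow_neg_one]; congr 1; ring
          rw [e, ENNReal.ofReal_mul (by positivity)]
          ring
      _ ≤ _ := tsum_mul_sq_le_mul_tsum_sq _ _
      _ ≤ (8 * kInt γ (kOp V v) ^ 2) *
          (ENNReal.ofReal (squareConst (1 - γ) C) * ‖J.adjoint h‖ₑ ^ 2) := by
          gcongr
          · exact tsum_le_kInt_sq hγ0.le hγ1.le (kOp_mono V v)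
          · rw [hVh]
            exact hV'.tsum_square_function_le hd hJ hC hm (by linarith) (by linarith) _
      _ ≤ (9 * kInt γ (kOp V v) ^ 2) *
          (ENNReal.ofReal (squareConst (1 - γ) C) * ‖J.adjoint h‖ₑ ^ 2) := by
          gcongr; norm_num
      _ = _ := by
          rw [hM, mul_pow, mul_pow, ← ENNReal.ofReal_pow (by positivity), mul_pow,
            Real.sq_sqrt h0, ENNReal.ofReal_mul (by norm_num)]
          norm_num
          ring
  obtain ⟨g, hg, hgn⟩ := exists_adjoint_apply_eq (B := J.adjoint) (v := v)
    (M := M.toReal) ENNReal.toReal_nonneg fun x => by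
      have := ENNReal.toReal_mono (ENNReal.mul_ne_top hMtop enorm_ne_top) (key x)
      rwa [ENNReal.toReal_mul, toReal_enorm, toReal_enorm] at this
  refine ⟨g, by rwa [ContinuousLinearMap.adjoint_adjoint] at hg, ?_⟩
  rw [← ofReal_norm, ← ENNReal.ofReal_toReal hMtop]
  exact ENNReal.ofReal_le_ofReal hgn

/-! ### Comparison of an operator with its adjoint -/

/-- The quadratic form of `J²` controls `‖J x‖²` and `‖J^* x‖²`. -/
def AdjointCoercive (J : H →L[ℝ] H) (c : ℝ) : Prop :=
  ∀ x, c * ‖J x‖ ^ 2 ≤ inner ℝ (J x) (J.adjoint x) ∧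
    c * ‖J.adjoint x‖ ^ 2 ≤ inner ℝ (J x) (J.adjoint x)

variable {c : ℝ}

theorem AdjointCoercive.norm_adjoint_le (hc : 0 < c) (h : AdjointCoercive J c) (x : H) :
    ‖J.adjoint x‖ ≤ c⁻¹ * ‖J x‖ := by
  have h1 := (h x).2.trans (real_inner_le_norm _ _)
  rw [← div_eq_inv_mul, le_div_iff₀ hc]
  rcases (norm_nonneg (J.adjoint x)).eq_or_lt with h0 | h0
  · rw [← h0, zero_mul]; exact norm_nonneg _
  · refine le_of_mul_le_mul_right ?_ h0
    linarith

/-- The operator `S = (J^*)⁻¹ J` is bounded and coercive. -/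
theorem AdjointCoercive.exists_factor (hc : 0 < c) (h : AdjointCoercive J c)
    (hinj : Function.Injective J.adjoint) (hd : DenseRange J) :
    ∃ S : H →L[ℝ] H, (∀ x, J.adjoint (S x) = J x) ∧ (∀ x, ‖S x‖ ≤ c⁻¹ * ‖x‖) ∧
      ∀ x, c * ‖x‖ ^ 2 ≤ inner ℝ x (S x) := by
  have h1 : ∀ x, ∃ g, J.adjoint g = J x ∧ ‖g‖ ≤ c⁻¹ * ‖x‖ := fun x =>
    exists_adjoint_apply_eq (by positivity) fun y => by
      rw [← ContinuousLinearMap.adjoint_inner_right]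
      calc _ ≤ ‖x‖ * ‖J.adjoint y‖ := abs_real_inner_le_norm _ _
        _ ≤ ‖x‖ * (c⁻¹ * ‖J y‖) := by gcongr; exact h.norm_adjoint_le hc y
        _ = _ := by ring
  choose S hS hSn using h1
  let S' : H →ₗ[ℝ] H :=
    { toFun := S
      map_add' := fun x y => hinj (by rw [map_add, hS, hS, hS, map_add])
      map_smul' := fun a x => hinj (by rw [RingHom.id_apply, map_smul, hS, hS, map_smul]) }
  let T := S'.mkContinuous c⁻¹ hSn
  have hT : ∀ x, T x = S x := fun _ => rfl
  refine ⟨T, hS, hSn, fun x => ?_⟩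
  refine hd.induction_on (p := fun x => c * ‖x‖ ^ 2 ≤ inner ℝ x (T x)) x ?_ fun y => ?_
  · exact isClosed_le (by fun_prop) (by fun_prop)
  · have e : inner ℝ (J y) (T (J y)) = inner ℝ (J y) (J.adjoint y) := by
      rw [← ContinuousLinearMap.adjoint_inner_right, hT, hS, real_inner_comm,
        ContinuousLinearMap.adjoint_inner_right]
    rw [e]
    exact (h y).1

end

end FracWave

namespace FracWave

/-! ### Causal convolution operators -/

/-- The triangle `0 < s < t < T`, with points `(t, s)`. -/
def tri (T : ℝ) : Set (ℝ × ℝ) := {p | 0 < p.2 ∧ p.2 < p.1 ∧ p.1 < T}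

theorem measurableSet_tri (T : ℝ) : MeasurableSet (tri T) :=
  (measurableSet_lt measurable_const measurable_snd).inter
    ((measurableSet_lt measurable_snd measurable_fst).inter
      (measurableSet_lt measurable_fst measurable_const))

theorem tri_indicator_left {M : Type*} [Zero M] (T : ℝ) (F : ℝ × ℝ → M) (t s : ℝ) :
    (tri T).indicator F (t, s) =
      (Ioo 0 T).indicator (fun t => (Ioo 0 t).indicator (fun s => F (t, s)) s) t := by
  simp only [indicator_apply, tri, mem_ofPred_eq, mem_Ioo]
  by_cases h1 : 0 < t <;> by_cases h2 : t < T <;> by_cases h3 : 0 < s <;> by_cases h4 : s < t <;>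
    first | (exfalso; linarith) | simp [h1, h2, h3, h4]

theorem tri_indicator_right {M : Type*} [Zero M] (T : ℝ) (F : ℝ × ℝ → M) (t s : ℝ) :
    (tri T).indicator F (t, s) =
      (Ioo 0 T).indicator (fun s => (Ioo s T).indicator (fun t => F (t, s)) t) s := by
  simp only [indicator_apply, tri, mem_ofPred_eq, mem_Ioo]
  by_cases h1 : s < T <;> by_cases h2 : t < T <;> by_cases h3 : 0 < s <;> by_cases h4 : s < t <;>
    first | (exfalso; linarith) | simp [h1, h2, h3, h4]

theorem lintegral_tri_left {T : ℝ} {F : ℝ × ℝ → ℝ≥0∞} (hF : Measurable F) :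
    ∫⁻ p, (tri T).indicator F p = ∫⁻ t in Ioo 0 T, ∫⁻ s in Ioo 0 t, F (t, s) := by
  rw [Measure.volume_eq_prod, lintegral_prod _ (hF.indicator (measurableSet_tri T)).aemeasurable,
    ← lintegral_indicator measurableSet_Ioo]
  refine lintegral_congr fun t => ?_
  simp only [tri_indicator_left]
  by_cases ht : t ∈ Ioo 0 T
  · simp only [indicator_of_mem ht]
    rw [lintegral_indicator measurableSet_Ioo]
  · simp [indicator_of_notMem ht]

theorem lintegral_tri_right {T : ℝ} {F : ℝ × ℝ → ℝ≥0∞} (hF : Measurable F) :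
    ∫⁻ p, (tri T).indicator F p = ∫⁻ s in Ioo 0 T, ∫⁻ t in Ioo s T, F (t, s) := by
  rw [Measure.volume_eq_prod,
    lintegral_prod_symm _ (hF.indicator (measurableSet_tri T)).aemeasurable,
    ← lintegral_indicator measurableSet_Ioo]
  refine lintegral_congr fun s => ?_
  simp only [tri_indicator_right]
  by_cases hs : s ∈ Ioo 0 T
  · simp only [indicator_of_mem hs]
    rw [lintegral_indicator measurableSet_Ioo]
  · simp [indicator_of_notMem hs]

theorem integrable_tri {T : ℝ} {F : ℝ × ℝ → ℝ} (hF : Measurable F)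
    (hfin : ∫⁻ t in Ioo 0 T, ∫⁻ s in Ioo 0 t, ‖F (t, s)‖ₑ ≠ ∞) :
    Integrable ((tri T).indicator F) ((volume : Measure ℝ).prod volume) := by
  refine ⟨(hF.indicator (measurableSet_tri T)).aestronglyMeasurable, ?_⟩
  have h := lintegral_tri_left (T := T) hF.enorm
  rw [hasFiniteIntegral_iff_enorm, ← Measure.volume_eq_prod]
  simp only [enorm_indicator_eq_indicator_enorm]
  rw [h]
  exact lt_top_iff_ne_top.2 hfin

theorem integral_tri_left (T : ℝ) (F : ℝ × ℝ → ℝ) (t : ℝ) :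
    ∫ s, (tri T).indicator F (t, s) =
      (Ioo 0 T).indicator (fun t => ∫ s in Ioo 0 t, F (t, s)) t := by
  simp only [tri_indicator_left]
  by_cases ht : t ∈ Ioo 0 T
  · simp only [indicator_of_mem ht]
    rw [integral_indicator measurableSet_Ioo]
  · simp [indicator_of_notMem ht]

theorem integral_tri_right (T : ℝ) (F : ℝ × ℝ → ℝ) (s : ℝ) :
    ∫ t, (tri T).indicator F (t, s) =
      (Ioo 0 T).indicator (fun s => ∫ t in Ioo s T, F (t, s)) s := by
  simp only [tri_indicator_right]
  by_cases hs : s ∈ Ioo 0 T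
  · simp only [indicator_of_mem hs]
    rw [integral_indicator measurableSet_Ioo]
  · simp [indicator_of_notMem hs]

theorem integral_tri_swap {T : ℝ} {F : ℝ × ℝ → ℝ} (hF : Measurable F)
    (hfin : ∫⁻ t in Ioo 0 T, ∫⁻ s in Ioo 0 t, ‖F (t, s)‖ₑ ≠ ∞) :
    ∫ t in Ioo 0 T, ∫ s in Ioo 0 t, F (t, s) = ∫ s in Ioo 0 T, ∫ t in Ioo s T, F (t, s) := by
  have h := integral_integral_swap (f := fun t s => (tri T).indicator F (t, s))
    (integrable_tri hF hfin)
  simp only [integral_tri_left, integral_tri_right] at h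
  rwa [integral_indicator measurableSet_Ioo, integral_indicator measurableSet_Ioo] at h

/-- The causal convolution of nonnegative functions. -/
noncomputable def lconv (κ f : ℝ → ℝ≥0∞) (t : ℝ) : ℝ≥0∞ := ∫⁻ s in Ioo 0 t, κ (t - s) * f s

theorem lconv_eq_lintegral (κ f : ℝ → ℝ≥0∞) (t : ℝ) :
    lconv κ f t = ∫⁻ s, {p : ℝ × ℝ | 0 < p.2 ∧ p.2 < p.1}.indicator
      (fun p => κ (p.1 - p.2) * f p.2) (t, s) := by
  rw [lconv, ← lintegral_indicator measurableSet_Ioo]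
  rfl

theorem measurable_lconv {κ f : ℝ → ℝ≥0∞} (hκ : Measurable κ) (hf : Measurable f) :
    Measurable (lconv κ f) := by
  have h : lconv κ f = fun t => ∫⁻ s, {p : ℝ × ℝ | 0 < p.2 ∧ p.2 < p.1}.indicator
      (fun p => κ (p.1 - p.2) * f p.2) (t, s) := funext (lconv_eq_lintegral κ f)
  rw [h]
  refine Measurable.lintegral_prod_right' (f := {p : ℝ × ℝ | 0 < p.2 ∧ p.2 < p.1}.indicator
      (fun p => κ (p.1 - p.2) * f p.2)) (Measurable.indicator (by fun_prop) ?_)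
  exact (measurableSet_lt measurable_const measurable_snd).inter
    (measurableSet_lt measurable_snd measurable_fst)

theorem lintegral_sub_left_Ioo (κ : ℝ → ℝ≥0∞) (a t : ℝ) :
    ∫⁻ s in Ioo a t, κ (t - s) = ∫⁻ r in Ioo 0 (t - a), κ r := by
  rw [← lintegral_indicator measurableSet_Ioo, ← lintegral_indicator measurableSet_Ioo,
    ← lintegral_sub_left_eq_self _ t]
  refine lintegral_congr fun s => ?_
  simp only [indicator_apply, mem_Ioo, sub_sub_cancel]
  congr 1
  simp only [eq_iff_iff]
  constructor <;> rintro ⟨h1, h2⟩ <;> constructor <;> linarith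

theorem lintegral_sub_right_Ioo (κ : ℝ → ℝ≥0∞) (s b : ℝ) :
    ∫⁻ t in Ioo s b, κ (t - s) = ∫⁻ r in Ioo 0 (b - s), κ r := by
  rw [← lintegral_indicator measurableSet_Ioo, ← lintegral_indicator measurableSet_Ioo,
    ← lintegral_add_right_eq_self _ s]
  refine lintegral_congr fun t => ?_
  simp only [indicator_apply, mem_Ioo, add_sub_cancel_right]
  congr 1
  simp only [eq_iff_iff]
  constructor <;> rintro ⟨h1, h2⟩ <;> constructor <;> linarith

/-- Young's inequality `L¹ * L² ⊆ L²` for causal convolutions. -/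
theorem lintegral_lconv_sq_le {κ f : ℝ → ℝ≥0∞} (hκ : Measurable κ) (hf : Measurable f) (T : ℝ) :
    ∫⁻ t in Ioo 0 T, lconv κ f t ^ 2 ≤
      (∫⁻ r in Ioo 0 T, κ r) ^ 2 * ∫⁻ s in Ioo 0 T, f s ^ 2 := by
  set M := ∫⁻ r in Ioo 0 T, κ r
  calc _ ≤ ∫⁻ t in Ioo 0 T, M * ∫⁻ s in Ioo 0 t, κ (t - s) * f s ^ 2 := by
        refine setLIntegral_mono' measurableSet_Ioo fun t ht => ?_
        refine (lintegral_mul_sq_le _ (by fun_prop) hf.aemeasurable).trans ?_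
        gcongr
        rw [lintegral_sub_left_Ioo, sub_zero]
        exact lintegral_mono_set (Ioo_subset_Ioo_right ht.2.le)
    _ = M * ∫⁻ s in Ioo 0 T, ∫⁻ t in Ioo s T, κ (t - s) * f s ^ 2 := by
        have hF : Measurable fun p : ℝ × ℝ => κ (p.1 - p.2) * f p.2 ^ 2 := by fun_prop
        have hm : Measurable fun t => ∫⁻ s in Ioo 0 t, κ (t - s) * f s ^ 2 :=
          measurable_lconv hκ (hf.pow_const 2)
        rw [lintegral_const_mul _ hm, ← lintegral_tri_left hF, lintegral_tri_right hF]
    _ ≤ M * ∫⁻ s in Ioo 0 T, M * f s ^ 2 := by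
        gcongr M * ?_
        refine setLIntegral_mono' measurableSet_Ioo fun s hs => ?_
        rw [lintegral_mul_const _ (by fun_prop), lintegral_sub_right_Ioo]
        gcongr
        exact lintegral_mono_set (Ioo_subset_Ioo_right (by linarith [hs.1]))
    _ = _ := by rw [lintegral_const_mul _ (hf.pow_const 2)]; ring

/-- A measurable kernel that is integrable on `(0, T)`. -/
def IsKernel (T : ℝ) (k : ℝ → ℝ) : Prop := Measurable k ∧ IntegrableOn k (Ioo 0 T)

theorem IsKernel.lintegral_lt_top {T : ℝ} {k : ℝ → ℝ} (hk : IsKernel T k) :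
    ∫⁻ r in Ioo 0 T, ‖k r‖ₑ < ∞ := hk.2.2

section

variable {X : Type*} [NormedAddCommGroup X] [NormedSpace ℝ X]

/-- The causal convolution `∫₀ᵗ k(t - s) v(s) ds`. -/
noncomputable def conv (k : ℝ → ℝ) (v : ℝ → X) (t : ℝ) : X := ∫ s in Ioo 0 t, k (t - s) • v s

theorem enorm_conv_le (k : ℝ → ℝ) (v : ℝ → X) (t : ℝ) :
    ‖conv k v t‖ₑ ≤ lconv (fun r => ‖k r‖ₑ) (fun s => ‖v s‖ₑ) t := by
  refine (enorm_integral_le_lintegral_enorm _).trans (le_of_eq ?_)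
  simp only [enorm_smul, lconv]

theorem stronglyMeasurable_conv {k : ℝ → ℝ} {v : ℝ → X} (hk : Measurable k)
    (hv : StronglyMeasurable v) : StronglyMeasurable (conv k v) := by
  have h : conv k v = fun t => ∫ s, {p : ℝ × ℝ | 0 < p.2 ∧ p.2 < p.1}.indicator
      (fun p => k (p.1 - p.2) • v p.2) (t, s) := by
    funext t
    rw [conv, ← integral_indicator measurableSet_Ioo]
    rfl
  rw [h]
  refine StronglyMeasurable.integral_prod_right' (f := {p : ℝ × ℝ | 0 < p.2 ∧ p.2 < p.1}.indicator
      (fun p => k (p.1 - p.2) • v p.2)) (StronglyMeasurable.indicator ?_ ?_)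
  · exact (hk.comp (measurable_fst.sub measurable_snd)).stronglyMeasurable.smul
      (hv.comp_measurable measurable_snd)
  · exact (measurableSet_lt measurable_const measurable_snd).inter
      (measurableSet_lt measurable_snd measurable_fst)

variable {T : ℝ} {k l p : ℝ → ℝ}

theorem eLpNorm_two_sq {Y : Type*} [NormedAddCommGroup Y] (μ : Measure ℝ) (v : ℝ → Y) :
    eLpNorm v 2 μ ^ 2 = ∫⁻ t, ‖v t‖ₑ ^ 2 ∂μ := by
  rw [eLpNorm_eq_lintegral_rpow_enorm_toReal (by norm_num) (by norm_num)]
  simp only [ENNReal.toReal_ofNat, ENNReal.rpow_two]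
  rw [← ENNReal.rpow_two, ← ENNReal.rpow_mul]
  norm_num

theorem eLpNorm_conv_le (hk : Measurable k) {v : ℝ → X} (hv : StronglyMeasurable v) :
    eLpNorm (conv k v) 2 (timeMeasure T) ≤
      (∫⁻ r in Ioo 0 T, ‖k r‖ₑ) * eLpNorm v 2 (timeMeasure T) := by
  rw [← ENNReal.pow_le_pow_left_iff two_ne_zero, mul_pow, eLpNorm_two_sq, eLpNorm_two_sq]
  refine le_trans ?_ (lintegral_lconv_sq_le hk.enorm hv.enorm T)
  refine lintegral_mono fun t => ?_
  gcongr
  exact enorm_conv_le k v t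

theorem memLp_conv (hk : IsKernel T k) (v : Lp X 2 (timeMeasure T)) :
    MemLp (conv k v) 2 (timeMeasure T) := by
  have hv := Lp.stronglyMeasurable v
  refine ⟨(stronglyMeasurable_conv hk.1 hv).aestronglyMeasurable, ?_⟩
  exact (eLpNorm_conv_le hk.1 hv).trans_lt
    (ENNReal.mul_lt_top hk.lintegral_lt_top (Lp.memLp v).2)

theorem ae_lconv_lt_top (hk : IsKernel T k) {f : ℝ → ℝ≥0∞} (hf : Measurable f)
    (hf2 : ∫⁻ s in Ioo 0 T, f s ^ 2 < ∞) :
    ∀ᵐ t ∂(timeMeasure T), lconv (fun r => ‖k r‖ₑ) f t < ∞ := by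
  have h : ∫⁻ t in Ioo 0 T, lconv (fun r => ‖k r‖ₑ) f t ^ 2 < ∞ :=
    (lintegral_lconv_sq_le hk.1.enorm hf T).trans_lt
      (ENNReal.mul_lt_top (ENNReal.pow_lt_top hk.lintegral_lt_top) hf2)
  filter_upwards [ae_lt_top ((measurable_lconv hk.1.enorm hf).pow_const 2) h.ne] with t ht
  simpa using ht

theorem lintegral_enorm_sq_lt_top {Y : Type*} [NormedAddCommGroup Y] (v : Lp Y 2 (timeMeasure T)) :
    ∫⁻ s in Ioo 0 T, ‖v s‖ₑ ^ 2 < ∞ := by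
  rw [← eLpNorm_two_sq]
  exact ENNReal.pow_lt_top (Lp.memLp v).2

/-- The integrand of a causal convolution is integrable for almost every `t`. -/
theorem ae_integrable_conv (hk : IsKernel T k) (v : Lp X 2 (timeMeasure T)) :
    ∀ᵐ t ∂(timeMeasure T), Integrable (fun s => k (t - s) • v s) (volume.restrict (Ioo 0 t)) := by
  have hv := Lp.stronglyMeasurable v
  filter_upwards [ae_lconv_lt_top hk hv.enorm (lintegral_enorm_sq_lt_top v)] with t ht
  refine ⟨(StronglyMeasurable.smul ?_ hv).aestronglyMeasurable, ?_⟩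
  · exact (hk.1.comp (measurable_const.sub measurable_id)).stronglyMeasurable
  · rw [hasFiniteIntegral_iff_enorm]
    simpa only [enorm_smul, lconv] using ht

/-- The value of `conv k v` on `(0, T)` depends only on the class of `v`. -/
theorem conv_congr {v w : ℝ → X} (h : v =ᵐ[timeMeasure T] w) {t : ℝ} (ht : t ≤ T) :
    conv k v t = conv k w t := by
  refine integral_congr_ae ?_
  filter_upwards [ae_restrict_of_ae_restrict_of_subset (Ioo_subset_Ioo_right ht) h] with s hs
  rw [hs]

/-- The causal convolution as an operator on `L²(0, T; X)`. -/
noncomputable def convOp (hk : IsKernel T k) :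
    Lp X 2 (timeMeasure T) →L[ℝ] Lp X 2 (timeMeasure T) :=
  LinearMap.mkContinuous
    { toFun := fun v => (memLp_conv hk v).toLp _
      map_add' := fun v w => by
        rw [← MemLp.toLp_add, MemLp.toLp_eq_toLp_iff]
        filter_upwards [ae_integrable_conv hk v, ae_integrable_conv hk w,
          ae_restrict_mem measurableSet_Ioo] with t hv hw ht
        rw [conv_congr (Lp.coeFn_add v w) ht.2.le, Pi.add_apply, conv, conv, conv,
          ← integral_add hv hw]
        simp only [Pi.add_apply, smul_add]
      map_smul' := fun c v => by
        rw [RingHom.id_apply, ← MemLp.toLp_const_smul, MemLp.toLp_eq_toLp_iff]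
        filter_upwards [ae_restrict_mem measurableSet_Ioo] with t ht
        rw [conv_congr (Lp.coeFn_smul c v) ht.2.le, Pi.smul_apply, conv, conv, ← integral_smul]
        simp only [Pi.smul_apply, smul_comm c] }
    (∫⁻ r in Ioo 0 T, ‖k r‖ₑ).toReal fun v => by
      change ‖(memLp_conv hk v).toLp _‖ ≤ _
      rw [Lp.norm_toLp, Lp.norm_def, ← ENNReal.toReal_mul]
      exact ENNReal.toReal_mono (ENNReal.mul_ne_top hk.lintegral_lt_top.ne (Lp.memLp v).2.ne)
        (eLpNorm_conv_le hk.1 (Lp.stronglyMeasurable v))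

theorem convOp_ae (hk : IsKernel T k) (v : Lp X 2 (timeMeasure T)) :
    convOp hk v =ᵐ[timeMeasure T] conv k v := (memLp_conv hk v).coeFn_toLp

theorem enorm_convOp_le (hk : IsKernel T k) (v : Lp X 2 (timeMeasure T)) :
    ‖convOp hk v‖ₑ ≤ (∫⁻ r in Ioo 0 T, ‖k r‖ₑ) * ‖v‖ₑ := by
  change ‖(memLp_conv hk v).toLp _‖ₑ ≤ _
  rw [Lp.enorm_toLp, Lp.enorm_def]
  exact eLpNorm_conv_le hk.1 (Lp.stronglyMeasurable v)

end

theorem convOp_comp {T : ℝ} {k l p : ℝ → ℝ} (hk : IsKernel T k) (hl : IsKernel T l)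
    (hp : IsKernel T p)
    (h : ∀ r ∈ Ioo 0 T, ∫ s in Ioo 0 r, k (r - s) * l s = p r) :
    (convOp hk : L2Time T →L[ℝ] L2Time T) ∘L convOp hl = convOp hp := by
  ext1 v
  refine Lp.ext ?_
  have hv := (Lp.stronglyMeasurable v).measurable
  have hl2 : ∫⁻ s in Ioo 0 T, lconv (fun r => ‖l r‖ₑ) (fun s => ‖v s‖ₑ) s ^ 2 < ∞ :=
    (lintegral_lconv_sq_le hl.1.enorm hv.enorm T).trans_lt
      (ENNReal.mul_lt_top (ENNReal.pow_lt_top hl.lintegral_lt_top) (lintegral_enorm_sq_lt_top v))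
  filter_upwards [convOp_ae hk (convOp hl v), convOp_ae hp v,
    ae_lconv_lt_top hk (measurable_lconv hl.1.enorm hv.enorm) hl2,
    ae_restrict_mem measurableSet_Ioo] with t h1 h2 h3 ht
  change (convOp hk (convOp hl v)) t = _
  rw [h1, h2, conv_congr (convOp_ae hl v) ht.2.le]
  have hF : Measurable fun q : ℝ × ℝ => k (t - q.1) * (l (q.1 - q.2) * v q.2) := by
    have := hk.1; have := hl.1; fun_prop
  have hs := integral_tri_swap (T := t) hF (by
    refine ne_of_eq_of_ne ?_ h3.ne
    rw [lconv]
    refine lintegral_congr fun r => ?_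
    rw [lconv, ← lintegral_const_mul]
    · simp only [enorm_mul]
    · have := hl.1; fun_prop)
  simp only [conv, smul_eq_mul]
  have e1 : ∀ r, k (t - r) * ∫ s in Ioo 0 r, l (r - s) * v s =
      ∫ s in Ioo 0 r, k (t - r) * (l (r - s) * v s) := fun r => (integral_const_mul _ _).symm
  simp only [e1]
  rw [hs]
  refine setIntegral_congr_fun measurableSet_Ioo fun s hs => ?_
  have e2 : ∀ r, k (t - r) * (l (r - s) * v s) = k (t - r) * l (r - s) * v s := fun r => by ring
  simp only [e2]
  rw [integral_mul_const]
  congr 1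
  rw [← h (t - s) ⟨by linarith [hs.2], by linarith [hs.1, ht.2]⟩]
  rw [← integral_indicator measurableSet_Ioo, ← integral_indicator measurableSet_Ioo,
    ← integral_add_right_eq_self _ s]
  refine integral_congr_ae (Eventually.of_forall fun r => ?_)
  simp only [indicator_apply, mem_Ioo]
  have e3 : t - s - r = t - (r + s) := by ring
  rw [e3, add_sub_cancel_right]
  congr 1
  simp only [eq_iff_iff]
  constructor <;> rintro ⟨h1, h2⟩ <;> constructor <;> linarith

end FracWave

namespace FracWave

/-! ### Riemann-Liouville operators on `L²(0, T)` -/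

/-- The kernel `r^{γ-1} / Γ(γ)`. -/
noncomputable def rlKer (γ r : ℝ) : ℝ := r ^ (γ - 1) / Real.Gamma γ

theorem rlKer_one (r : ℝ) : rlKer 1 r = 1 := by simp [rlKer]

theorem intLeft_eq_conv {X : Type*} [NormedAddCommGroup X] [NormedSpace ℝ X] (γ : ℝ) (v : ℝ → X) :
    intLeft γ v = conv (rlKer γ) v := by
  funext t
  rw [intLeft, conv, ← integral_smul]
  simp only [smul_smul, rlKer]
  congr 1
  funext s
  congr 1
  ring

variable {T γ a b : ℝ}

theorem isKernel_rlKer (T : ℝ) (hγ : 0 < γ) : IsKernel T (rlKer γ) := by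
  refine ⟨by unfold rlKer; fun_prop, ?_⟩
  rcases le_total T 0 with hT | hT
  · rw [Ioo_eq_empty_of_le hT]; exact integrableOn_empty
  · have h := intervalIntegral.intervalIntegrable_rpow' (a := 0) (b := T) (r := γ - 1)
      (by linarith)
    rw [intervalIntegrable_iff_integrableOn_Ioo_of_le hT] at h
    exact h.div_const _

theorem rlKer_nonneg (hγ : 0 < γ) {r : ℝ} (hr : 0 ≤ r) : 0 ≤ rlKer γ r :=
  div_nonneg (Real.rpow_nonneg hr _) (Real.Gamma_pos_of_pos hγ).le

theorem integral_rlKer (hγ : 0 < γ) {δ : ℝ} (hδ : 0 ≤ δ) :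
    ∫ r in Ioo 0 δ, rlKer γ r = δ ^ γ / Real.Gamma (γ + 1) := by
  rw [← integral_Ioc_eq_integral_Ioo, ← intervalIntegral.integral_of_le hδ]
  simp only [rlKer]
  rw [intervalIntegral.integral_div, integral_rpow (Or.inl (by linarith)),
    Real.Gamma_add_one hγ.ne', Real.zero_rpow (by linarith), sub_add_cancel, sub_zero,
    div_div]

/-- The Beta integral: `rlKer a * rlKer b = rlKer (a + b)`. -/
theorem integral_rlKer_mul_rlKer (ha : 0 < a) (hb : 0 < b) {r : ℝ} (hr : 0 < r) :
    ∫ s in Ioo 0 r, rlKer a (r - s) * rlKer b s = rlKer (a + b) r := by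
  have h1 := Complex.betaIntegral_scaled (b : ℂ) (a : ℂ) hr
  have h2 := Complex.Gamma_mul_Gamma_eq_betaIntegral (s := (b : ℂ)) (t := (a : ℂ))
    (by simpa using hb) (by simpa using ha)
  have hG : Real.Gamma (a + b) ≠ 0 := (Real.Gamma_pos_of_pos (by linarith)).ne'
  have h3 : Complex.betaIntegral b a =
      ((Real.Gamma b * Real.Gamma a / Real.Gamma (a + b) : ℝ) : ℂ) := by
    push_cast
    rw [eq_div_iff (by exact_mod_cast hG), mul_comm, ← Complex.Gamma_ofReal, ← Complex.Gamma_ofReal,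
      ← Complex.Gamma_ofReal, h2]
    push_cast
    rw [add_comm (b : ℂ)]
  have h4 : ∫ x in (0 : ℝ)..r, (x : ℂ) ^ ((b : ℂ) - 1) * ((r : ℂ) - x) ^ ((a : ℂ) - 1) =
      ((∫ x in (0 : ℝ)..r, x ^ (b - 1) * (r - x) ^ (a - 1) : ℝ) : ℂ) := by
    rw [← intervalIntegral.integral_ofReal]
    refine intervalIntegral.integral_congr_ae (Eventually.of_forall fun x hx => ?_)
    rw [uIoc_of_le hr.le] at hx
    push_cast
    rw [Complex.ofReal_cpow hx.1.le, Complex.ofReal_cpow (by linarith [hx.2])]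
    push_cast
    rfl
  rw [h4, h3] at h1
  have h5 : (r : ℂ) ^ ((b : ℂ) + a - 1) = ((r ^ (a + b - 1) : ℝ) : ℂ) := by
    rw [Complex.ofReal_cpow hr.le]; push_cast; rw [add_comm (b : ℂ)]
  rw [h5, ← Complex.ofReal_mul] at h1
  have h6 := Complex.ofReal_injective h1
  rw [intervalIntegral.integral_of_le hr.le, integral_Ioc_eq_integral_Ioo] at h6
  have ha' := (Real.Gamma_pos_of_pos ha).ne'
  have hb' := (Real.Gamma_pos_of_pos hb).ne'
  have e : ∀ s, rlKer a (r - s) * rlKer b s =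
      (s ^ (b - 1) * (r - s) ^ (a - 1)) * (Real.Gamma a * Real.Gamma b)⁻¹ := fun s => by
    simp only [rlKer]; field_simp
  simp only [e]
  rw [integral_mul_const, h6, rlKer]
  field_simp

section

variable {X : Type*} [NormedAddCommGroup X] [NormedSpace ℝ X]

/-- The left-sided Riemann-Liouville integral as an operator on `L²(0, T; X)`. -/
noncomputable def rlOp (T : ℝ) (hγ : 0 < γ) : Lp X 2 (timeMeasure T) →L[ℝ] Lp X 2 (timeMeasure T) :=
  convOp (isKernel_rlKer T hγ)

theorem rlOp_ae (hγ : 0 < γ) (v : Lp X 2 (timeMeasure T)) :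
    rlOp T hγ v =ᵐ[timeMeasure T] intLeft γ v := by
  rw [intLeft_eq_conv]; exact convOp_ae _ v

theorem measurePreserving_reflect (T : ℝ) :
    MeasurePreserving (fun t : ℝ => T - t) (timeMeasure T) (timeMeasure T) := by
  have h := (Measure.measurePreserving_sub_left (volume : Measure ℝ) T).restrict_preimage
    (measurableSet_Ioo (a := 0) (b := T))
  have e : (fun t : ℝ => T - t) ⁻¹' Ioo 0 T = Ioo 0 T := by
    ext t; simp only [mem_preimage, mem_Ioo]; constructor <;> rintro ⟨h1, h2⟩ <;>
      constructor <;> linarith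
  rwa [e] at h

/-- The time reversal `v ↦ v(T - ·)`. -/
noncomputable def reflect (T : ℝ) : Lp X 2 (timeMeasure T) →ₗᵢ[ℝ] Lp X 2 (timeMeasure T) :=
  Lp.compMeasurePreservingₗᵢ ℝ (fun t => T - t) (measurePreserving_reflect T)

theorem reflect_ae (v : Lp X 2 (timeMeasure T)) :
    reflect T v =ᵐ[timeMeasure T] fun t => v (T - t) :=
  Lp.coeFn_compMeasurePreserving v (measurePreserving_reflect T)

theorem reflect_reflect (v : Lp X 2 (timeMeasure T)) : reflect T (reflect T v) = v := by
  refine Lp.ext ?_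
  filter_upwards [reflect_ae (reflect T v),
    (measurePreserving_reflect T).quasiMeasurePreserving.ae (reflect_ae v)] with t h1 h2
  rw [h1, h2, sub_sub_cancel]

theorem intRight_eq_intLeft (v : ℝ → X) (t : ℝ) :
    intRight T γ v t = intLeft γ (fun s => v (T - s)) (T - t) := by
  rw [intRight, intLeft]
  congr 1
  rw [← integral_indicator measurableSet_Ioo, ← integral_indicator measurableSet_Ioo,
    ← integral_sub_left_eq_self _ _ T]
  refine integral_congr_ae (Eventually.of_forall fun s => ?_)
  simp only [indicator_apply, mem_Ioo]
  have e : T - s - t = T - t - s := by ring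
  rw [e]
  congr 1
  simp only [eq_iff_iff]
  constructor <;> rintro ⟨h1, h2⟩ <;> constructor <;> linarith

/-- The right-sided Riemann-Liouville integral as an operator on `L²(0, T; X)`. -/
noncomputable def rlOpR (T : ℝ) (hγ : 0 < γ) :
    Lp X 2 (timeMeasure T) →L[ℝ] Lp X 2 (timeMeasure T) :=
  (reflect T).toContinuousLinearMap ∘L rlOp T hγ ∘L (reflect T).toContinuousLinearMap

theorem rlOpR_apply (hγ : 0 < γ) (v : Lp X 2 (timeMeasure T)) :
    rlOpR T hγ v = reflect T (rlOp T hγ (reflect T v)) := rfl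

theorem rlOpR_ae (hγ : 0 < γ) (v : Lp X 2 (timeMeasure T)) :
    rlOpR T hγ v =ᵐ[timeMeasure T] intRight T γ v := by
  rw [rlOpR_apply]
  filter_upwards [reflect_ae (rlOp T hγ (reflect T v)),
    (measurePreserving_reflect T).quasiMeasurePreserving.ae (rlOp_ae hγ (reflect T v)),
    ae_restrict_mem measurableSet_Ioo] with t h1 h2 ht
  rw [h1, h2, intRight_eq_intLeft, intLeft_eq_conv, intLeft_eq_conv,
    conv_congr (reflect_ae v) (by linarith [ht.1])]

end

theorem rlOp_comp_rlOp (T : ℝ) (ha : 0 < a) (hb : 0 < b) :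
    (rlOp T ha : L2Time T →L[ℝ] L2Time T) ∘L rlOp T hb = rlOp T (add_pos ha hb) :=
  convOp_comp _ _ _ fun _ hr => integral_rlKer_mul_rlKer ha hb hr.1

theorem rlOp_rlOp (ha : 0 < a) (hb : 0 < b) (v : L2Time T) :
    rlOp T ha (rlOp T hb v) = rlOp T (add_pos ha hb) v :=
  congrArg (fun W : L2Time T →L[ℝ] L2Time T => W v) (rlOp_comp_rlOp T ha hb)

theorem rlOp_congr (ha : 0 < a) (hb : 0 < b) (h : a = b) (v : L2Time T) :
    rlOp T ha v = rlOp T hb v := by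
  subst h; rfl

theorem rlOpR_congr (ha : 0 < a) (hb : 0 < b) (h : a = b) (v : L2Time T) :
    rlOpR T ha v = rlOpR T hb v := by
  subst h; rfl

theorem rlOpR_rlOpR (ha : 0 < a) (hb : 0 < b) (v : L2Time T) :
    rlOpR T ha (rlOpR T hb v) = rlOpR T (add_pos ha hb) v := by
  rw [rlOpR_apply, rlOpR_apply, reflect_reflect, rlOp_rlOp, rlOpR_apply]

theorem commute_rlOp (ha : 0 < a) (hb : 0 < b) :
    Commute (rlOp T ha : L2Time T →L[ℝ] L2Time T) (rlOp T hb) := by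
  ext1 v
  change rlOp T ha (rlOp T hb v) = rlOp T hb (rlOp T ha v)
  rw [rlOp_rlOp, rlOp_rlOp]
  exact rlOp_congr _ _ (add_comm a b) v

theorem commute_rlOpR (ha : 0 < a) (hb : 0 < b) :
    Commute (rlOpR T ha : L2Time T →L[ℝ] L2Time T) (rlOpR T hb) := by
  ext1 v
  change rlOpR T ha (rlOpR T hb v) = rlOpR T hb (rlOpR T ha v)
  rw [rlOpR_rlOpR, rlOpR_rlOpR]
  exact rlOpR_congr _ _ (add_comm a b) v

theorem inner_L2Time (u w : L2Time T) :
    inner ℝ u w = ∫ t in Ioo 0 T, u t * w t := by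
  rw [L2.inner_def]
  refine integral_congr_ae (Eventually.of_forall fun t => ?_)
  simp [mul_comm]

theorem ENNReal_mul_le_sq_add_sq (x y : ℝ≥0∞) : x * y ≤ x ^ 2 + y ^ 2 := by
  rcases le_total x y with h | h
  · exact (mul_le_mul_left h y).trans ((pow_two y).symm.le.trans le_add_self)
  · exact (mul_le_mul_right h x).trans ((pow_two x).symm.le.trans le_self_add)

theorem lintegral_lconv_mul_ne_top {k : ℝ → ℝ} (hk : IsKernel T k) (u w : L2Time T) :
    ∫⁻ t in Ioo 0 T, lconv (fun r => ‖k r‖ₑ) (fun s => ‖u s‖ₑ) t * ‖w t‖ₑ ≠ ∞ := by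
  have hu := (Lp.stronglyMeasurable u).measurable
  have h : ∫⁻ t in Ioo 0 T, lconv (fun r => ‖k r‖ₑ) (fun s => ‖u s‖ₑ) t ^ 2 < ∞ :=
    (lintegral_lconv_sq_le hk.1.enorm hu.enorm T).trans_lt
      (ENNReal.mul_lt_top (ENNReal.pow_lt_top hk.lintegral_lt_top) (lintegral_enorm_sq_lt_top u))
  refine ne_top_of_le_ne_top ?_ (lintegral_mono fun t => ENNReal_mul_le_sq_add_sq _ _)
  rw [lintegral_add_left ((measurable_lconv hk.1.enorm hu.enorm).pow_const 2)]
  exact ENNReal.add_ne_top.2 ⟨h.ne, (lintegral_enorm_sq_lt_top w).ne⟩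

theorem inner_rlOp_left (hγ : 0 < γ) (u w : L2Time T) :
    inner ℝ (rlOp T hγ u) w = inner ℝ u (rlOpR T hγ w) := by
  have hk := isKernel_rlKer T hγ
  have hkm := hk.1
  have hu := (Lp.stronglyMeasurable u).measurable
  have hw := (Lp.stronglyMeasurable w).measurable
  have hF : Measurable fun p : ℝ × ℝ => rlKer γ (p.1 - p.2) * u p.2 * w p.1 := by fun_prop
  have hs := integral_tri_swap (T := T) hF (by
    refine ne_of_eq_of_ne ?_ (lintegral_lconv_mul_ne_top hk u w)
    refine lintegral_congr fun t => ?_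
    rw [lconv, ← lintegral_mul_const]
    · simp only [enorm_mul]
    · fun_prop)
  rw [inner_L2Time, inner_L2Time]
  have e1 : ∫ t in Ioo 0 T, rlOp T hγ u t * w t =
      ∫ t in Ioo 0 T, ∫ s in Ioo 0 t, rlKer γ (t - s) * u s * w t := by
    refine integral_congr_ae ?_
    filter_upwards [rlOp_ae hγ u] with t ht
    rw [ht, intLeft_eq_conv, conv, ← integral_mul_const]
    simp only [smul_eq_mul]
  have e2 : ∫ t in Ioo 0 T, u t * rlOpR T hγ w t =
      ∫ s in Ioo 0 T, ∫ t in Ioo s T, rlKer γ (t - s) * u s * w t := by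
    refine integral_congr_ae ?_
    filter_upwards [rlOpR_ae hγ w] with s hs
    rw [hs, intRight, ← integral_smul, ← integral_const_mul]
    simp only [smul_eq_mul, rlKer]
    congr 1
    funext t
    ring
  rw [e1, e2]
  exact hs

theorem adjoint_rlOp (T : ℝ) (hγ : 0 < γ) :
    (rlOp T hγ : L2Time T →L[ℝ] L2Time T).adjoint = rlOpR T hγ :=
  ((ContinuousLinearMap.eq_adjoint_iff _ _).2 fun u w => by
    rw [real_inner_comm, ← inner_rlOp_left, real_inner_comm]).symm

theorem adjoint_rlOpR (T : ℝ) (hγ : 0 < γ) :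
    (rlOpR T hγ : L2Time T →L[ℝ] L2Time T).adjoint = rlOp T hγ := by
  rw [← adjoint_rlOp, ContinuousLinearMap.adjoint_adjoint]

/-- Integration is accretive: `⟨V x, x⟩ = (∫ x)² / 2`. -/
theorem accretive_rlOp_one (T : ℝ) : Accretive (rlOp T one_pos : L2Time T →L[ℝ] L2Time T) := by
  intro x
  have h : inner ℝ (rlOp T one_pos x) x + inner ℝ (rlOp T one_pos x) x =
      (∫ s in Ioo 0 T, x s) * ∫ s in Ioo 0 T, x s := by
    nth_rewrite 2 [inner_rlOp_left, real_inner_comm]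
    rw [← inner_add_left, inner_L2Time, ← integral_const_mul]
    have hx : IntegrableOn x (Ioo 0 T) :=
      (Lp.memLp x).integrable (by norm_num)
    refine integral_congr_ae ?_
    filter_upwards [rlOp_ae one_pos x, rlOpR_ae one_pos x, ae_restrict_mem measurableSet_Ioo,
      Lp.coeFn_add (rlOp T one_pos x) (rlOpR T one_pos x)] with t h1 h2 ht h3
    rw [h3, Pi.add_apply, h1, h2, intLeft, intRight]
    simp only [sub_self, Real.rpow_zero, one_smul, Real.Gamma_one, div_one]
    congr 1
    rw [← integral_Ioc_eq_integral_Ioo (x := 0) (y := t), ← setIntegral_union]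
    · rw [Ioc_union_Ioo_eq_Ioo ht.1.le ht.2]
    · exact Set.disjoint_left.2 fun y hy hy' => absurd hy.2 (not_le.2 hy'.1)
    · exact measurableSet_Ioo
    · exact hx.mono_set (Ioc_subset_Ioo_right ht.2)
    · exact hx.mono_set (Ioo_subset_Ioo_left ht.1.le)
  nlinarith [mul_self_nonneg (∫ s in Ioo 0 T, x s)]

theorem accretive_rlOpR_one (T : ℝ) : Accretive (rlOpR T one_pos : L2Time T →L[ℝ] L2Time T) := by
  intro x
  rw [real_inner_comm, ← inner_rlOp_left]
  exact accretive_rlOp_one T x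

/-! ### The moment inequality -/

theorem convOp_eq_add_sub {k k₁ k₂ k₃ : ℝ → ℝ} (hk : IsKernel T k) (h₁ : IsKernel T k₁)
    (h₂ : IsKernel T k₂) (h₃ : IsKernel T k₃) (c : ℝ)
    (h : ∀ r ∈ Ioo 0 T, k r = k₁ r + c * k₂ r - k₃ r) (v : L2Time T) :
    convOp hk v = convOp h₁ v + c • convOp h₂ v - convOp h₃ v := by
  refine Lp.ext ?_
  filter_upwards [convOp_ae hk v, convOp_ae h₁ v, convOp_ae h₂ v, convOp_ae h₃ v,
    Lp.coeFn_sub (convOp h₁ v + c • convOp h₂ v) (convOp h₃ v),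
    Lp.coeFn_add (convOp h₁ v) (c • convOp h₂ v), Lp.coeFn_smul c (convOp h₂ v),
    ae_integrable_conv h₁ v, ae_integrable_conv h₂ v, ae_integrable_conv h₃ v,
    ae_restrict_mem measurableSet_Ioo] with t e0 e1 e2 e3 e4 e5 e6 i1 i2 i3 ht
  rw [e4, Pi.sub_apply, e5, Pi.add_apply, e6, Pi.smul_apply, e0, e1, e2, e3]
  simp only [conv, ← integral_smul]
  have i2' : Integrable (fun s => c • k₂ (t - s) • v s) (volume.restrict (Ioo 0 t)) := i2.smul c
  have i12 : Integrable (fun s => k₁ (t - s) • v s + c • k₂ (t - s) • v s)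
      (volume.restrict (Ioo 0 t)) := i1.add i2'
  rw [← integral_add i1 i2', ← integral_sub i12 i3]
  refine setIntegral_congr_fun measurableSet_Ioo fun s hs => ?_
  simp only [h (t - s) ⟨by linarith [hs.2], by linarith [hs.1, ht.2]⟩, smul_eq_mul]
  ring

/-- The part of `rlKer γ` above its value at `δ`. -/
noncomputable def rlHead (γ δ r : ℝ) : ℝ := if r < δ then rlKer γ r - rlKer γ δ else 0

/-- Minus the derivative of `rlKer γ`, restricted to `(δ, ∞)`. -/
noncomputable def rlTail (γ δ r : ℝ) : ℝ :=
  if δ < r then (1 - γ) * r ^ (γ - 2) / Real.Gamma γ else 0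

variable {δ : ℝ}

theorem lintegral_rlHead_le (hγ : 0 < γ) (hγ1 : γ < 1) (hδ : 0 < δ) :
    ∫⁻ r in Ioo 0 T, ‖rlHead γ δ r‖ₑ ≤ ENNReal.ofReal (δ ^ γ / Real.Gamma (γ + 1)) := by
  have hk := isKernel_rlKer δ hγ
  rw [← integral_rlKer hγ hδ.le, ofReal_integral_eq_lintegral_ofReal hk.2
    ((ae_restrict_mem measurableSet_Ioo).mono fun r hr => rlKer_nonneg hγ hr.1.le),
    ← lintegral_indicator measurableSet_Ioo, ← lintegral_indicator measurableSet_Ioo]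
  refine lintegral_mono fun r => ?_
  by_cases h1 : r ∈ Ioo 0 T
  · rw [indicator_of_mem h1, rlHead]
    split_ifs with h2
    · rw [indicator_of_mem (show r ∈ Ioo 0 δ from ⟨h1.1, h2⟩)]
      have h3 : rlKer γ δ ≤ rlKer γ r := by
        unfold rlKer
        have := Real.Gamma_pos_of_pos hγ
        gcongr ?_ / _
        exact Real.rpow_le_rpow_of_nonpos h1.1 h2.le (by linarith)
      rw [Real.enorm_of_nonneg (by linarith)]
      exact ENNReal.ofReal_le_ofReal (by linarith [rlKer_nonneg hγ hδ.le])
    · simp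
  · simp [indicator_of_notMem h1]

theorem integrableOn_rlTail (hγ1 : γ < 1) (hδ : 0 < δ) :
    IntegrableOn (fun r => (1 - γ) * r ^ (γ - 2) / Real.Gamma γ) (Ioi δ) :=
  ((integrableOn_Ioi_rpow_of_lt (by linarith) hδ).const_mul _).div_const _

theorem lintegral_rlTail_le (hγ : 0 < γ) (hγ1 : γ < 1) (hδ : 0 < δ) :
    ∫⁻ r in Ioo 0 T, ‖rlTail γ δ r‖ₑ ≤ ENNReal.ofReal (rlKer γ δ) := by
  have hint : ∫ r in Ioi δ, (1 - γ) * r ^ (γ - 2) / Real.Gamma γ = rlKer γ δ := by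
    rw [integral_div, integral_const_mul, integral_Ioi_rpow_of_lt (by linarith) hδ, rlKer]
    have : γ - 2 + 1 = γ - 1 := by ring
    rw [this]
    have h2 : γ - 1 ≠ 0 := by linarith
    field_simp
    ring
  have hnn : ∀ r, 0 < r → 0 ≤ (1 - γ) * r ^ (γ - 2) / Real.Gamma γ := fun r hr =>
    div_nonneg (mul_nonneg (by linarith) (Real.rpow_nonneg hr.le _)) (Real.Gamma_pos_of_pos hγ).le
  rw [← hint, ofReal_integral_eq_lintegral_ofReal (integrableOn_rlTail hγ1 hδ)
    ((ae_restrict_mem measurableSet_Ioi).mono fun r hr => hnn r (hδ.trans hr)),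
    ← lintegral_indicator measurableSet_Ioo, ← lintegral_indicator measurableSet_Ioi]
  refine lintegral_mono fun r => ?_
  by_cases h1 : r ∈ Ioo 0 T
  · rw [indicator_of_mem h1, rlTail]
    split_ifs with h2
    · rw [indicator_of_mem (show r ∈ Ioi δ from h2), Real.enorm_of_nonneg (hnn r h1.1)]
    · simp
  · simp [indicator_of_notMem h1]

theorem isKernel_rlHead (T : ℝ) (hγ : 0 < γ) (hγ1 : γ < 1) (hδ : 0 < δ) :
    IsKernel T (rlHead γ δ) := by
  have hm : Measurable (rlHead γ δ) :=
    Measurable.ite measurableSet_Iio ((isKernel_rlKer T hγ).1.sub measurable_const) measurable_const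
  exact ⟨hm, hm.aestronglyMeasurable,
    (lintegral_rlHead_le hγ hγ1 hδ).trans_lt ENNReal.ofReal_lt_top⟩

theorem isKernel_rlTail (T : ℝ) (hγ : 0 < γ) (hγ1 : γ < 1) (hδ : 0 < δ) :
    IsKernel T (rlTail γ δ) := by
  have hm : Measurable (rlTail γ δ) :=
    Measurable.ite measurableSet_Ioi (by fun_prop) measurable_const
  exact ⟨hm, hm.aestronglyMeasurable,
    (lintegral_rlTail_le hγ hγ1 hδ).trans_lt ENNReal.ofReal_lt_top⟩

theorem integral_rlTail (hγ1 : γ < 1) (hδ : 0 < δ) (r : ℝ) :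
    ∫ s in Ioo 0 r, rlTail γ δ (r - s) * rlKer 1 s = rlKer γ δ - rlKer γ (max r δ) := by
  simp only [rlKer_one, mul_one]
  have e : ∫ s in Ioo 0 r, rlTail γ δ (r - s) = ∫ s in Ioo 0 r, rlTail γ δ s := by
    rw [← integral_indicator measurableSet_Ioo, ← integral_indicator measurableSet_Ioo,
      ← integral_sub_left_eq_self _ _ r]
    refine integral_congr_ae (Eventually.of_forall fun s => ?_)
    simp only [indicator_apply, mem_Ioo, sub_sub_cancel]
    congr 1
    simp only [eq_iff_iff]
    constructor <;> rintro ⟨h1, h2⟩ <;> constructor <;> linarith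
  rw [e]
  rcases le_total r δ with h | h
  · rw [max_eq_right h, sub_self]
    refine setIntegral_eq_zero_of_forall_eq_zero fun s hs => ?_
    rw [rlTail, if_neg (by linarith [hs.2])]
  · rw [max_eq_left h]
    have e2 : ∫ s in Ioo 0 r, rlTail γ δ s = ∫ s in Ioo δ r,
        (1 - γ) * s ^ (γ - 2) / Real.Gamma γ := by
      rw [← integral_indicator measurableSet_Ioo, ← integral_indicator measurableSet_Ioo]
      refine integral_congr_ae (Eventually.of_forall fun s => ?_)
      simp only [indicator_apply, mem_Ioo, rlTail]
      by_cases h1 : δ < s <;> by_cases h2 : s < r <;> simp [h1, h2]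
      intro h3; linarith
    have h0 : (0 : ℝ) ∉ uIcc δ r := by
      rw [uIcc_of_le h]; exact fun h' => absurd h'.1 (not_le.2 hδ)
    rw [e2, ← integral_Ioc_eq_integral_Ioo, ← intervalIntegral.integral_of_le h,
      intervalIntegral.integral_div, intervalIntegral.integral_const_mul,
      integral_rpow (Or.inr ⟨by linarith, h0⟩), rlKer, rlKer]
    have : γ - 2 + 1 = γ - 1 := by ring
    rw [this]
    have h2 : γ - 1 ≠ 0 := by linarith
    field_simp
    ring

/-- The constant in the moment inequality for the Riemann-Liouville integral of order `γ`. -/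
noncomputable def rlConst (γ : ℝ) : ℝ := 1 / Real.Gamma (γ + 1) + 2 / Real.Gamma γ

theorem rlConst_nonneg (hγ : 0 < γ) : 0 ≤ rlConst γ :=
  add_nonneg (div_nonneg zero_le_one (Real.Gamma_pos_of_pos (by linarith)).le)
    (div_nonneg zero_le_two (Real.Gamma_pos_of_pos hγ).le)

/-- The kernel is split as `rlHead γ δ + rlKer γ δ - rlTail γ δ * 1`. -/
theorem momentBound_rlOp (T : ℝ) (hγ : 0 < γ) (hγ1 : γ < 1) :
    MomentBound (rlOp T one_pos : L2Time T →L[ℝ] L2Time T) (rlOp T hγ) γ (rlConst γ) := by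
  intro δ hδ x
  have hH := isKernel_rlHead T hγ hγ1 hδ
  have hL := isKernel_rlTail T hγ hγ1 hδ
  have h1 := isKernel_rlKer T one_pos
  have hP : IsKernel T (fun r => rlKer γ δ - rlKer γ (max r δ)) := by
    have hm : Measurable fun r => rlKer γ δ - rlKer γ (max r δ) :=
      measurable_const.sub ((isKernel_rlKer T hγ).1.comp (measurable_id.max measurable_const))
    refine ⟨hm, Measure.integrableOn_of_bounded (M := rlKer γ δ) (by simp)
      hm.aestronglyMeasurable ((ae_restrict_mem measurableSet_Ioo).mono fun r hr => ?_)⟩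
    have h2 : rlKer γ (max r δ) ≤ rlKer γ δ := by
      unfold rlKer
      have := Real.Gamma_pos_of_pos hγ
      gcongr ?_ / _
      exact Real.rpow_le_rpow_of_nonpos hδ (le_max_right _ _) (by linarith)
    have h3 : 0 ≤ rlKer γ (max r δ) := rlKer_nonneg hγ (hδ.le.trans (le_max_right _ _))
    rw [Real.norm_of_nonneg (by linarith)]
    linarith
  have hcomp := convOp_comp hL h1 hP fun r _ => integral_rlTail hγ1 hδ r
  have e1 : convOp hP x = convOp hL (rlOp T one_pos x) :=
    congrArg (fun W : L2Time T →L[ℝ] L2Time T => W x) hcomp.symm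
  have e := convOp_eq_add_sub (isKernel_rlKer T hγ) hH h1 hP (rlKer γ δ) (fun r hr => by
    rw [rlKer_one, mul_one, rlHead]
    split_ifs with h
    · rw [max_eq_right h.le]; ring
    · rw [max_eq_left (not_lt.1 h)]; ring) x
  rw [e1] at e
  have hk0 := rlKer_nonneg hγ hδ.le
  have hg0 : 0 ≤ δ ^ γ / Real.Gamma (γ + 1) :=
    div_nonneg (by positivity) (Real.Gamma_pos_of_pos (by linarith)).le
  have n : ∀ {k : ℝ → ℝ} (hk : IsKernel T k) (c : ℝ), 0 ≤ c →
      ∫⁻ r in Ioo 0 T, ‖k r‖ₑ ≤ ENNReal.ofReal c → ∀ y : L2Time T, ‖convOp hk y‖ ≤ c * ‖y‖ := by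
    intro k hk c hc h y
    have h2 := (enorm_convOp_le hk y).trans (mul_le_mul_left h _)
    rw [← ofReal_norm, ← ofReal_norm, ← ENNReal.ofReal_mul hc] at h2
    exact (ENNReal.ofReal_le_ofReal_iff (by positivity)).1 h2
  have n1 := n hH _ hg0 (lintegral_rlHead_le hγ hγ1 hδ) x
  have n2 := n hL _ hk0 (lintegral_rlTail_le hγ hγ1 hδ) (rlOp T one_pos x)
  change ‖convOp (isKernel_rlKer T hγ) x‖ ≤ _
  rw [e]
  calc _ ≤ ‖convOp hH x‖ + ‖rlKer γ δ • convOp h1 x‖ + ‖convOp hL (rlOp T one_pos x)‖ :=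
        (norm_sub_le _ _).trans (add_le_add_left (norm_add_le _ _) _)
    _ ≤ δ ^ γ / Real.Gamma (γ + 1) * ‖x‖ + rlKer γ δ * ‖rlOp T one_pos x‖ +
          rlKer γ δ * ‖rlOp T one_pos x‖ := by
        gcongr
        rw [norm_smul, Real.norm_of_nonneg hk0]; rfl
    _ ≤ _ := by
        have g1 := Real.Gamma_pos_of_pos hγ
        have g2 := Real.Gamma_pos_of_pos (show 0 < γ + 1 by linarith)
        have hA : 0 ≤ δ ^ γ * ‖x‖ := by positivity
        have hB : 0 ≤ δ ^ (γ - 1) * ‖rlOp T one_pos x‖ := by positivity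
        have e3 : δ ^ γ / Real.Gamma (γ + 1) * ‖x‖ + rlKer γ δ * ‖rlOp T one_pos x‖ +
          rlKer γ δ * ‖rlOp T one_pos x‖ = 1 / Real.Gamma (γ + 1) * (δ ^ γ * ‖x‖) +
            2 / Real.Gamma γ * (δ ^ (γ - 1) * ‖rlOp T one_pos x‖) := by
          rw [rlKer]; ring
        rw [e3, rlConst]
        have p1 : 0 ≤ 1 / Real.Gamma (γ + 1) := by positivity
        have p2 : 0 ≤ 2 / Real.Gamma γ := by positivity
        nlinarith [mul_nonneg p1 hB, mul_nonneg p2 hA]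

theorem momentBound_rlOpR (T : ℝ) (hγ : 0 < γ) (hγ1 : γ < 1) :
    MomentBound (rlOpR T one_pos : L2Time T →L[ℝ] L2Time T) (rlOpR T hγ) γ (rlConst γ) := by
  intro δ hδ x
  have h := momentBound_rlOp T hγ hγ1 δ hδ (reflect T x)
  rw [rlOpR_apply, rlOpR_apply, LinearIsometry.norm_map, LinearIsometry.norm_map]
  rwa [LinearIsometry.norm_map] at h

-- Definitional unfolding of these operators is expensive and never needed below.
attribute [irreducible] rlOp rlOpR reflect

end FracWave

namespace FracWave

/-! ### Comparison of left- and right-sided integrals of order less than `1 / 2` -/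

variable {T γ : ℝ}

/-- The function `x^{γ-1} (1 + x)^{γ-1}` on `(0, ∞)`. -/
noncomputable def crossFun (γ : ℝ) : ℝ → ℝ :=
  (Ioi 0).indicator fun x => x ^ (γ - 1) * (1 + x) ^ (γ - 1)

/-- The kernel `rlKer γ`, extended by zero to the negative half-line. -/
noncomputable def rlKer₀ (γ : ℝ) : ℝ → ℝ := (Ioi 0).indicator (rlKer γ)

theorem measurable_rlKer₀ (γ : ℝ) : Measurable (rlKer₀ γ) :=
  Measurable.indicator (by unfold rlKer; fun_prop) measurableSet_Ioi

theorem rlKer₀_nonneg (hγ : 0 < γ) (r : ℝ) : 0 ≤ rlKer₀ γ r :=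
  indicator_nonneg (fun _ hr => rlKer_nonneg hγ (le_of_lt hr)) r

theorem integrable_crossFun (hγ : 0 < γ) (hγ2 : γ < 1 / 2) : Integrable (crossFun γ) := by
  rw [crossFun, integrable_indicator_iff measurableSet_Ioi, ← Ioc_union_Ioi_eq_Ioi zero_le_one]
  have hm : Measurable fun x : ℝ => x ^ (γ - 1) * (1 + x) ^ (γ - 1) := by fun_prop
  refine IntegrableOn.union ?_ ?_
  · have h := intervalIntegral.intervalIntegrable_rpow' (a := 0) (b := 1) (r := γ - 1)
      (by linarith)
    rw [intervalIntegrable_iff_integrableOn_Ioc_of_le zero_le_one] at h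
    refine Integrable.mono h hm.aestronglyMeasurable ?_
    filter_upwards [ae_restrict_mem measurableSet_Ioc] with x hx
    have h1 : 0 ≤ x ^ (γ - 1) := Real.rpow_nonneg hx.1.le _
    have h2 : 0 ≤ (1 + x) ^ (γ - 1) := Real.rpow_nonneg (by linarith [hx.1]) _
    have h3 : (1 + x) ^ (γ - 1) ≤ 1 :=
      Real.rpow_le_one_of_one_le_of_nonpos (by linarith [hx.1]) (by linarith)
    rw [Real.norm_of_nonneg (mul_nonneg h1 h2), Real.norm_of_nonneg h1]
    exact mul_le_of_le_one_right h1 h3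
  · refine Integrable.mono (integrableOn_Ioi_rpow_of_lt (a := 2 * γ - 2) (by linarith)
      zero_lt_one) hm.aestronglyMeasurable ?_
    filter_upwards [ae_restrict_mem measurableSet_Ioi] with x hx
    have hx0 : 0 < x := zero_lt_one.trans hx
    have h1 : 0 ≤ x ^ (γ - 1) := Real.rpow_nonneg hx0.le _
    have h2 : 0 ≤ (1 + x) ^ (γ - 1) := Real.rpow_nonneg (by linarith) _
    have h3 : (1 + x) ^ (γ - 1) ≤ x ^ (γ - 1) :=
      Real.rpow_le_rpow_of_nonpos hx0 (by linarith) (by linarith)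
    have e : x ^ (2 * γ - 2) = x ^ (γ - 1) * x ^ (γ - 1) := by
      rw [← Real.rpow_add hx0]; congr 1; ring
    rw [Real.norm_of_nonneg (mul_nonneg h1 h2), Real.norm_of_nonneg (Real.rpow_nonneg hx0.le _), e]
    exact mul_le_mul_of_nonneg_left h3 h1

/-- `∫₀^∞ x^{γ-1} (1 + x)^{γ-1} dx / Γ(γ)²`. -/
noncomputable def crossConst (γ : ℝ) : ℝ := (∫ x, crossFun γ x) / Real.Gamma γ ^ 2

theorem crossConst_pos (hγ : 0 < γ) (hγ2 : γ < 1 / 2) : 0 < crossConst γ := by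
  refine div_pos ?_ (pow_pos (Real.Gamma_pos_of_pos hγ) 2)
  have hpos : ∀ x : ℝ, 0 < x → 0 < x ^ (γ - 1) * (1 + x) ^ (γ - 1) := fun x hx =>
    mul_pos (Real.rpow_pos_of_pos hx _) (Real.rpow_pos_of_pos (by linarith) _)
  have hnn : 0 ≤ crossFun γ := fun x => indicator_nonneg (fun x hx => (hpos x hx).le) x
  rw [integral_pos_iff_support_of_nonneg hnn (integrable_crossFun hγ hγ2)]
  refine lt_of_lt_of_le ?_ (measure_mono (s := Ioi (0 : ℝ)) fun x hx => ?_)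
  · simp
  · rw [Function.mem_support, crossFun, indicator_of_mem hx]
    exact (hpos x hx).ne'

theorem rlKer₀_mul_eq {s s' : ℝ} (h : s' < s) (t : ℝ) :
    rlKer₀ γ (t - s) * rlKer₀ γ (t - s') =
      (s - s') ^ (2 * γ - 2) / Real.Gamma γ ^ 2 * crossFun γ ((s - s')⁻¹ * (t - s)) := by
  have ha : 0 < s - s' := by linarith
  by_cases ht : s < t
  · have hts : 0 < t - s := by linarith
    have hts' : 0 < t - s' := by linarith
    have h1 : 0 < (s - s')⁻¹ * (t - s) := by positivity
    have e1 : 1 + (s - s')⁻¹ * (t - s) = (s - s')⁻¹ * (t - s') := by field_simp; ring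
    have e2 : (s - s') ^ (2 * γ - 2) = (s - s') ^ (γ - 1) * (s - s') ^ (γ - 1) := by
      rw [← Real.rpow_add ha]; congr 1; ring
    rw [rlKer₀, indicator_of_mem (show t - s ∈ Ioi (0 : ℝ) from hts),
      indicator_of_mem (show t - s' ∈ Ioi (0 : ℝ) from hts'), crossFun,
      indicator_of_mem (show _ ∈ Ioi (0 : ℝ) from h1), e1,
      Real.mul_rpow (by positivity) hts.le, Real.mul_rpow (by positivity) hts'.le,
      Real.inv_rpow ha.le, e2, rlKer, rlKer]
    have := (Real.rpow_pos_of_pos ha (γ - 1)).ne'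
    field_simp
  · have h1 : ¬ 0 < (s - s')⁻¹ * (t - s) := by
      rw [not_lt]
      exact mul_nonpos_of_nonneg_of_nonpos (by positivity) (by linarith)
    rw [rlKer₀, indicator_of_notMem (show t - s ∉ Ioi (0 : ℝ) from fun h' => ht (by
      rw [mem_Ioi] at h'; linarith)), crossFun, indicator_of_notMem (show _ ∉ Ioi (0 : ℝ) from h1)]
    simp

/-- `∫ rlKer₀(t - s) rlKer₀(t - s') dt` is a multiple of `|s - s'|^{2γ-1}`. -/
theorem integral_rlKer₀_mul (hγ : 0 < γ) (hγ2 : γ < 1 / 2) {s s' : ℝ} (h : s ≠ s') :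
    Integrable (fun t => rlKer₀ γ (t - s) * rlKer₀ γ (t - s')) ∧
      ∫ t, rlKer₀ γ (t - s) * rlKer₀ γ (t - s') = crossConst γ * |s - s'| ^ (2 * γ - 1) := by
  have key : ∀ {s s' : ℝ}, s' < s →
      Integrable (fun t => rlKer₀ γ (t - s) * rlKer₀ γ (t - s')) ∧
      ∫ t, rlKer₀ γ (t - s) * rlKer₀ γ (t - s') = crossConst γ * |s - s'| ^ (2 * γ - 1) := by
    intro s s' h
    have ha : 0 < s - s' := by linarith
    simp only [rlKer₀_mul_eq h]
    have hi := (integrable_crossFun hγ hγ2).comp_mul_left' (inv_ne_zero ha.ne')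
    refine ⟨(hi.comp_sub_right s).const_mul _, ?_⟩
    rw [integral_const_mul,
      integral_sub_right_eq_self (fun t => crossFun γ ((s - s')⁻¹ * t)) s,
      Measure.integral_comp_mul_left, inv_inv, abs_of_pos ha, crossConst, smul_eq_mul]
    have e : (s - s') ^ (2 * γ - 1) = (s - s') ^ (2 * γ - 2) * (s - s') := by
      rw [← Real.rpow_add_one ha.ne']; congr 1; ring
    rw [e]; ring
  rcases lt_or_gt_of_ne h with h | h
  · have := key h
    simp only [mul_comm (rlKer₀ γ (_ - s')), abs_sub_comm s'] at this
    exact this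
  · exact key h

/-- The singular quadratic form `∬ |s - s'|^{2γ-1} u(s) u(s')` is integrable and equals
`2 Γ(2γ) ⟨D_{0+}^{-2γ} u, u⟩`. -/
theorem integral_abs_rpow_mul (hγ : 0 < γ) (hγ2 : γ < 1 / 2) (u : L2Time T) :
    Integrable (fun p : ℝ × ℝ => |p.1 - p.2| ^ (2 * γ - 1) * (u p.1 * u p.2))
        ((timeMeasure T).prod (timeMeasure T)) ∧
      ∫ p, |p.1 - p.2| ^ (2 * γ - 1) * (u p.1 * u p.2) ∂((timeMeasure T).prod (timeMeasure T)) =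
        2 * Real.Gamma (2 * γ) * inner ℝ (rlOp T (show 0 < 2 * γ by linarith) u) u := by
  have hu := (Lp.stronglyMeasurable u).measurable
  have h2γ : 0 < 2 * γ := by linarith
  have hG := Real.Gamma_pos_of_pos h2γ
  set Ψ : ℝ × ℝ → ℝ := fun p => |p.1 - p.2| ^ (2 * γ - 1) * (u p.1 * u p.2) with hΨ
  have hΨm : Measurable Ψ := by fun_prop
  have hΨe : ∀ {t s : ℝ}, s < t →
      Ψ (t, s) = Real.Gamma (2 * γ) * (rlKer (2 * γ) (t - s) * u s * u t) := by
    intro t s h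
    simp only [hΨ, rlKer, abs_of_pos (show 0 < t - s by linarith)]
    field_simp
  have hf : Integrable ((tri T).indicator Ψ) ((volume : Measure ℝ).prod volume) := by
    refine integrable_tri hΨm ?_
    refine ne_of_eq_of_ne ?_ (ENNReal.mul_ne_top (enorm_ne_top (x := Real.Gamma (2 * γ)))
      (lintegral_lconv_mul_ne_top (isKernel_rlKer T h2γ) u u))
    rw [← lintegral_const_mul' _ _ enorm_ne_top]
    refine lintegral_congr fun t => ?_
    have hkm := (isKernel_rlKer T h2γ).1
    rw [lconv, ← lintegral_mul_const _ (by fun_prop), ← lintegral_const_mul' _ _ enorm_ne_top]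
    refine setLIntegral_congr_fun measurableSet_Ioo fun s hs => ?_
    simp only [hΨe hs.2, enorm_mul]
  have hsplit : (Ioo 0 T ×ˢ Ioo 0 T).indicator Ψ =
      fun p => (tri T).indicator Ψ p + (tri T).indicator Ψ p.swap := by
    funext ⟨t, s⟩
    have hsym : Ψ (s, t) = Ψ (t, s) := by simp only [hΨ, abs_sub_comm s t, mul_comm (u s)]
    simp only [indicator_apply, tri, mem_ofPred_eq, mem_prod, mem_Ioo, Prod.swap_prod_mk, hsym]
    rcases lt_trichotomy s t with h | h | h
    · have h' : ¬ t < s := by linarith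
      by_cases h1 : 0 < s <;> by_cases h2 : t < T
      · simp [h, h', h1, h2, h1.trans h, h.trans h2]
      all_goals simp [h', h1, h2]
    · subst h
      have h0 : Ψ (s, s) = 0 := by
        simp only [hΨ, sub_self, abs_zero]
        rw [Real.zero_rpow (by linarith), zero_mul]
      simp [h0]
    · have h' : ¬ s < t := by linarith
      by_cases h1 : 0 < t <;> by_cases h2 : s < T
      · simp [h, h', h1, h2, h1.trans h, h.trans h2]
      all_goals simp [h', h1, h2]
  have hprod : (timeMeasure T).prod (timeMeasure T) =
      ((volume : Measure ℝ).prod volume).restrict (Ioo 0 T ×ˢ Ioo 0 T) := Measure.prod_restrict _ _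
  have hms : MeasurableSet (Ioo 0 T ×ˢ Ioo 0 T : Set (ℝ × ℝ)) :=
    measurableSet_Ioo.prod measurableSet_Ioo
  constructor
  · rw [hprod]
    change IntegrableOn Ψ _ _
    rw [← integrable_indicator_iff hms, hsplit]
    exact hf.add hf.swap
  · have hf' : Integrable (fun p : ℝ × ℝ => (tri T).indicator Ψ p.swap)
      ((volume : Measure ℝ).prod volume) := hf.swap
    rw [hprod, ← integral_indicator hms, hsplit, integral_add hf hf',
      integral_prod_swap (fun p => (tri T).indicator Ψ p), ← two_mul, integral_prod _ hf]
    simp only [integral_tri_left]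
    rw [integral_indicator measurableSet_Ioo, inner_L2Time, mul_assoc,
      ← integral_const_mul (Real.Gamma (2 * γ))]
    refine congrArg ((2 : ℝ) * ·) (integral_congr_ae ?_)
    filter_upwards [rlOp_ae h2γ u] with t ht
    rw [ht, intLeft_eq_conv, conv, ← integral_mul_const, ← integral_const_mul]
    refine setIntegral_congr_fun measurableSet_Ioo fun s hs => ?_
    simp only [hΨe hs.2, smul_eq_mul]

/-- `‖D_{0+}^{-γ} u‖²` over `(0, T)` is at most the same quantity over `ℝ`, and the latter is a
multiple of `⟨D_{0+}^{-2γ} u, u⟩`. -/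
theorem norm_rlOp_sq_le (hγ : 0 < γ) (hγ2 : γ < 1 / 2) (u : L2Time T) :
    ‖rlOp T hγ u‖ ^ 2 ≤ crossConst γ * (2 * Real.Gamma (2 * γ) *
      inner ℝ (rlOp T (show 0 < 2 * γ by linarith) u) u) := by
  have hu := (Lp.stronglyMeasurable u).measurable
  have hkm := measurable_rlKer₀ γ
  obtain ⟨hΨ, hΨi⟩ := integral_abs_rpow_mul hγ hγ2 u
  set ν := (timeMeasure T).prod (timeMeasure T) with hν
  set Φ : ℝ × (ℝ × ℝ) → ℝ := fun q =>
    (rlKer₀ γ (q.1 - q.2.1) * rlKer₀ γ (q.1 - q.2.2)) * (u q.2.1 * u q.2.2) with hΦ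
  have hΦm : Measurable Φ := by fun_prop
  have hne : ∀ᵐ y ∂ν, y.1 ≠ y.2 := by
    have hm : MeasurableSet {y : ℝ × ℝ | y.1 ≠ y.2} :=
      (measurableSet_eq_fun measurable_fst measurable_snd).compl
    rw [hν, Measure.ae_prod_iff_ae_ae hm]
    exact Eventually.of_forall fun x => by
      have h : ∀ᵐ y ∂(timeMeasure T), y ≠ x := compl_mem_ae_iff.2 (measure_singleton x)
      exact h.mono fun y hy => hy.symm
  have hint : Integrable Φ ((volume : Measure ℝ).prod ν) := by
    rw [integrable_prod_iff' hΦm.aestronglyMeasurable]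
    refine ⟨hne.mono fun y hy => (integral_rlKer₀_mul hγ hγ2 hy).1.mul_const (u y.1 * u y.2), ?_⟩
    refine (hΨ.norm.const_mul (crossConst γ)).congr ?_
    filter_upwards [hne] with y hy
    simp only [hΦ, norm_mul, Real.norm_of_nonneg (rlKer₀_nonneg hγ _)]
    rw [integral_mul_const, (integral_rlKer₀_mul hγ hγ2 hy).2,
      Real.norm_of_nonneg (Real.rpow_nonneg (abs_nonneg _) _)]
    ring
  have hsq : ∀ t, ∫ y, Φ (t, y) ∂ν = (∫ s in Ioo 0 T, rlKer₀ γ (t - s) * u s) ^ 2 := by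
    intro t
    rw [pow_two, ← integral_prod_mul]
    refine integral_congr_ae (Eventually.of_forall fun y => ?_)
    simp only [hΦ]; ring
  have htot : ∫ t, (∫ s in Ioo 0 T, rlKer₀ γ (t - s) * u s) ^ 2 = crossConst γ *
      (2 * Real.Gamma (2 * γ) * inner ℝ (rlOp T (show 0 < 2 * γ by linarith) u) u) := by
    rw [← hΨi, ← integral_const_mul]
    simp only [← hsq]
    rw [integral_integral_swap (f := fun t y => Φ (t, y)) hint]
    refine integral_congr_ae ?_
    filter_upwards [hne] with y hy
    simp only [hΦ]
    rw [integral_mul_const, (integral_rlKer₀_mul hγ hγ2 hy).2]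
    ring
  rw [← htot, ← real_inner_self_eq_norm_sq, inner_L2Time]
  have hi : Integrable fun t => (∫ s in Ioo 0 T, rlKer₀ γ (t - s) * u s) ^ 2 := by
    simp only [← hsq]; exact hint.integral_prod_left
  refine le_trans (le_of_eq ?_) (setIntegral_le_integral (s := Ioo 0 T) hi
    (Eventually.of_forall fun t => sq_nonneg _))
  refine integral_congr_ae ?_
  filter_upwards [rlOp_ae hγ u, ae_restrict_mem measurableSet_Ioo] with t ht htT
  rw [ht, intLeft_eq_conv, conv, ← pow_two]
  congr 1
  rw [← integral_indicator measurableSet_Ioo, ← integral_indicator measurableSet_Ioo]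
  refine integral_congr_ae (Eventually.of_forall fun s => ?_)
  simp only [indicator_apply, mem_Ioo, rlKer₀, mem_Ioi, smul_eq_mul]
  by_cases h1 : 0 < s <;> by_cases h2 : s < t
  · have h3 : s < T := h2.trans htT.2
    simp [h1, h2, h3]
  · simp [h2]
  · simp [h1]
  · simp [h1]

/-- The constant of coercivity of the form `⟨D_{0+}^{-γ} u, D_{T-}^{-γ} u⟩`. -/
noncomputable def coerConst (γ : ℝ) : ℝ := (crossConst γ * (2 * Real.Gamma (2 * γ)))⁻¹

theorem coerConst_pos (hγ : 0 < γ) (hγ2 : γ < 1 / 2) : 0 < coerConst γ :=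
  inv_pos.2 (mul_pos (crossConst_pos hγ hγ2)
    (mul_pos two_pos (Real.Gamma_pos_of_pos (by linarith))))

theorem adjointCoercive_rlOp (T : ℝ) (hγ : 0 < γ) (hγ2 : γ < 1 / 2) :
    AdjointCoercive (rlOp T hγ : L2Time T →L[ℝ] L2Time T) (coerConst γ) := by
  have hpos := coerConst_pos hγ hγ2
  have key : ∀ u : L2Time T, coerConst γ * ‖rlOp T hγ u‖ ^ 2 ≤
      inner ℝ (rlOp T hγ u) (rlOpR T hγ u) := by
    intro u
    have h := norm_rlOp_sq_le hγ hγ2 u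
    rw [← inner_rlOp_left, rlOp_rlOp, rlOp_congr (add_pos hγ hγ)
      (show 0 < 2 * γ by linarith) (two_mul γ).symm]
    rw [coerConst, inv_mul_le_iff₀ (inv_pos.1 hpos)]
    linarith
  intro u
  rw [adjoint_rlOp]
  refine ⟨key u, ?_⟩
  have h := key (reflect T u)
  have e1 : rlOpR T hγ (reflect T u) = reflect T (rlOp T hγ u) := by
    rw [rlOpR_apply, reflect_reflect]
  have e2 : ‖rlOp T hγ (reflect T u)‖ = ‖rlOpR T hγ u‖ := by
    rw [rlOpR_apply, LinearIsometry.norm_map]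
  have e3 : rlOp T hγ (reflect T u) = reflect T (rlOpR T hγ u) := by
    rw [rlOpR_apply, reflect_reflect]
  rw [e1, e2, e3, LinearIsometry.inner_map_map, real_inner_comm] at h
  exact h

end FracWave

namespace FracWave

/-! ### Weak derivatives and the Volterra operator -/

variable {T γ : ℝ}

theorem IsTest.memLp {ψ : ℝ → ℝ} (h : IsTest T ψ) : MemLp ψ 2 (timeMeasure T) :=
  h.1.continuous.memLp_of_hasCompactSupport h.2.1

theorem IsTest.memLp_deriv {ψ : ℝ → ℝ} (h : IsTest T ψ) : MemLp (deriv ψ) 2 (timeMeasure T) :=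
  h.continuous_deriv.memLp_of_hasCompactSupport h.2.1.deriv

/-- A test function as an element of `L²(0, T)`. -/
noncomputable def IsTest.toLp {ψ : ℝ → ℝ} (h : IsTest T ψ) : L2Time T := h.memLp.toLp ψ

/-- The derivative of a test function as an element of `L²(0, T)`. -/
noncomputable def IsTest.derivLp {ψ : ℝ → ℝ} (h : IsTest T ψ) : L2Time T :=
  h.memLp_deriv.toLp (deriv ψ)

theorem IsTest.derivLp_ae {ψ : ℝ → ℝ} (h : IsTest T ψ) :
    h.derivLp =ᵐ[timeMeasure T] deriv ψ :=
  h.memLp_deriv.coeFn_toLp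

theorem integral_mul_eq_inner (v w : L2Time T) {f : ℝ → ℝ} (h : w =ᵐ[timeMeasure T] f) :
    ∫ t, v t * f t ∂(timeMeasure T) = inner ℝ v w := by
  rw [inner_L2Time]
  refine integral_congr_ae ?_
  filter_upwards [h] with t ht
  rw [ht]

theorem IsTest.eq_zero_of_le {ψ : ℝ → ℝ} (h : IsTest T ψ) {t : ℝ} (ht : t ≤ 0) : ψ t = 0 :=
  image_eq_zero_of_notMem_tsupport fun h' => absurd (h.2.2 h').1 (not_lt.2 ht)

theorem IsTest.eq_zero_of_ge {ψ : ℝ → ℝ} (h : IsTest T ψ) {t : ℝ} (ht : T ≤ t) : ψ t = 0 :=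
  image_eq_zero_of_notMem_tsupport fun h' => absurd (h.2.2 h').2 (not_lt.2 ht)

theorem integral_deriv_Ioo {ψ : ℝ → ℝ} (h : IsTest T ψ) {a b : ℝ} (hab : a ≤ b) :
    ∫ s in Ioo a b, deriv ψ s = ψ b - ψ a := by
  rw [← integral_Ioc_eq_integral_Ioo, ← intervalIntegral.integral_of_le hab]
  exact intervalIntegral.integral_deriv_eq_sub
    (fun x _ => (h.1.differentiable (by norm_num)).differentiableAt)
    (h.continuous_deriv.intervalIntegrable _ _)

theorem rlOp_one_derivLp {ψ : ℝ → ℝ} (h : IsTest T ψ) : rlOp T one_pos h.derivLp = h.toLp := by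
  refine Lp.ext ?_
  filter_upwards [rlOp_ae one_pos h.derivLp, h.memLp.coeFn_toLp,
    ae_restrict_mem measurableSet_Ioo] with t h1 h2 ht
  have h3 : h.toLp t = ψ t := h2
  rw [h1, h3, intLeft_eq_conv, conv_congr (IsTest.derivLp_ae h) ht.2.le, conv]
  simp only [rlKer_one, one_smul]
  rw [integral_deriv_Ioo h ht.1.le, h.eq_zero_of_le le_rfl, sub_zero]

theorem rlOpR_one_derivLp {ψ : ℝ → ℝ} (h : IsTest T ψ) :
    rlOpR T one_pos h.derivLp = -h.toLp := by
  refine Lp.ext ?_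
  filter_upwards [rlOpR_ae one_pos h.derivLp, h.memLp.coeFn_toLp, Lp.coeFn_neg h.toLp,
    ae_restrict_mem measurableSet_Ioo] with t h1 h2 h4 ht
  have h3 : h.toLp t = ψ t := h2
  rw [h1, h4, Pi.neg_apply, h3, intRight]
  simp only [sub_self, Real.rpow_zero, one_smul, Real.Gamma_one, div_one]
  have e : ∫ s in Ioo t T, h.derivLp s = ∫ s in Ioo t T, deriv ψ s :=
    integral_congr_ae (ae_restrict_of_ae_restrict_of_subset (Ioo_subset_Ioo_left ht.1.le)
      h.memLp_deriv.coeFn_toLp)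
  rw [e, integral_deriv_Ioo h ht.2.le, h.eq_zero_of_ge le_rfl, zero_sub]

theorem hasWeakDeriv_iff {v g : L2Time T} :
    HasWeakDeriv T v g ↔ ∀ (ψ : ℝ → ℝ) (h : IsTest T ψ),
      inner ℝ v h.derivLp = -inner ℝ g h.toLp := by
  refine forall₂_congr fun ψ h => ?_
  rw [integral_mul_eq_inner v h.derivLp h.memLp_deriv.coeFn_toLp,
    integral_mul_eq_inner g h.toLp h.memLp.coeFn_toLp]

theorem hasWeakDeriv_rlOp_one (x : L2Time T) : HasWeakDeriv T (rlOp T one_pos x) x := by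
  rw [hasWeakDeriv_iff]
  intro ψ h
  rw [inner_rlOp_left, rlOpR_one_derivLp, inner_neg_right]

theorem hasWeakDeriv_rlOpR_one (x : L2Time T) : HasWeakDeriv T (rlOpR T one_pos x) (-x) := by
  rw [hasWeakDeriv_iff]
  intro ψ h
  rw [real_inner_comm, ← inner_rlOp_left, rlOp_one_derivLp, inner_neg_left, neg_neg,
    real_inner_comm]

theorem vanishesAt_rlOp_one (hT : 0 < T) (x : L2Time T) : VanishesAt T 0 (rlOp T one_pos x) := by
  have hx : IntegrableOn x (Icc 0 T) := by
    rw [integrableOn_Icc_iff_integrableOn_Ioo]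
    exact (Lp.memLp x).integrable (by norm_num)
  refine ⟨fun t => ∫ s in (0 : ℝ)..t, x s, ?_, ?_, by simp⟩
  · have := intervalIntegral.continuousOn_primitive_interval (f := x) (a := 0) (b := T)
      (μ := volume) (by rwa [uIcc_of_le hT.le])
    rwa [uIcc_of_le hT.le] at this
  · filter_upwards [rlOp_ae one_pos x, ae_restrict_mem measurableSet_Ioo] with t h1 ht
    rw [h1, intLeft_eq_conv, conv]
    simp only [rlKer_one, one_smul]
    rw [intervalIntegral.integral_of_le ht.1.le, integral_Ioc_eq_integral_Ioo]

theorem vanishesAt_rlOpR_one (hT : 0 < T) (x : L2Time T) :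
    VanishesAt T T (rlOpR T one_pos x) := by
  obtain ⟨F, hF, hae, h0⟩ := vanishesAt_rlOp_one hT (reflect T x)
  refine ⟨fun t => F (T - t), hF.comp (by fun_prop) fun t ht => ?_, ?_, by simpa using h0⟩
  · exact ⟨by linarith [ht.2], by linarith [ht.1]⟩
  · rw [rlOpR_apply]
    filter_upwards [reflect_ae (rlOp T one_pos (reflect T x)),
      (measurePreserving_reflect T).quasiMeasurePreserving.ae hae] with t h1 h2
    rw [h1, h2]

/-- The fundamental lemma of the calculus of variations on `(0, T)`. -/
theorem ae_eq_zero_of_integral_test {f : ℝ → ℝ} (hf : Integrable f (timeMeasure T))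
    (h : ∀ ψ, IsTest T ψ → ∫ t, f t * ψ t ∂(timeMeasure T) = 0) :
    ∀ᵐ t ∂(timeMeasure T), f t = 0 := by
  have h1 := (isOpen_Ioo (a := (0 : ℝ)) (b := T)).ae_eq_zero_of_integral_contDiff_smul_eq_zero
    (μ := timeMeasure T) (hf.locallyIntegrable.locallyIntegrableOn _) fun g hg hc hs => by
      rw [← h g ⟨hg, hc, hs⟩]
      simp only [smul_eq_mul, mul_comm]
  filter_upwards [h1, ae_restrict_mem measurableSet_Ioo] with t h2 ht
  exact h2 ht

theorem eq_zero_of_inner_test {x : L2Time T}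
    (h : ∀ (ψ : ℝ → ℝ) (hψ : IsTest T ψ), inner ℝ x hψ.toLp = 0) : x = 0 := by
  refine Lp.ext ?_
  filter_upwards [ae_eq_zero_of_integral_test ((Lp.memLp x).integrable (by norm_num))
    (fun ψ hψ => (integral_mul_eq_inner x hψ.toLp hψ.memLp.coeFn_toLp).trans (h ψ hψ)),
    Lp.coeFn_zero ℝ 2 (timeMeasure T)] with t h1 h2
  rw [h1, h2, Pi.zero_apply]

theorem injective_rlOp_one : Function.Injective (rlOp T one_pos : L2Time T → L2Time T) := by
  rw [injective_iff_map_eq_zero]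
  intro x hx
  refine eq_zero_of_inner_test fun ψ hψ => ?_
  have h := hasWeakDeriv_iff.1 (hasWeakDeriv_rlOp_one x) ψ hψ
  rw [hx, inner_zero_left] at h
  linarith

theorem injective_rlOpR_one : Function.Injective (rlOpR T one_pos : L2Time T → L2Time T) := by
  intro x y h
  rw [rlOpR_apply, rlOpR_apply] at h
  exact (reflect T).injective (injective_rlOp_one ((reflect T).injective h))

theorem injective_rlOp (hγ : 0 < γ) (hγ1 : γ < 1) :
    Function.Injective (rlOp T hγ : L2Time T → L2Time T) := by
  intro x y h
  have e : ∀ z : L2Time T, rlOp T (show 0 < 1 - γ by linarith) (rlOp T hγ z) =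
      rlOp T one_pos z := fun z => by
    rw [rlOp_rlOp]; exact rlOp_congr _ _ (by ring) z
  exact injective_rlOp_one (by rw [← e, ← e, h])

theorem injective_rlOpR (hγ : 0 < γ) (hγ1 : γ < 1) :
    Function.Injective (rlOpR T hγ : L2Time T → L2Time T) := by
  intro x y h
  rw [rlOpR_apply, rlOpR_apply] at h
  exact (reflect T).injective (injective_rlOp hγ hγ1 ((reflect T).injective h))

theorem denseRange_of_injective_adjoint {H : Type*} [NormedAddCommGroup H] [InnerProductSpace ℝ H]
    [CompleteSpace H] {B : H →L[ℝ] H} (h : Function.Injective B.adjoint) : DenseRange B := by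
  have h1 : (LinearMap.range B.toLinearMap).topologicalClosure = ⊤ := by
    rw [Submodule.topologicalClosure_eq_top_iff, Submodule.eq_bot_iff]
    intro x hx
    refine h ?_
    rw [map_zero]
    refine ext_inner_right ℝ fun y => ?_
    rw [ContinuousLinearMap.adjoint_inner_left, inner_zero_left, real_inner_comm]
    exact (Submodule.mem_orthogonal _ _).1 hx _ ⟨y, rfl⟩
  have h2 := Submodule.dense_iff_topologicalClosure_eq_top.2 h1
  exact h2

theorem denseRange_rlOp_one : DenseRange (rlOp T one_pos : L2Time T →L[ℝ] L2Time T) :=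
  denseRange_of_injective_adjoint (by rw [adjoint_rlOp]; exact injective_rlOpR_one)

theorem denseRange_rlOpR_one : DenseRange (rlOpR T one_pos : L2Time T →L[ℝ] L2Time T) :=
  denseRange_of_injective_adjoint (by rw [adjoint_rlOpR]; exact injective_rlOp_one)

theorem denseRange_rlOp (hγ : 0 < γ) (hγ1 : γ < 1) :
    DenseRange (rlOp T hγ : L2Time T →L[ℝ] L2Time T) :=
  denseRange_of_injective_adjoint (by rw [adjoint_rlOp]; exact injective_rlOpR hγ hγ1)

/-- A test function with vanishing integral is the derivative of a test function. -/
theorem IsTest.exists_deriv_eq {η : ℝ → ℝ} (h : IsTest T η) (hT : 0 < T)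
    (h0 : ∫ t, η t ∂(timeMeasure T) = 0) : ∃ ψ, IsTest T ψ ∧ deriv ψ = η := by
  obtain ⟨a, b, ha, hb, hK⟩ : ∃ a b, 0 < a ∧ b < T ∧ tsupport η ⊆ Icc a b := by
    rcases (tsupport η).eq_empty_or_nonempty with he | hne
    · exact ⟨T / 2, T / 2, by linarith, by linarith, by rw [he]; exact empty_subset _⟩
    · obtain ⟨a, ha⟩ := h.2.1.isCompact.exists_isLeast hne
      obtain ⟨b, hb⟩ := h.2.1.isCompact.exists_isGreatest hne
      exact ⟨a, b, (h.2.2 ha.1).1, (h.2.2 hb.1).2, fun x hx => ⟨ha.2 hx, hb.2 hx⟩⟩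
  have hc := h.1.continuous
  have hη : ∀ s, s ∉ Icc a b → η s = 0 := fun s hs =>
    image_eq_zero_of_notMem_tsupport fun h' => hs (hK h')
  have hI : ∫ s in (0 : ℝ)..T, η s = 0 := by
    rw [intervalIntegral.integral_of_le hT.le, integral_Ioc_eq_integral_Ioo]; exact h0
  set ψ : ℝ → ℝ := fun t => ∫ s in (0 : ℝ)..t, η s with hψ
  have hd : deriv ψ = η := by
    funext t
    exact Continuous.deriv_integral η hc 0 t
  have hz1 : ∀ t, t < a → ψ t = 0 := by
    intro t ht
    refine intervalIntegral.integral_zero_ae (Eventually.of_forall fun s hs => hη s fun h' => ?_)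
    have : s ≤ max 0 t := hs.2
    have := max_lt ha ht
    linarith [h'.1]
  have hz2 : ∀ t, b < t → ψ t = 0 := by
    intro t ht
    have e : ψ t = ∫ s in T..t, η s := by
      have := intervalIntegral.integral_add_adjacent_intervals
        (hc.intervalIntegrable (μ := volume) 0 T) (hc.intervalIntegrable T t)
      rw [hI, zero_add] at this
      exact this.symm
    rw [e]
    refine intervalIntegral.integral_zero_ae (Eventually.of_forall fun s hs => hη s fun h' => ?_)
    have : min T t < s := hs.1
    have := lt_min hb ht
    linarith [h'.2]
  have hsupp : ∀ t, t ∉ Icc a b → ψ t = 0 := by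
    intro t ht
    rw [mem_Icc, not_and_or, not_le, not_le] at ht
    exact ht.elim (hz1 t) (hz2 t)
  refine ⟨ψ, ⟨?_, HasCompactSupport.intro isCompact_Icc hsupp, ?_⟩, hd⟩
  · refine contDiff_infty_iff_deriv.2 ⟨?_, by rw [hd]; exact h.1⟩
    intro t
    exact (intervalIntegral.integral_hasDerivAt_right (hc.intervalIntegrable _ _)
      (hc.stronglyMeasurableAtFilter _ _) hc.continuousAt).differentiableAt
  · have h1 : tsupport ψ ⊆ Icc a b := closure_minimal (fun t ht => by
      by_contra h'; exact ht (hsupp t h')) isClosed_Icc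
    exact fun t ht => ⟨ha.trans_le (h1 ht).1, (h1 ht).2.trans_lt hb⟩

theorem exists_isTest_integral_eq_one (hT : 0 < T) :
    ∃ χ, IsTest T χ ∧ ∫ t, χ t ∂(timeMeasure T) = 1 := by
  let f : ContDiffBump (T / 2) := ⟨T / 8, T / 4, by linarith, by linarith⟩
  have hs : tsupport (f.normed volume) ⊆ Ioo 0 T := by
    rw [f.tsupport_normed_eq]
    intro x hx
    rw [Metric.mem_closedBall, Real.dist_eq, abs_le] at hx
    change -(T / 4) ≤ _ ∧ _ ≤ T / 4 at hx
    exact ⟨by linarith [hx.1], by linarith [hx.2]⟩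
  refine ⟨f.normed volume, ⟨f.contDiff_normed, f.hasCompactSupport_normed, hs⟩, ?_⟩
  rw [setIntegral_eq_integral_of_forall_compl_eq_zero, f.integral_normed]
  intro x hx
  exact image_eq_zero_of_notMem_tsupport fun h' => hx (hs h')

/-- A function with vanishing weak derivative is constant. -/
theorem ae_eq_const_of_hasWeakDeriv_zero (hT : 0 < T) {w : L2Time T} (h : HasWeakDeriv T w 0) :
    ∃ c : ℝ, ∀ᵐ t ∂(timeMeasure T), w t = c := by
  obtain ⟨χ₀, hχ₀, h1⟩ := exists_isTest_integral_eq_one hT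
  set c := ∫ t, w t * χ₀ t ∂(timeMeasure T) with hc
  refine ⟨c, ?_⟩
  have hw : Integrable w (timeMeasure T) := (Lp.memLp w).integrable (by norm_num)
  have hz := ae_eq_zero_of_integral_test (T := T) (f := fun t => w t - c)
    (hw.sub (integrable_const c)) fun χ hχ => by
      have hi : ∀ {χ}, IsTest T χ → Integrable χ (timeMeasure T) := fun hχ =>
        hχ.memLp.integrable (by norm_num)
      set m := ∫ t, χ t ∂(timeMeasure T) with hm
      have hη : IsTest T (fun t => χ t - m * χ₀ t) := by
        refine ⟨hχ.1.sub (contDiff_const.mul hχ₀.1), ?_, ?_⟩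
        · exact hχ.2.1.sub hχ₀.2.1.mul_left
        · refine (tsupport_sub _ _).trans (union_subset hχ.2.2 ?_)
          exact (tsupport_mul_subset_right (f := fun _ => m) (g := χ₀)).trans hχ₀.2.2
      obtain ⟨ψ, hψ, hd⟩ := hη.exists_deriv_eq hT (by
        rw [integral_sub (hi hχ) ((hi hχ₀).const_mul m), integral_const_mul, h1, mul_one, sub_self])
      have h2 := hasWeakDeriv_iff.1 h ψ hψ
      rw [inner_zero_left, neg_zero, ← integral_mul_eq_inner w hψ.derivLp
        hψ.memLp_deriv.coeFn_toLp, hd] at h2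
      have hwi : ∀ {χ}, IsTest T χ → Integrable (fun t => w t * χ t) (timeMeasure T) := fun hχ =>
        integrable_mul_test w hχ.1.continuous hχ.2.1
      simp only [mul_sub, sub_mul] at h2 ⊢
      have e : ∀ t, w t * (m * χ₀ t) = m * (w t * χ₀ t) := fun t => by ring
      simp only [e] at h2
      rw [integral_sub (hwi hχ) ((hwi hχ₀).const_mul m), integral_const_mul] at h2
      rw [integral_sub (hwi hχ) ((hi hχ).const_mul c), integral_const_mul, ← hm]
      linarith
  filter_upwards [hz] with t ht
  linarith

theorem exists_mem_Ioo_of_ae {P : ℝ → Prop} (h : ∀ᵐ t ∂(timeMeasure T), P t) {a b : ℝ}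
    (hab : a < b) (hs : Ioo a b ⊆ Ioo 0 T) : ∃ t ∈ Ioo a b, P t := by
  by_contra! hcon
  have h1 : ∀ᵐ t ∂(volume.restrict (Ioo a b)), False := by
    filter_upwards [ae_restrict_of_ae_restrict_of_subset hs h,
      ae_restrict_mem measurableSet_Ioo] with t h2 h3
    exact hcon t h3 h2
  rw [ae_iff] at h1
  simp only [not_false_eq_true, ofPred_true, Measure.restrict_apply MeasurableSet.univ, univ_inter,
    Real.volume_Ioo, ENNReal.ofReal_eq_zero] at h1
  linarith

/-- If `w` vanishes at `0` then it is the primitive of its weak derivative. -/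
theorem eq_rlOp_one_of_hasWeakDeriv (hT : 0 < T) {w g : L2Time T} (h : HasWeakDeriv T w g)
    (hv : VanishesAt T 0 w) : w = rlOp T one_pos g := by
  have h1 := h.add ((hasWeakDeriv_rlOp_one g).smul (-1))
  have h2 := hv.add ((vanishesAt_rlOp_one hT g).smul (-1))
  rw [neg_one_smul, neg_one_smul, add_neg_cancel] at h1
  rw [neg_one_smul] at h2
  obtain ⟨c, hc⟩ := ae_eq_const_of_hasWeakDeriv_zero hT h1
  obtain ⟨F, hF, hae, hF0⟩ := h2
  have hcl : F 0 = c := by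
    have hF0' : Tendsto F (𝓝[Ioo 0 T] 0) (𝓝 (F 0)) :=
      (hF 0 ⟨le_rfl, hT.le⟩).mono_left (nhdsWithin_mono _ Ioo_subset_Icc_self)
    by_contra hne
    have hev := hF0'.eventually_ne hne
    rw [nhdsWithin_Ioo_eq_nhdsGT hT, eventually_nhdsWithin_iff, Metric.eventually_nhds_iff] at hev
    obtain ⟨ε, hε, hev⟩ := hev
    obtain ⟨t, ht, h3⟩ := exists_mem_Ioo_of_ae (hc.and hae) (a := 0) (b := min ε T)
      (lt_min hε hT) (Ioo_subset_Ioo_right (min_le_right _ _))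
    refine hev (y := t) ?_ ht.1 (by rw [← h3.2, h3.1])
    rw [Real.dist_eq, sub_zero, abs_of_pos ht.1]
    exact ht.2.trans_le (min_le_left _ _)
  rw [hF0] at hcl
  rw [← sub_eq_zero, sub_eq_add_neg]
  refine Lp.ext ?_
  filter_upwards [hc, Lp.coeFn_zero ℝ 2 (timeMeasure T)] with t h3 h4
  rw [h3, h4, ← hcl, Pi.zero_apply]

theorem isTest_reflect {ψ : ℝ → ℝ} (h : IsTest T ψ) : IsTest T (fun t => ψ (T - t)) := by
  have hsup : tsupport (fun t => ψ (T - t)) ⊆ (fun t => T - t) ⁻¹' tsupport ψ :=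
    closure_minimal (fun t ht => subset_tsupport ψ ht)
      ((isClosed_tsupport ψ).preimage (by fun_prop))
  refine ⟨h.1.comp (contDiff_const.sub contDiff_id), ?_, fun t ht => ?_⟩
  · exact h.2.1.comp_homeomorph (Homeomorph.subLeft T)
  · have := h.2.2 (hsup ht)
    exact ⟨by linarith [this.2], by linarith [this.1]⟩

theorem HasWeakDeriv.reflect {v g : L2Time T} (h : HasWeakDeriv T v g) :
    HasWeakDeriv T (reflect T v) (-(FracWave.reflect T g)) := by
  rw [hasWeakDeriv_iff]
  intro ψ hψ
  have h1 := hasWeakDeriv_iff.1 h _ (isTest_reflect hψ)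
  have e1 : FracWave.reflect T hψ.toLp = (isTest_reflect hψ).toLp := by
    refine Lp.ext ?_
    filter_upwards [reflect_ae hψ.toLp, (isTest_reflect hψ).memLp.coeFn_toLp,
      (measurePreserving_reflect T).quasiMeasurePreserving.ae hψ.memLp.coeFn_toLp] with t a b c
    rw [a]; exact c.trans b.symm
  have e2 : FracWave.reflect T hψ.derivLp = -(isTest_reflect hψ).derivLp := by
    refine Lp.ext ?_
    filter_upwards [reflect_ae hψ.derivLp, (isTest_reflect hψ).memLp_deriv.coeFn_toLp,
      (measurePreserving_reflect T).quasiMeasurePreserving.ae hψ.memLp_deriv.coeFn_toLp,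
      Lp.coeFn_neg (isTest_reflect hψ).derivLp] with t a b c d
    rw [a, d, Pi.neg_apply]
    refine c.trans ?_
    have h3 : (isTest_reflect hψ).derivLp t = deriv (fun t => ψ (T - t)) t := b
    rw [h3, deriv_comp_const_sub, neg_neg]
  have i : ∀ a b : L2Time T, inner ℝ (FracWave.reflect T a) b =
      inner ℝ a (FracWave.reflect T b) := fun a b => by
    rw [← (FracWave.reflect T).inner_map_map a, reflect_reflect]
  rw [inner_neg_left, i, i, e1, e2, inner_neg_right, h1]

theorem VanishesAt.reflect {v : L2Time T} (h : VanishesAt T T v) :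
    VanishesAt T 0 (reflect T v) := by
  obtain ⟨F, hF, hae, h0⟩ := h
  refine ⟨fun t => F (T - t), hF.comp (by fun_prop) fun t ht => ?_, ?_, by simpa using h0⟩
  · exact ⟨by linarith [ht.2], by linarith [ht.1]⟩
  · filter_upwards [reflect_ae v,
      (measurePreserving_reflect T).quasiMeasurePreserving.ae hae] with t h1 h2
    rw [h1, h2]

theorem eq_rlOpR_one_of_hasWeakDeriv (hT : 0 < T) {w g : L2Time T} (h : HasWeakDeriv T w g)
    (hv : VanishesAt T T w) : w = rlOpR T one_pos (-g) := by
  have h1 := eq_rlOp_one_of_hasWeakDeriv hT h.reflect hv.reflect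
  rw [rlOpR_apply, map_neg, ← h1, reflect_reflect]

end FracWave

namespace FracWave

/-! ### Fractional Sobolev norms on the interval -/

variable {T c σ γ : ℝ} {V : L2Time T →L[ℝ] L2Time T}

/-- `V` inverts `σ d/dt` on the functions that vanish at the endpoint `c`; here `σ = 1` for the
integral from the left and `σ = -1` for the integral from the right. -/
structure IsVolterra (T c σ : ℝ) (V : L2Time T →L[ℝ] L2Time T) : Prop where
  enorm_sign : ‖σ‖ₑ = 1
  hasWeakDeriv : ∀ x, HasWeakDeriv T (V x) (σ • x)
  vanishesAt : ∀ x, VanishesAt T c (V x)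
  eq_apply : ∀ w g, HasWeakDeriv T w g → VanishesAt T c w → w = V (σ • g)

theorem isVolterra_rlOp (hT : 0 < T) : IsVolterra T 0 1 (rlOp T one_pos) where
  enorm_sign := by simp
  hasWeakDeriv x := by rw [one_smul]; exact hasWeakDeriv_rlOp_one x
  vanishesAt := vanishesAt_rlOp_one hT
  eq_apply w g h hv := by rw [one_smul]; exact eq_rlOp_one_of_hasWeakDeriv hT h hv

theorem isVolterra_rlOpR (hT : 0 < T) : IsVolterra T T (-1) (rlOpR T one_pos) where
  enorm_sign := by simp
  hasWeakDeriv x := by rw [neg_one_smul]; exact hasWeakDeriv_rlOpR_one x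
  vanishesAt := vanishesAt_rlOpR_one hT
  eq_apply w g h hv := by rw [neg_one_smul]; exact eq_rlOpR_one_of_hasWeakDeriv hT h hv

theorem sob_le {m : ℕ} {v : L2Time T} {D : ℕ → L2Time T} (h : IsDerivChain T c m v D) :
    sob T c m v ≤ ‖D m‖ₑ :=
  iInf_le (fun D : {D : ℕ → L2Time T // IsDerivChain T c m v D} => ‖D.1 m‖ₑ) ⟨D, h⟩

theorem sob_zero (v : L2Time T) : sob T c 0 v = ‖v‖ₑ := by
  refine le_antisymm (sob_le (D := fun _ => v) ⟨rfl, fun k hk => absurd hk (by simp)⟩) ?_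
  exact le_iInf fun D => by rw [D.2.1]

theorem IsVolterra.sob_one_le (hV : IsVolterra T c σ V) (x : L2Time T) :
    sob T c 1 (V x) ≤ ‖x‖ₑ := by
  refine (sob_le (D := fun k => if k = 0 then V x else σ • x) ⟨rfl, fun k hk => ?_⟩).trans ?_
  · obtain rfl : k = 0 := by omega
    exact ⟨hV.hasWeakDeriv x, hV.vanishesAt x⟩
  · simp only [one_ne_zero, if_false, enorm_smul, hV.enorm_sign, one_mul, le_refl]

theorem IsVolterra.sob_two_le (hV : IsVolterra T c σ V) (x : L2Time T) :
    sob T c 2 (V (V x)) ≤ ‖x‖ₑ := by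
  refine (sob_le (D := fun k => if k = 0 then V (V x) else if k = 1 then σ • V x
    else σ • σ • x) ⟨rfl, fun k hk => ?_⟩).trans ?_
  · obtain rfl | rfl : k = 0 ∨ k = 1 := by omega
    · exact ⟨hV.hasWeakDeriv _, hV.vanishesAt _⟩
    · exact ⟨(hV.hasWeakDeriv x).smul σ, (hV.vanishesAt x).smul σ⟩
  · simp [enorm_smul, hV.enorm_sign]

/-- The `K`-functional of the couple `(L², H¹)` with a vanishing condition, in terms of `V`. -/
theorem IsVolterra.kFun_sob_zero_one (hV : IsVolterra T c σ V) {t : ℝ} (ht : 0 < t)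
    (w : L2Time T) : (sob T c 0).kFun (sob T c 1) t w = kOp V w t := by
  refine le_antisymm (le_iInf fun x => (iInf_le _ (w - V x)).trans ?_) (le_iInf fun w₀ => ?_)
  · rw [sob_zero, sub_sub_cancel]
    gcongr
    exact hV.sob_one_le x
  · have h : ∀ D : {D : ℕ → L2Time T // IsDerivChain T c 1 (w - w₀) D},
        ∃ x, w₀ = w - V x ∧ ‖x‖ₑ = ‖D.1 1‖ₑ := by
      rintro ⟨D, h0, h1⟩
      refine ⟨σ • D 1, ?_, by rw [enorm_smul, hV.enorm_sign, one_mul]⟩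
      rw [← hV.eq_apply (w - w₀) (D 1) (h0 ▸ (h1 0 one_pos).1) (h0 ▸ (h1 0 one_pos).2),
        sub_sub_cancel]
    rw [sob_zero]
    change _ ≤ ‖w₀‖ₑ + ENNReal.ofReal t * ⨅ D : {D : ℕ → L2Time T // _}, ‖D.1 1‖ₑ
    rw [ENNReal.mul_iInf' (fun h => absurd h ENNReal.ofReal_ne_top)
      (fun h => absurd h (by simpa using ht)), ENNReal.add_iInf]
    refine le_iInf fun D => ?_
    obtain ⟨x, hx, hn⟩ := h D
    rw [← hn]
    rw [hx]
    exact iInf_le (fun x => ‖w - V x‖ₑ + ENNReal.ofReal t * ‖x‖ₑ) x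

theorem IsVolterra.kFun_sob_one_two_le (hV : IsVolterra T c σ V) (t : ℝ) (v : L2Time T) :
    (sob T c 1).kFun (sob T c 2) t (V v) ≤ kOp V v t := by
  refine le_iInf fun x => (iInf_le _ (V (v - V x))).trans ?_
  rw [← map_sub, sub_sub_cancel]
  gcongr
  · exact hV.sob_one_le _
  · exact hV.sob_two_le _

theorem IsVolterra.sobNonneg_eq (hV : IsVolterra T c σ V) (hγ : 0 < γ) (hγ1 : γ < 1)
    (w : L2Time T) : sobNonneg T c γ w = kInt γ (kOp V w) := by
  have h0 : ⌊γ⌋₊ = 0 := Nat.floor_eq_zero.2 hγ1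
  rw [sobNonneg, h0, if_neg (by simpa using hγ.ne')]
  have h1 : kInt γ (kOp V w) = kInt γ fun t => (sob T c 0).kFun (sob T c 1) t w :=
    le_antisymm (kInt_mono fun t ht => (hV.kFun_sob_zero_one ht w).ge)
      (kInt_mono fun t ht => (hV.kFun_sob_zero_one ht w).le)
  rw [h1, Nat.cast_zero, sub_zero]
  rfl

theorem IsVolterra.sobNonneg_one_le (hV : IsVolterra T c σ V) (x : L2Time T) :
    sobNonneg T c 1 (V x) ≤ ‖x‖ₑ := by
  rw [sobNonneg, Nat.floor_one, if_pos (by simp)]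
  exact hV.sob_one_le x

theorem IsVolterra.sobNonneg_add_one_le (hV : IsVolterra T c σ V) (hγ : 0 < γ) (hγ1 : γ < 1)
    (v : L2Time T) : sobNonneg T c (γ + 1) (V v) ≤ kInt γ (kOp V v) := by
  have h0 : ⌊γ + 1⌋₊ = 1 := by
    rw [Nat.floor_add_one hγ.le, Nat.floor_eq_zero.2 hγ1]
  rw [sobNonneg, h0, if_neg (by simpa using hγ.ne'), Nat.cast_one, add_sub_cancel_right]
  exact kInt_mono fun t _ => hV.kFun_sob_one_two_le t v

/-- Bound for the norm of order `γ` of a Riemann-Liouville integral of order `γ`. -/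
noncomputable def upConst (γ : ℝ) : ℝ := 3 * √(squareConst γ (rlConst γ)) + 1

/-- Bound for the density of which a function is the Riemann-Liouville integral of order `γ`, in
terms of its norm of order `γ`. -/
noncomputable def loConst (γ : ℝ) : ℝ := 3 * √(squareConst (1 - γ) (rlConst (1 - γ))) + 1

theorem upConst_pos (γ : ℝ) : 0 < upConst γ := by unfold upConst; positivity

theorem loConst_pos (γ : ℝ) : 0 < loConst γ := by unfold loConst; positivity

theorem kInt_rlOp_le (hγ : 0 < γ) (hγ1 : γ < 1) (g : L2Time T) :
    kInt γ (kOp (rlOp T one_pos) (rlOp T hγ g)) ≤ ENNReal.ofReal (upConst γ) * ‖g‖ₑ := by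
  refine ((accretive_rlOp_one T).kInt_kOp_le denseRange_rlOp_one (commute_rlOp hγ one_pos)
    (rlConst_nonneg hγ) (momentBound_rlOp T hγ hγ1) hγ hγ1 g).trans ?_
  gcongr
  unfold upConst; linarith

theorem kInt_rlOpR_le (hγ : 0 < γ) (hγ1 : γ < 1) (g : L2Time T) :
    kInt γ (kOp (rlOpR T one_pos) (rlOpR T hγ g)) ≤ ENNReal.ofReal (upConst γ) * ‖g‖ₑ := by
  refine ((accretive_rlOpR_one T).kInt_kOp_le denseRange_rlOpR_one (commute_rlOpR hγ one_pos)
    (rlConst_nonneg hγ) (momentBound_rlOpR T hγ hγ1) hγ hγ1 g).trans ?_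
  gcongr
  unfold upConst; linarith

theorem leftH_eq (hT : 0 < T) (hγ : 0 < γ) (hγ1 : γ < 1) (v : L2Time T) :
    leftH T γ v = kInt γ (kOp (rlOp T one_pos) v) := by
  rw [leftH, if_pos hγ.le, (isVolterra_rlOp hT).sobNonneg_eq hγ hγ1]

theorem rightH_eq (hT : 0 < T) (hγ : 0 < γ) (hγ1 : γ < 1) (v : L2Time T) :
    rightH T γ v = kInt γ (kOp (rlOpR T one_pos) v) := by
  rw [rightH, if_pos hγ.le, (isVolterra_rlOpR hT).sobNonneg_eq hγ hγ1]

theorem leftH_rlOp_le (hT : 0 < T) (hγ : 0 < γ) (hγ1 : γ < 1) (g : L2Time T) :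
    leftH T γ (rlOp T hγ g) ≤ ENNReal.ofReal (upConst γ) * ‖g‖ₑ := by
  rw [leftH_eq hT hγ hγ1]
  exact kInt_rlOp_le hγ hγ1 g

theorem rightH_rlOpR_le (hT : 0 < T) (hγ : 0 < γ) (hγ1 : γ < 1) (g : L2Time T) :
    rightH T γ (rlOpR T hγ g) ≤ ENNReal.ofReal (upConst γ) * ‖g‖ₑ := by
  rw [rightH_eq hT hγ hγ1]
  exact kInt_rlOpR_le hγ hγ1 g

/-- Bound for the norm of order `μ ∈ (0, 2)` of a Riemann-Liouville integral of order `μ`. -/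
noncomputable def upConst₂ (μ : ℝ) : ℝ := upConst μ + upConst (μ - 1) + 1

theorem upConst₂_pos (μ : ℝ) : 0 < upConst₂ μ := by
  have := upConst_pos μ
  have := upConst_pos (μ - 1)
  unfold upConst₂; linarith

theorem rightH_rlOpR_le_of_lt_two (hT : 0 < T) {μ : ℝ} (hμ : 0 < μ) (hμ2 : μ < 2)
    (g : L2Time T) :
    rightH T μ (rlOpR T hμ g) ≤ ENNReal.ofReal (upConst₂ μ) * ‖g‖ₑ := by
  have p1 := upConst_pos μ
  have p2 := upConst_pos (μ - 1)
  rcases lt_trichotomy μ 1 with h | rfl | h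
  · refine (rightH_rlOpR_le hT hμ h g).trans ?_
    gcongr
    unfold upConst₂; linarith
  · rw [rightH, if_pos hμ.le]
    refine ((isVolterra_rlOpR hT).sobNonneg_one_le g).trans ?_
    refine le_mul_of_one_le_left zero_le ?_
    rw [ENNReal.one_le_ofReal]
    unfold upConst₂; linarith
  · have h1 : 0 < μ - 1 := by linarith
    have e : rlOpR T hμ g = rlOpR T one_pos (rlOpR T h1 g) := by
      rw [rlOpR_rlOpR]
      exact rlOpR_congr _ _ (by ring) g
    rw [rightH, if_pos hμ.le, e]
    have h2 := (isVolterra_rlOpR hT).sobNonneg_add_one_le h1 (by linarith) (rlOpR T h1 g)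
    rw [sub_add_cancel] at h2
    refine h2.trans ((kInt_rlOpR_le h1 (by linarith) g).trans ?_)
    gcongr
    unfold upConst₂; linarith

theorem exists_rlOp_eq_of_leftH (hT : 0 < T) (hγ : 0 < γ) (hγ1 : γ < 1) {v : L2Time T}
    (hv : leftH T γ v < ∞) :
    ∃ g, rlOp T hγ g = v ∧ ‖g‖ₑ ≤ ENNReal.ofReal (loConst γ) * leftH T γ v := by
  rw [leftH_eq hT hγ hγ1] at hv ⊢
  have h1 : 0 < 1 - γ := by linarith
  have hA := adjoint_rlOp T one_pos
  have hJJ : (rlOpR T h1 : L2Time T →L[ℝ] L2Time T) *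
      (rlOp T hγ : L2Time T →L[ℝ] L2Time T).adjoint =
      ((rlOp T one_pos : L2Time T →L[ℝ] L2Time T)).adjoint := by
    rw [hA, adjoint_rlOp]
    ext1 x
    change rlOpR T h1 (rlOpR T hγ x) = rlOpR T one_pos x
    rw [rlOpR_rlOpR]
    exact rlOpR_congr _ _ (by ring) x
  have hacc := accretive_rlOpR_one T
  have hden := denseRange_rlOpR_one (T := T)
  have hcom := commute_rlOpR (T := T) h1 one_pos
  have hmom := momentBound_rlOpR T h1 (by linarith)
  rw [← hA] at hacc hden hcom hmom
  obtain ⟨g, hg, hn⟩ := exists_apply_eq_of_kInt hacc hden hcom (rlConst_nonneg h1) hmom hγ hγ1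
    hJJ hv
  refine ⟨g, hg, hn.trans ?_⟩
  gcongr
  unfold loConst; linarith

theorem exists_rlOpR_eq_of_rightH (hT : 0 < T) (hγ : 0 < γ) (hγ1 : γ < 1) {v : L2Time T}
    (hv : rightH T γ v < ∞) :
    ∃ g, rlOpR T hγ g = v ∧ ‖g‖ₑ ≤ ENNReal.ofReal (loConst γ) * rightH T γ v := by
  rw [rightH_eq hT hγ hγ1] at hv ⊢
  have h1 : 0 < 1 - γ := by linarith
  have hA := adjoint_rlOpR T one_pos
  have hJJ : (rlOp T h1 : L2Time T →L[ℝ] L2Time T) *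
      (rlOpR T hγ : L2Time T →L[ℝ] L2Time T).adjoint =
      ((rlOpR T one_pos : L2Time T →L[ℝ] L2Time T)).adjoint := by
    rw [hA, adjoint_rlOpR]
    ext1 x
    change rlOp T h1 (rlOp T hγ x) = rlOp T one_pos x
    rw [rlOp_rlOp]
    exact rlOp_congr _ _ (by ring) x
  have hacc := accretive_rlOp_one T
  have hden := denseRange_rlOp_one (T := T)
  have hcom := commute_rlOp (T := T) h1 one_pos
  have hmom := momentBound_rlOp T h1 (by linarith)
  rw [← hA] at hacc hden hcom hmom
  obtain ⟨g, hg, hn⟩ := exists_apply_eq_of_kInt hacc hden hcom (rlConst_nonneg h1) hmom hγ hγ1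
    hJJ hv
  refine ⟨g, hg, hn.trans ?_⟩
  gcongr
  unfold loConst; linarith

/-- The norm of `₀H^{-γ}` is bounded by the `L²` norm of the Riemann-Liouville integral. -/
theorem leftH_neg_le (hT : 0 < T) (hγ : 0 < γ) (hγ1 : γ < 1) (v : L2Time T) :
    leftH T (-γ) v ≤ ENNReal.ofReal (loConst γ) * ‖rlOp T hγ v‖ₑ := by
  rw [leftH, if_neg (by linarith), neg_neg]
  refine iSup₂_le fun z hz => ?_
  have hz' : rightH T γ z ≤ 1 := by rwa [rightH, if_pos hγ.le]
  obtain ⟨g, rfl, hg⟩ := exists_rlOpR_eq_of_rightH hT hγ hγ1 (hz'.trans_lt ENNReal.one_lt_top)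
  rw [← inner_L2Time, ← inner_rlOp_left]
  calc ‖inner ℝ (rlOp T hγ v) g‖ₑ ≤ ‖rlOp T hγ v‖ₑ * ‖g‖ₑ := by
        rw [← ofReal_norm, ← ofReal_norm, ← ofReal_norm,
          ← ENNReal.ofReal_mul (norm_nonneg _)]
        exact ENNReal.ofReal_le_ofReal (norm_inner_le_norm _ _)
    _ ≤ ‖rlOp T hγ v‖ₑ * (ENNReal.ofReal (loConst γ) * 1) := by
        gcongr
        exact hg.trans (by gcongr)
    _ = _ := by rw [mul_one, mul_comm]

theorem enorm_rlOp_le_leftH_neg (hT : 0 < T) (hγ : 0 < γ) (hγ1 : γ < 1) (v : L2Time T) :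
    ‖rlOp T hγ v‖ₑ ≤ ENNReal.ofReal (upConst γ) * leftH T (-γ) v := by
  rw [leftH, if_neg (by linarith), neg_neg]
  set q := rlOp T hγ v with hq
  have hu := upConst_pos γ
  rcases eq_or_ne q 0 with h0 | h0
  · rw [h0]; simp
  have hqp : 0 < ‖q‖ := norm_pos_iff.2 h0
  -- test against the multiple of `rlOpR T hγ q` whose norm is controlled by one
  set a : ℝ := (upConst γ * ‖q‖)⁻¹ with ha
  have hap : 0 < a := by positivity
  have hz : sobNonneg T T γ (rlOpR T hγ (a • q)) ≤ 1 := by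
    have h := rightH_rlOpR_le hT hγ hγ1 (a • q)
    rw [rightH, if_pos hγ.le] at h
    refine h.trans ?_
    rw [← ofReal_norm, ← ENNReal.ofReal_mul hu.le, norm_smul, Real.norm_of_nonneg hap.le,
      ENNReal.ofReal_le_one, ha]
    apply le_of_eq; field_simp
  have h := le_iSup₂ (f := fun (z : L2Time T) (_ : sobNonneg T T γ z ≤ 1) =>
    ‖∫ t, v t * z t ∂(timeMeasure T)‖ₑ) _ hz
  have h2 : ‖q‖ₑ = ENNReal.ofReal (upConst γ) *
      ‖∫ t, v t * (rlOpR T hγ (a • q)) t ∂(timeMeasure T)‖ₑ := by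
    rw [← inner_L2Time, ← inner_rlOp_left, ← hq, inner_smul_right, real_inner_self_eq_norm_sq,
      ← ofReal_norm, ← ofReal_norm, ← ENNReal.ofReal_mul hu.le,
      Real.norm_of_nonneg (by positivity), ha]
    congr 1; field_simp
  rw [h2]
  gcongr
  exact h

/-- A test function is a Riemann-Liouville integral of order `γ`. -/
theorem rlOpR_rlOpR_derivLp (hγ : 0 < γ) (hγ1 : 0 < 1 - γ) {ψ : ℝ → ℝ} (h : IsTest T ψ) :
    rlOpR T hγ (-rlOpR T hγ1 h.derivLp) = h.toLp := by
  rw [map_neg, rlOpR_rlOpR, rlOpR_congr _ one_pos (by ring), rlOpR_one_derivLp, neg_neg]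

theorem abs_rlOp_one_le (x : L2Time T) :
    ∀ᵐ t ∂(timeMeasure T), |rlOp T one_pos x t| ≤ √t * ‖x‖ := by
  filter_upwards [rlOp_ae one_pos x, ae_restrict_mem measurableSet_Ioo] with t h1 ht
  rw [h1, intLeft_eq_conv, conv]
  simp only [rlKer_one, one_smul]
  have hle : volume.restrict (Ioo 0 t) ≤ timeMeasure T :=
    Measure.restrict_mono (Ioo_subset_Ioo_right ht.2.le) le_rfl
  have h2 : ‖∫ s in Ioo 0 t, x s‖ₑ ≤ ‖x‖ₑ * ENNReal.ofReal t ^ (1 / 2 : ℝ) := by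
    refine (enorm_integral_le_lintegral_enorm _).trans ?_
    rw [← eLpNorm_one_eq_lintegral_enorm]
    refine (eLpNorm_le_eLpNorm_mul_rpow_measure_univ (q := 2) (by norm_num)
      ((Lp.aestronglyMeasurable x).mono_measure hle)).trans ?_
    rw [Measure.restrict_apply_univ, Real.volume_Ioo, sub_zero, Lp.enorm_def]
    exact mul_le_mul' (eLpNorm_mono_measure (x : ℝ → ℝ) hle) (le_of_eq (by norm_num))
  have ht0 := ht.1.le
  rw [ENNReal.ofReal_rpow_of_nonneg ht.1.le (by norm_num), ← ofReal_norm, ← ofReal_norm,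
    ← ENNReal.ofReal_mul (norm_nonneg _), ENNReal.ofReal_le_ofReal_iff (by positivity),
    ← Real.sqrt_eq_rpow, mul_comm] at h2
  exact h2

/-- The fractional derivatives `D_{T-}^γ ψ` of test functions are dense in `L²(0, T)`
for `γ < 1/2`: this is what makes a functional on `⁰H^γ` determined by its values on test
functions. A function `h` orthogonal to them has `D_{0+}^{-1} h` equal to a multiple of `t^γ`, which
is larger near `0` than the bound `t^{1/2} ‖h‖` for the primitive of `h`. -/
theorem eq_zero_of_inner_rlOpR_derivLp (hT : 0 < T) (hγ : 0 < γ) (hγ2 : γ < 1 / 2)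
    (hγ1 : 0 < 1 - γ) {h : L2Time T}
    (hh : ∀ (ψ : ℝ → ℝ) (hψ : IsTest T ψ), inner ℝ h (rlOpR T hγ1 hψ.derivLp) = 0) : h = 0 := by
  have h1 : HasWeakDeriv T (rlOp T hγ1 h) 0 := by
    rw [hasWeakDeriv_iff]
    intro ψ hψ
    rw [inner_rlOp_left, hh ψ hψ, inner_zero_left, neg_zero]
  obtain ⟨c, hc⟩ := ae_eq_const_of_hasWeakDeriv_zero hT h1
  have h2 : ∀ᵐ t ∂(timeMeasure T), rlOp T one_pos h t = c * (t ^ γ / Real.Gamma (γ + 1)) := by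
    have e : rlOp T one_pos h = rlOp T hγ (rlOp T hγ1 h) := by
      rw [rlOp_rlOp]; exact rlOp_congr _ _ (by ring) h
    rw [e]
    filter_upwards [rlOp_ae hγ (rlOp T hγ1 h), ae_restrict_mem measurableSet_Ioo] with t ht htm
    rw [ht, intLeft_eq_conv, conv_congr hc htm.2.le, conv]
    simp only [smul_eq_mul]
    rw [integral_mul_const, mul_comm, ← integral_rlKer hγ htm.1.le,
      ← integral_Ioc_eq_integral_Ioo, ← integral_Ioc_eq_integral_Ioo,
      ← intervalIntegral.integral_of_le htm.1.le, ← intervalIntegral.integral_of_le htm.1.le,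
      intervalIntegral.integral_comp_sub_left (fun r => rlKer γ r) t, sub_self, sub_zero]
  have hc0 : c = 0 := by
    by_contra hne
    have hG := Real.Gamma_pos_of_pos (show 0 < γ + 1 by linarith)
    have hpos : 0 < |c| / Real.Gamma (γ + 1) := div_pos (abs_pos.2 hne) hG
    have hlim : Tendsto (fun t : ℝ => t ^ (1 / 2 - γ) * ‖h‖) (𝓝 0) (𝓝 0) := by
      have := ((Real.continuousAt_rpow_const 0 (1 / 2 - γ)
        (Or.inr (by linarith))).tendsto).mul_const ‖h‖
      rwa [Real.zero_rpow (by linarith), zero_mul] at this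
    obtain ⟨ε, hε, hev⟩ := Metric.eventually_nhds_iff.1 (hlim.eventually_lt_const hpos)
    obtain ⟨t, ht, h3, h4⟩ := exists_mem_Ioo_of_ae (h2.and (abs_rlOp_one_le h)) (a := 0)
      (b := min ε T) (lt_min hε hT) (Ioo_subset_Ioo_right (min_le_right _ _))
    have h5 := hev (y := t) (by
      rw [Real.dist_eq, sub_zero, abs_of_pos ht.1]
      exact ht.2.trans_le (min_le_left _ _))
    have htg : 0 < t ^ γ := Real.rpow_pos_of_pos ht.1 _
    have h6 : √t = t ^ (1 / 2 - γ) * t ^ γ := by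
      rw [← Real.rpow_add ht.1, Real.sqrt_eq_rpow]; congr 1; ring
    rw [h3, abs_mul, abs_of_pos (div_pos htg hG), h6] at h4
    have h7 := mul_lt_mul_of_pos_right h5 htg
    have h8 : |c| / Real.Gamma (γ + 1) * t ^ γ = |c| * (t ^ γ / Real.Gamma (γ + 1)) := by ring
    rw [h8] at h7
    linarith [mul_right_comm (t ^ (1 / 2 - γ)) (t ^ γ) ‖h‖]
  apply injective_rlOp_one
  rw [map_zero]
  refine Lp.ext ?_
  filter_upwards [h2, Lp.coeFn_zero ℝ 2 (timeMeasure T)] with t h3 h4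
  rw [h3, hc0, zero_mul, h4, Pi.zero_apply]

end FracWave

namespace FracWave

/-! ### The weak gradient and the Dirichlet eigenfunctions -/

variable {d : ℕ} {Ω : Set (Sp d)}

theorem differentiable_of_contDiff {ψ : Sp d → ℝ}
    (h : ContDiff ℝ ((⊤ : ℕ∞) : WithTop ℕ∞) ψ) : Differentiable ℝ ψ :=
  h.differentiable (by norm_num)

/-- The graph of the gradient on `C_c^∞(Ω)`, as a subspace. -/
def testGraph (Ω : Set (Sp d)) : Submodule ℝ (L2 Ω × L2Vec Ω) where
  carrier := {p | ∃ ψ : Sp d → ℝ, ContDiff ℝ ((⊤ : ℕ∞) : WithTop ℕ∞) ψ ∧ HasCompactSupport ψ ∧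
    tsupport ψ ⊆ Ω ∧ (∀ᵐ x ∂(volume.restrict Ω), p.1 x = ψ x) ∧
    (∀ᵐ x ∂(volume.restrict Ω), p.2 x = gradient ψ x)}
  add_mem' := by
    rintro p q ⟨ψ, h1, h2, h3, h4, h5⟩ ⟨χ, k1, k2, k3, k4, k5⟩
    refine ⟨ψ + χ, h1.add k1, h2.add k2, (tsupport_add ψ χ).trans (union_subset h3 k3), ?_, ?_⟩
    · filter_upwards [h4, k4, Lp.coeFn_add p.1 q.1] with x e1 e2 e3
      rw [Prod.fst_add, e3, Pi.add_apply, Pi.add_apply, e1, e2]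
    · filter_upwards [h5, k5, Lp.coeFn_add p.2 q.2] with x e1 e2 e3
      rw [Prod.snd_add, e3, Pi.add_apply, e1, e2, gradient, gradient, gradient, fderiv_add
        (differentiable_of_contDiff h1 x) (differentiable_of_contDiff k1 x), map_add]
  zero_mem' := by
    refine ⟨0, contDiff_const, HasCompactSupport.zero, by simp, ?_, ?_⟩
    · filter_upwards [Lp.coeFn_zero ℝ 2 (volume.restrict Ω)] with x e
      rw [Prod.fst_zero, e]
    · filter_upwards [Lp.coeFn_zero (Sp d) 2 (volume.restrict Ω)] with x e
      rw [Prod.snd_zero, e, gradient, fderiv_zero, Pi.zero_apply, Pi.zero_apply, map_zero]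
  smul_mem' := by
    rintro c p ⟨ψ, h1, h2, h3, h4, h5⟩
    refine ⟨c • ψ, h1.const_smul c, h2.smul_left (f := fun _ => c),
      (tsupport_smul_subset_right (fun _ => c) ψ).trans h3, ?_, ?_⟩
    · filter_upwards [h4, Lp.coeFn_smul c p.1] with x e1 e3
      rw [Prod.smul_fst, e3, Pi.smul_apply, Pi.smul_apply, e1]
    · filter_upwards [h5, Lp.coeFn_smul c p.2] with x e1 e3
      rw [Prod.smul_snd, e3, Pi.smul_apply, e1, gradient, gradient, fderiv_const_smul
        (differentiable_of_contDiff h1 x), map_smul]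

theorem coe_topologicalClosure_testGraph (Ω : Set (Sp d)) :
    ((testGraph Ω).topologicalClosure : Set (L2 Ω × L2Vec Ω)) = gradGraph Ω :=
  Submodule.topologicalClosure_coe _

theorem mem_gradGraph {p : L2 Ω × L2Vec Ω} :
    p ∈ gradGraph Ω ↔ p ∈ (testGraph Ω).topologicalClosure := by
  rw [← coe_topologicalClosure_testGraph]; rfl

/-- Integration by parts against `C_c^∞(Ω)` for elements of `H₀¹(Ω)`. -/
theorem inner_eq_neg_of_mem_gradGraph {χ : Sp d → ℝ}
    (hχ : ContDiff ℝ ((⊤ : ℕ∞) : WithTop ℕ∞) χ) (hc : HasCompactSupport χ) (hs : tsupport χ ⊆ Ω)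
    (e : Sp d) {X : L2Vec Ω} (hX : ∀ᵐ x ∂(volume.restrict Ω), X x = χ x • e) {Y : L2 Ω}
    (hY : ∀ᵐ x ∂(volume.restrict Ω), Y x = fderiv ℝ χ x e) {p : L2 Ω × L2Vec Ω}
    (hp : p ∈ gradGraph Ω) : inner ℝ p.2 X = -inner ℝ p.1 Y := by
  refine closure_minimal (t := {p : L2 Ω × L2Vec Ω | inner ℝ p.2 X = -inner ℝ p.1 Y}) ?_
    (isClosed_eq (by fun_prop) (by fun_prop)) hp
  rintro p ⟨ψ, h1, h2, h3, h4, h5⟩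
  have hoff : ∀ x, x ∉ Ω → χ x = 0 := fun x hx =>
    image_eq_zero_of_notMem_tsupport fun h => hx (hs h)
  have hoff' : ∀ x, x ∉ Ω → ψ x = 0 := fun x hx =>
    image_eq_zero_of_notMem_tsupport fun h => hx (h3 h)
  have cχ' : Continuous fun x => fderiv ℝ χ x e :=
    (hχ.continuous_fderiv (by norm_num)).clm_apply continuous_const
  have cψ' : Continuous fun x => fderiv ℝ ψ x e :=
    (h1.continuous_fderiv (by norm_num)).clm_apply continuous_const
  have e1 : inner ℝ p.2 X = ∫ x, fderiv ℝ ψ x e * χ x := by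
    rw [L2.inner_def, ← setIntegral_eq_integral_of_forall_compl_eq_zero
      (s := Ω) (f := fun x => fderiv ℝ ψ x e * χ x) fun x hx => by rw [hoff x hx, mul_zero]]
    refine integral_congr_ae ?_
    filter_upwards [h5, hX] with x a b
    rw [a, b, inner_smul_right, inner_gradient_left, mul_comm]
  have e2 : inner ℝ p.1 Y = ∫ x, ψ x * fderiv ℝ χ x e := by
    rw [L2.inner_def, ← setIntegral_eq_integral_of_forall_compl_eq_zero
      (s := Ω) (f := fun x => ψ x * fderiv ℝ χ x e) fun x hx => by rw [hoff' x hx, zero_mul]]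
    refine integral_congr_ae ?_
    filter_upwards [h4, hY] with x a b
    rw [a, b, RCLike.inner_apply, conj_trivial, mul_comm]
  rw [Set.mem_ofPred_eq, e1, e2, integral_mul_fderiv_eq_neg_fderiv_mul_of_integrable, neg_neg]
  · exact (cψ'.mul hχ.continuous).integrable_of_hasCompactSupport hc.mul_left
  · exact (h1.continuous.mul cχ').integrable_of_hasCompactSupport h2.mul_right
  · exact (h1.continuous.mul hχ.continuous).integrable_of_hasCompactSupport hc.mul_left
  · exact fun x _ => differentiable_of_contDiff h1 x
  · exact fun x _ => differentiable_of_contDiff hχ x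

/-- The gradient is closable: it is determined by the function. -/
theorem eq_zero_of_zero_mem_gradGraph (hΩ : IsOpen Ω) {R : L2Vec Ω}
    (h : ((0 : L2 Ω), R) ∈ gradGraph Ω) : R = 0 := by
  refine Lp.ext ?_
  have h1 : ∀ᵐ x ∂(volume.restrict Ω), x ∈ Ω → R x = 0 := by
    refine hΩ.ae_eq_zero_of_integral_contDiff_smul_eq_zero
      (((Lp.memLp R).locallyIntegrable (by norm_num)).locallyIntegrableOn _)
      fun χ hχ hc hs => ?_
    have hint : Integrable (fun x => χ x • R x) (volume.restrict Ω) :=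
      memLp_one_iff_integrable.1 ((Lp.memLp R).smul (p := 2) (q := 2) (r := 1)
        (hχ.continuous.memLp_of_hasCompactSupport hc))
    refine ext_inner_left ℝ fun e => ?_
    rw [inner_zero_right, ← integral_inner hint]
    have cχ' : Continuous fun x => fderiv ℝ χ x e :=
      (hχ.continuous_fderiv (by norm_num)).clm_apply continuous_const
    have mX : MemLp (fun x => χ x • e) 2 (volume.restrict Ω) :=
      (hχ.continuous.smul continuous_const).memLp_of_hasCompactSupport hc.smul_right
    have mY : MemLp (fun x => fderiv ℝ χ x e) 2 (volume.restrict Ω) :=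
      cχ'.memLp_of_hasCompactSupport (hc.fderiv_apply (𝕜 := ℝ) e)
    have h2 := inner_eq_neg_of_mem_gradGraph hχ hc hs e mX.coeFn_toLp mY.coeFn_toLp h
    rw [inner_zero_left, neg_zero, L2.inner_def] at h2
    rw [← h2]
    refine integral_congr_ae ?_
    filter_upwards [mX.coeFn_toLp] with x hx
    rw [hx, inner_smul_right, inner_smul_right, real_inner_comm]
  filter_upwards [h1, ae_restrict_mem hΩ.measurableSet, Lp.coeFn_zero (Sp d) 2 (volume.restrict Ω)]
    with x a b c
  rw [a b, c, Pi.zero_apply]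

variable {φ : HilbertBasis ℕ ℝ (L2 Ω)} {ev : ℕ → ℝ}

/-- The gradient as the spectral square root of `-Δ` followed by an isometry: `U ∈ H₀¹(Ω)` with
`∇U = P` if and only if `P = Φ q` where `q = ∑ₙ λₙ^{1/2} ⟨φₙ, U⟩ φₙ`. -/
theorem exists_gradient_isometry (hΩ : IsOpen Ω) (hφ : IsDirichletEigenbasis Ω φ ev) :
    ∃ Φ : L2 Ω →ₗᵢ[ℝ] L2Vec Ω, ∀ U P, (U, P) ∈ gradGraph Ω ↔
      ∃ q, P = Φ q ∧ ∀ n, inner ℝ (φ n) q = √(ev n) * inner ℝ (φ n) U := by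
  choose g hg hgp using hφ.eigen
  have hs : ∀ n, 0 < √(ev n) := fun n => Real.sqrt_pos.2 (hφ.pos n)
  have hss : ∀ n, √(ev n) * √(ev n) = ev n := fun n => Real.mul_self_sqrt (hφ.pos n).le
  have hon : Orthonormal ℝ fun n => (√(ev n))⁻¹ • g n := by
    classical
    rw [orthonormal_iff_ite]
    intro i j
    have h1 := hgp i _ (hg j)
    simp only at h1
    rw [inner_smul_left, inner_smul_right, h1, orthonormal_iff_ite.1 φ.orthonormal i j]
    split_ifs with hij
    · subst hij
      simp only [map_inv₀, conj_trivial]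
      have := hs i
      field_simp
      rw [pow_two, hss]
    · simp
  let Φ : L2 Ω →ₗᵢ[ℝ] L2Vec Ω :=
    hon.orthogonalFamily.linearIsometry.comp φ.repr.toLinearIsometry
  have hΦ : ∀ n, Φ (φ n) = (√(ev n))⁻¹ • g n := by
    classical
    intro n
    change hon.orthogonalFamily.linearIsometry (φ.repr (φ n)) = _
    rw [φ.repr_self, OrthogonalFamily.linearIsometry_apply_single]
    simp
  have hmem : ∀ U q, (∀ n, inner ℝ (φ n) q = √(ev n) * inner ℝ (φ n) U) →
      (U, Φ q) ∈ gradGraph Ω := by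
    intro U q hq
    rw [mem_gradGraph]
    have h1 := φ.hasSum_repr U
    have h2 := (φ.hasSum_repr q).mapL Φ.toContinuousLinearMap
    have h3 := h1.prodMk h2
    refine (Submodule.isClosed_topologicalClosure _).mem_of_tendsto h3
      (Eventually.of_forall fun s => Submodule.sum_mem _ fun n _ => ?_)
    have e : ((φ.repr U n • φ n, Φ.toContinuousLinearMap (φ.repr q n • φ n)) : L2 Ω × L2Vec Ω) =
        φ.repr U n • (φ n, g n) := by
      rw [map_smul, Prod.smul_mk]
      congr 1
      change _ • Φ (φ n) = _
      rw [hΦ, smul_smul, φ.repr_apply_apply, φ.repr_apply_apply, hq n]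
      congr 1
      have := hs n
      field_simp
    rw [e]
    exact Submodule.smul_mem _ _ (mem_gradGraph.1 (hg n))
  refine ⟨Φ, fun U P => ⟨fun h => ?_, ?_⟩⟩
  · let q := Φ.toContinuousLinearMap.adjoint P
    have hq : ∀ n, inner ℝ (φ n) q = √(ev n) * inner ℝ (φ n) U := fun n => by
      rw [ContinuousLinearMap.adjoint_inner_right]
      change inner ℝ (Φ (φ n)) P = _
      rw [hΦ, inner_smul_left, hgp n _ h]
      simp only [map_inv₀, conj_trivial]
      have := hs n
      field_simp
      rw [pow_two, hss]
    refine ⟨q, ?_, hq⟩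
    have h2 := Submodule.sub_mem _ (mem_gradGraph.1 h) (mem_gradGraph.1 (hmem U q hq))
    rw [Prod.mk_sub_mk, sub_self] at h2
    exact sub_eq_zero.1 (eq_zero_of_zero_mem_gradGraph hΩ (mem_gradGraph.2 h2))
  · rintro ⟨q, rfl, hq⟩
    exact hmem U q hq

variable {T : ℝ}

theorem coeff_ae (n : ℕ) (u : L2TS T Ω) :
    coeff φ n u =ᵐ[timeMeasure T] fun t => inner ℝ (φ n) (u t) :=
  ContinuousLinearMap.coeFn_compLpL _ _

section

variable {X Y : Type*} [NormedAddCommGroup X] [NormedSpace ℝ X] [NormedAddCommGroup Y]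
  [NormedSpace ℝ Y]

/-- Pointwise application of a continuous linear map to time-dependent functions. -/
theorem exists_pointwise (T : ℝ) (A : X →L[ℝ] Y) :
    ∃ B : Lp X 2 (timeMeasure T) → Lp Y 2 (timeMeasure T),
      ∀ u, B u =ᵐ[timeMeasure T] fun t => A (u t) :=
  ⟨A.compLpL 2 (timeMeasure T), fun u => ContinuousLinearMap.coeFn_compLpL A u⟩

end

theorem exists_leftInverse_of_isometry {X Y : Type*} [NormedAddCommGroup X] [InnerProductSpace ℝ X]
    [CompleteSpace X] [NormedAddCommGroup Y] [InnerProductSpace ℝ Y] [CompleteSpace Y]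
    (Φ : X →ₗᵢ[ℝ] Y) : ∃ A : Y →L[ℝ] X, ∀ x, A (Φ x) = x :=
  ⟨Φ.toContinuousLinearMap.adjoint, fun x => ext_inner_left ℝ fun y => by
    rw [ContinuousLinearMap.adjoint_inner_right]
    exact Φ.inner_map_map y x⟩

set_option maxHeartbeats 1000000 in
/-- The spatial gradient of time-dependent functions, see `exists_gradient_isometry`. -/
theorem exists_spaceGrad (T : ℝ) (hΩ : IsOpen Ω) (hφ : IsDirichletEigenbasis Ω φ ev) :
    ∃ Ψ : L2TS T Ω → L2TSVec T Ω, (∀ q q', inner ℝ (Ψ q) (Ψ q') = inner ℝ q q') ∧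
      ∀ (u : L2TS T Ω) P, IsSpaceGrad u P ↔
        ∃ q, P = Ψ q ∧ ∀ n, coeff φ n q = √(ev n) • coeff φ n u := by
  obtain ⟨Φ, hΦ⟩ := exists_gradient_isometry hΩ hφ
  obtain ⟨A, hA⟩ := exists_leftInverse_of_isometry Φ
  obtain ⟨Ψ, hΨ⟩ := exists_pointwise T Φ.toContinuousLinearMap
  obtain ⟨Ψ', hΨ'⟩ := exists_pointwise T A
  refine ⟨Ψ, fun q q' => ?_, fun u P => ⟨fun h => ?_, ?_⟩⟩
  · rw [L2.inner_def, L2.inner_def]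
    refine integral_congr_ae ?_
    filter_upwards [hΨ q, hΨ q'] with t h1 h2
    rw [h1, h2]
    exact Φ.inner_map_map _ _
  · have hΨP := hΨ' P
    have key : ∀ᵐ t ∂(timeMeasure T), P t = Φ (Ψ' P t) ∧
        ∀ n, inner ℝ (φ n) (Ψ' P t) = √(ev n) * inner ℝ (φ n) (u t) := by
      filter_upwards [h, hΨP] with t h1 h2
      obtain ⟨q, hq, hn⟩ := (hΦ _ _).1 h1
      rw [h2, hq, hA]
      exact ⟨rfl, hn⟩
    refine ⟨Ψ' P, ?_, fun n => ?_⟩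
    · refine Lp.ext ?_
      filter_upwards [key, hΨ (Ψ' P)] with t h1 h2
      rw [h2]
      exact h1.1
    · refine Lp.ext ?_
      filter_upwards [key, coeff_ae (φ := φ) n (Ψ' P), coeff_ae (φ := φ) n u,
        Lp.coeFn_smul (√(ev n)) (coeff φ n u)] with t h1 h2 h3 h4
      rw [h4, Pi.smul_apply, h3, h2, h1.2 n, smul_eq_mul]
  · rintro ⟨q, rfl, hq⟩
    have h1 : ∀ᵐ t ∂(timeMeasure T), ∀ n,
        inner ℝ (φ n) (q t) = √(ev n) * inner ℝ (φ n) (u t) := by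
      rw [ae_all_iff]
      intro n
      filter_upwards [coeff_ae (φ := φ) n q, coeff_ae (φ := φ) n u,
        Lp.coeFn_smul (√(ev n)) (coeff φ n u)] with t h2 h3 h4
      rw [← h2, ← h3, hq n, h4, Pi.smul_apply, smul_eq_mul]
    filter_upwards [h1, hΨ q] with t h2 h3
    rw [hΦ, h3]
    exact ⟨q t, rfl, h2⟩

end FracWave

namespace FracWave

/-! ### Square-summable sequences in a Hilbert space and the Lax–Milgram lemma -/

variable {H : Type*} [NormedAddCommGroup H]

/-- The space of square-summable sequences in `H`. -/
abbrev Seq (H : Type*) [NormedAddCommGroup H] := lp (fun _ : ℕ => H) 2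

theorem hasSum_norm_sq (c : Seq H) : HasSum (fun n => ‖c n‖ ^ 2) (‖c‖ ^ 2) := by
  have h := lp.hasSum_norm (p := 2) (by norm_num) c
  simpa using h

theorem enorm_sq_eq_tsum (c : Seq H) : ‖c‖ₑ ^ (2 : ℝ) = ∑' n, ‖c n‖ₑ ^ (2 : ℝ) := by
  have h := hasSum_norm_sq c
  have e : ∀ x : ℝ, 0 ≤ x → ENNReal.ofReal x ^ (2 : ℝ) = ENNReal.ofReal (x ^ 2) := fun x hx => by
    rw [ENNReal.rpow_two, ENNReal.ofReal_pow hx]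
  simp only [← ofReal_norm]
  rw [e _ (norm_nonneg _), ← h.tsum_eq, ENNReal.ofReal_tsum_of_nonneg (fun n => by positivity)
    h.summable]
  exact tsum_congr fun n => (e _ (norm_nonneg _)).symm

theorem exists_seq {c : ℕ → H} (h : ∑' n, ‖c n‖ₑ ^ (2 : ℝ) < ∞) :
    ∃ c' : Seq H, ∀ n, c' n = c n := by
  refine ⟨⟨c, memℓp_gen ?_⟩, fun n => rfl⟩
  have h1 := ENNReal.summable_toReal h.ne
  refine h1.congr fun n => ?_
  rw [← ENNReal.toReal_rpow, toReal_enorm]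
  norm_num

variable [InnerProductSpace ℝ H]

/-- Termwise application of an operator to a square-summable sequence. -/
noncomputable def seqMap (A : H →L[ℝ] H) : Seq H →L[ℝ] Seq H :=
  LinearMap.mkContinuous
    { toFun := fun c => ⟨fun n => A (c n), memℓp_gen (by
        have h := (hasSum_norm_sq c).summable.mul_left (‖A‖ ^ 2)
        refine Summable.of_nonneg_of_le (fun n => by positivity) (fun n => ?_) h
        rw [← mul_pow]
        simp only [ENNReal.toReal_ofNat, Real.rpow_ofNat]
        gcongr
        exact A.le_opNorm _)⟩
      map_add' := fun c d => lp.ext (funext fun n => map_add A _ _)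
      map_smul' := fun a c => lp.ext (funext fun n => map_smul A _ _) }
    ‖A‖ fun c => by
      refine le_of_sq_le_sq ?_ (by positivity)
      rw [mul_pow]
      refine hasSum_le (fun n => ?_) (hasSum_norm_sq _) ((hasSum_norm_sq c).mul_left (‖A‖ ^ 2))
      rw [← mul_pow]
      gcongr
      exact A.le_opNorm _

theorem seqMap_apply (A : H →L[ℝ] H) (c : Seq H) (n : ℕ) : seqMap A c n = A (c n) := rfl

theorem le_inner_seqMap {A : H →L[ℝ] H} {κ : ℝ} (h : ∀ x, κ * ‖x‖ ^ 2 ≤ inner ℝ x (A x))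
    (c : Seq H) : κ * ‖c‖ ^ 2 ≤ inner ℝ c (seqMap A c) :=
  hasSum_le (fun n => h (c n)) ((hasSum_norm_sq c).mul_left κ) (lp.hasSum_inner _ _)

/-- The Lax–Milgram lemma on a closed subspace. -/
theorem exists_inner_eq_of_coercive [CompleteSpace H] {A : H →L[ℝ] H} {κ : ℝ} (hκ : 0 < κ)
    (hA : ∀ x, κ * ‖x‖ ^ 2 ≤ inner ℝ x (A x)) {K : Submodule ℝ H} (hK : IsClosed (K : Set H))
    (F : K →ₗ[ℝ] ℝ) {M : ℝ} (hF : ∀ y, |F y| ≤ M * ‖y‖) :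
    ∃ x : K, ∀ y : K, inner ℝ (x : H) (A y) = F y := by
  have : CompleteSpace K := hK.completeSpace_coe
  let b : K →L[ℝ] K →L[ℝ] ℝ := (innerSL ℝ : H →L[ℝ] H →L[ℝ] ℝ).bilinearComp K.subtypeL
    (A ∘L K.subtypeL)
  have hb : IsCoercive b := ⟨κ, hκ, fun u => by
    rw [mul_assoc, ← pow_two]
    exact hA u⟩
  let F' : K →L[ℝ] ℝ := F.mkContinuous M hF
  refine ⟨hb.continuousLinearEquivOfBilin.symm ((InnerProductSpace.toDual ℝ K).symm F'),
    fun y => ?_⟩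
  have h := hb.continuousLinearEquivOfBilin_apply
    (hb.continuousLinearEquivOfBilin.symm ((InnerProductSpace.toDual ℝ K).symm F')) y
  rw [ContinuousLinearEquiv.apply_symm_apply, InnerProductSpace.toDual_symm_apply] at h
  exact h.symm

theorem inner_apply_isHilbertSum {E : Type*} [NormedAddCommGroup E] [InnerProductSpace ℝ E]
    [CompleteSpace E] {V : ℕ → H →ₗᵢ[ℝ] E} (hV : IsHilbertSum ℝ (fun _ : ℕ => H) V) (n : ℕ) (c : H)
    (u : E) : inner ℝ (V n c) u = inner ℝ c (hV.linearIsometryEquiv u n) := by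
  classical
  have h := lp.inner_single_left (𝕜 := ℝ) (G := fun _ : ℕ => H) n c (hV.linearIsometryEquiv u)
  refine Eq.trans ?_ h
  rw [← hV.linearIsometryEquiv_symm_apply_single, ← hV.linearIsometryEquiv.inner_map_map,
    LinearIsometryEquiv.apply_symm_apply]

end FracWave

namespace FracWave

/-! ### Expansion of time-dependent functions in the eigenfunctions -/

variable {d : ℕ} {Ω : Set (Sp d)} {φ : HilbertBasis ℕ ℝ (L2 Ω)} {T : ℝ}

theorem coeff_ext {u v : L2TS T Ω} (h : ∀ n, coeff φ n u = coeff φ n v) : u = v := by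
  refine Lp.ext ?_
  have h1 : ∀ᵐ t ∂(timeMeasure T), ∀ n, inner ℝ (φ n) (u t) = inner ℝ (φ n) (v t) := by
    rw [ae_all_iff]
    intro n
    filter_upwards [coeff_ae (φ := φ) n u, coeff_ae (φ := φ) n v] with t h2 h3
    rw [← h2, ← h3, h n]
  filter_upwards [h1] with t ht
  refine φ.repr.injective (lp.ext (funext fun n => ?_))
  rw [φ.repr_apply_apply, φ.repr_apply_apply, ht n]

/-- The embedding `c ↦ c φₙ` of `L²(0, T)` into `L²(0, T; L²(Ω))`. -/
noncomputable def coordEmb (T : ℝ) (φ : HilbertBasis ℕ ℝ (L2 Ω)) (n : ℕ) :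
    L2Time T →ₗᵢ[ℝ] L2TS T Ω where
  toLinearMap := ((ContinuousLinearMap.toSpanSingleton ℝ (φ n)).compLpL 2
    (timeMeasure T)).toLinearMap
  norm_map' c := by
    change ‖(ContinuousLinearMap.toSpanSingleton ℝ (φ n)).compLpL 2 (timeMeasure T) c‖ = ‖c‖
    rw [Lp.norm_def, Lp.norm_def]
    congr 1
    refine eLpNorm_congr_norm_ae ?_
    filter_upwards [ContinuousLinearMap.coeFn_compLpL (p := 2) (μ := timeMeasure T)
      (ContinuousLinearMap.toSpanSingleton ℝ (φ n)) c] with t ht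
    rw [ht, ContinuousLinearMap.toSpanSingleton_apply, norm_smul, φ.orthonormal.1 n, mul_one]

theorem coordEmb_ae (n : ℕ) (c : L2Time T) :
    coordEmb T φ n c =ᵐ[timeMeasure T] fun t => c t • φ n :=
  ContinuousLinearMap.coeFn_compLpL _ _

theorem inner_coordEmb (n : ℕ) (c : L2Time T) (u : L2TS T Ω) :
    inner ℝ (coordEmb T φ n c) u = inner ℝ c (coeff φ n u) := by
  rw [L2.inner_def, L2.inner_def]
  refine integral_congr_ae ?_
  filter_upwards [coordEmb_ae (φ := φ) n c, coeff_ae (φ := φ) n u] with t h1 h2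
  rw [h1, h2, inner_smul_left, RCLike.inner_apply, mul_comm]

theorem coeff_coordEmb (m n : ℕ) (c : L2Time T) :
    coeff φ m (coordEmb T φ n c) = if m = n then c else 0 := by
  refine Lp.ext ?_
  filter_upwards [coordEmb_ae (φ := φ) n c, coeff_ae (φ := φ) m (coordEmb T φ n c),
    Lp.coeFn_zero ℝ 2 (timeMeasure T)] with t h1 h2 h3
  rw [h2, h1, inner_smul_right, orthonormal_iff_ite.1 φ.orthonormal m n]
  split_ifs
  · rw [mul_one]
  · rw [mul_zero, h3, Pi.zero_apply]

theorem isHilbertSum_coordEmb (T : ℝ) (φ : HilbertBasis ℕ ℝ (L2 Ω)) :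
    IsHilbertSum ℝ (fun _ : ℕ => L2Time T) (coordEmb T φ) := by
  classical
  refine IsHilbertSum.mk (fun i j hij c e => ?_) ?_
  · rw [inner_coordEmb, coeff_coordEmb, if_neg hij, inner_zero_right]
  · rw [top_le_iff, Submodule.topologicalClosure_eq_top_iff, Submodule.eq_bot_iff]
    intro u hu
    refine coeff_ext (φ := φ) fun n => ?_
    have h : ∀ c : L2Time T, inner ℝ c (coeff φ n u) = 0 := fun c => by
      rw [← inner_coordEmb]
      exact hu _ ((le_iSup (fun i => LinearMap.range (coordEmb T φ i).toLinearMap) n) ⟨c, rfl⟩)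
    rw [inner_self_eq_zero.1 (h _)]
    exact (map_zero ((innerSL ℝ (φ n)).compLpL 2 (timeMeasure T))).symm

/-- The expansion `u ↦ (coeff φ n u)ₙ` as an isometry of `L²(0, T; L²(Ω))` with the space of
square-summable sequences in `L²(0, T)`. -/
noncomputable def coordEquiv (T : ℝ) (φ : HilbertBasis ℕ ℝ (L2 Ω)) :
    L2TS T Ω ≃ₗᵢ[ℝ] Seq (L2Time T) :=
  (isHilbertSum_coordEmb T φ).linearIsometryEquiv

theorem coordEquiv_apply (u : L2TS T Ω) (n : ℕ) : coordEquiv T φ u n = coeff φ n u := by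
  refine ext_inner_left ℝ fun c => ?_
  rw [← inner_coordEmb]
  exact (inner_apply_isHilbertSum (isHilbertSum_coordEmb T φ) n c u).symm

attribute [irreducible] coordEmb coordEquiv

theorem coeff_coordEquiv_symm (c : Seq (L2Time T)) (n : ℕ) :
    coeff φ n ((coordEquiv T φ).symm c) = c n := by
  rw [← coordEquiv_apply, LinearIsometryEquiv.apply_symm_apply]

theorem coordEquiv_symm_eq {c : Seq (L2Time T)} {u : L2TS T Ω} (h : ∀ n, c n = coeff φ n u) :
    (coordEquiv T φ).symm c = u :=
  coeff_ext (φ := φ) fun n => by rw [coeff_coordEquiv_symm, h]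

variable {γ : ℝ}

theorem coeff_rlOp (hγ : 0 < γ) (n : ℕ) (u : L2TS T Ω) :
    coeff φ n (rlOp T hγ u) = rlOp T hγ (coeff φ n u) := by
  refine Lp.ext ?_
  filter_upwards [coeff_ae (φ := φ) n (rlOp T hγ u), rlOp_ae hγ u, rlOp_ae hγ (coeff φ n u),
    ae_integrable_conv (isKernel_rlKer T hγ) u, ae_restrict_mem measurableSet_Ioo]
    with t h1 h2 h3 h4 ht
  rw [h1, h2, h3, intLeft_eq_conv, intLeft_eq_conv, conv_congr (coeff_ae n u) ht.2.le, conv, conv,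
    ← integral_inner h4]
  exact integral_congr_ae (Eventually.of_forall fun s => inner_smul_right _ _ _)

theorem coeff_reflect (n : ℕ) (u : L2TS T Ω) :
    coeff φ n (reflect T u) = reflect T (coeff φ n u) := by
  refine Lp.ext ?_
  filter_upwards [coeff_ae (φ := φ) n (reflect T u), reflect_ae u, reflect_ae (coeff φ n u),
    (measurePreserving_reflect T).quasiMeasurePreserving.ae (coeff_ae (φ := φ) n u)]
    with t h1 h2 h3 h4
  rw [h1, h2, h3, h4]

theorem coeff_rlOpR (hγ : 0 < γ) (n : ℕ) (u : L2TS T Ω) :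
    coeff φ n (rlOpR T hγ u) = rlOpR T hγ (coeff φ n u) := by
  rw [rlOpR_apply, rlOpR_apply, coeff_reflect, coeff_rlOp, coeff_reflect]

end FracWave

namespace FracWave

/-! ### The Hilbert space and the bilinear form of the weak formulation -/

section

variable {H : Type*} [NormedAddCommGroup H] [InnerProductSpace ℝ H]

/-- The Hilbert space of pairs of square-summable sequences. -/
abbrev SeqPair (H : Type*) [NormedAddCommGroup H] := WithLp 2 (Seq H × Seq H)

/-- The operator `(g, p) ↦ (S g, S^* p)`, termwise. -/
noncomputable def pairMap [CompleteSpace H] (S : H →L[ℝ] H) : SeqPair H →L[ℝ] SeqPair H :=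
  (WithLp.prodContinuousLinearEquiv 2 ℝ (Seq H) (Seq H)).symm.toContinuousLinearMap ∘L
    ((seqMap S).prodMap (seqMap S.adjoint)) ∘L
    (WithLp.prodContinuousLinearEquiv 2 ℝ (Seq H) (Seq H)).toContinuousLinearMap

theorem inner_pairMap [CompleteSpace H] (S : H →L[ℝ] H) (x y : SeqPair H) :
    inner ℝ x (pairMap S y) =
      inner ℝ x.fst (seqMap S y.fst) + inner ℝ x.snd (seqMap S.adjoint y.snd) :=
  WithLp.prod_inner_apply _ _

theorem le_inner_pairMap [CompleteSpace H] {S : H →L[ℝ] H} {κ : ℝ}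
    (h : ∀ x, κ * ‖x‖ ^ 2 ≤ inner ℝ x (S x)) (x : SeqPair H) :
    κ * ‖x‖ ^ 2 ≤ inner ℝ x (pairMap S x) := by
  rw [inner_pairMap, WithLp.prod_norm_sq_eq_of_L2, mul_add]
  refine add_le_add (le_inner_seqMap h _) (le_inner_seqMap (fun y => ?_) _)
  rw [ContinuousLinearMap.adjoint_inner_right, real_inner_comm]
  exact h y

/-- The closed subspace of the pairs `(g, p)` with `pₙ = λₙ^{1/2} J² gₙ`. For `J` the
Riemann-Liouville integral of order `α/4` it parametrizes `W` through `uₙ = J gₙ`. -/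
def solSpace (J : H →L[ℝ] H) (ev : ℕ → ℝ) : Submodule ℝ (SeqPair H) where
  carrier := {x | ∀ n, x.snd n = √(ev n) • J (J (x.fst n))}
  add_mem' := fun {x y} hx hy n => by
    change x.snd n + y.snd n = √(ev n) • J (J (x.fst n + y.fst n))
    rw [hx n, hy n, map_add, map_add, smul_add]
  zero_mem' := fun n => by
    change (0 : H) = √(ev n) • J (J (0 : H))
    rw [map_zero, map_zero, smul_zero]
  smul_mem' := fun c x hx n => by
    change c • x.snd n = √(ev n) • J (J (c • x.fst n))
    rw [hx n, map_smul, map_smul, smul_comm]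

theorem isClosed_solSpace (J : H →L[ℝ] H) (ev : ℕ → ℝ) :
    IsClosed (solSpace J ev : Set (SeqPair H)) := by
  have e : (solSpace J ev : Set (SeqPair H)) =
      ⋂ n, {x | x.snd n = √(ev n) • J (J (x.fst n))} := by
    ext x
    rw [mem_iInter]
    rfl
  rw [e]
  have h1 : ∀ n, Continuous fun x : SeqPair H => x.fst n := fun n =>
    (lp.evalCLM ℝ (fun _ : ℕ => H) 2 n).continuous.comp
      (WithLp.fstL 2 ℝ (Seq H) (Seq H)).continuous
  have h2 : ∀ n, Continuous fun x : SeqPair H => x.snd n := fun n =>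
    (lp.evalCLM ℝ (fun _ : ℕ => H) 2 n).continuous.comp
      (WithLp.sndL 2 ℝ (Seq H) (Seq H)).continuous
  exact isClosed_iInter fun n => isClosed_eq (h2 n)
    ((J.continuous.comp (J.continuous.comp (h1 n))).const_smul _)

end

variable {T γ : ℝ}

/-- The operator `D_{T-}^{γ} D_{0+}^{-γ}`: it is bounded and coercive for `γ < 1/2`. -/
theorem exists_swap (T : ℝ) (hγ : 0 < γ) (hγ2 : γ < 1 / 2) :
    ∃ S : L2Time T →L[ℝ] L2Time T, (∀ x, rlOpR T hγ (S x) = rlOp T hγ x) ∧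
      (∀ x, ‖S x‖ ≤ (coerConst γ)⁻¹ * ‖x‖) ∧
      ∀ x, coerConst γ * ‖x‖ ^ 2 ≤ inner ℝ x (S x) := by
  have h := (adjointCoercive_rlOp T hγ hγ2).exists_factor (coerConst_pos hγ hγ2)
    (by rw [adjoint_rlOp]; exact injective_rlOpR hγ (by linarith))
    (denseRange_rlOp hγ (by linarith))
  rwa [adjoint_rlOp] at h

/-- A bounded coercive operator `S` with `D_{T-}^{-γ} S = D_{0+}^{-γ}`. -/
noncomputable def swapOp (T : ℝ) (hγ : 0 < γ) (hγ2 : γ < 1 / 2) : L2Time T →L[ℝ] L2Time T :=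
  (exists_swap T hγ hγ2).choose

theorem rlOpR_swapOp (hγ : 0 < γ) (hγ2 : γ < 1 / 2) (x : L2Time T) :
    rlOpR T hγ (swapOp T hγ hγ2 x) = rlOp T hγ x :=
  (exists_swap T hγ hγ2).choose_spec.1 x

theorem norm_swapOp_le (hγ : 0 < γ) (hγ2 : γ < 1 / 2) (x : L2Time T) :
    ‖swapOp T hγ hγ2 x‖ ≤ (coerConst γ)⁻¹ * ‖x‖ :=
  (exists_swap T hγ hγ2).choose_spec.2.1 x

theorem le_inner_swapOp (hγ : 0 < γ) (hγ2 : γ < 1 / 2) (x : L2Time T) :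
    coerConst γ * ‖x‖ ^ 2 ≤ inner ℝ x (swapOp T hγ hγ2 x) :=
  (exists_swap T hγ hγ2).choose_spec.2.2 x

theorem adjoint_swapOp_rlOp (hγ : 0 < γ) (hγ2 : γ < 1 / 2) (x : L2Time T) :
    (swapOp T hγ hγ2).adjoint (rlOp T hγ x) = rlOpR T hγ x :=
  ext_inner_right ℝ fun y => by
    rw [ContinuousLinearMap.adjoint_inner_left, inner_rlOp_left, rlOpR_swapOp, real_inner_comm,
      inner_rlOp_left, real_inner_comm]

theorem norm_rlOpR_le (hγ : 0 < γ) (hγ2 : γ < 1 / 2) (x : L2Time T) :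
    ‖rlOpR T hγ x‖ ≤ (coerConst γ)⁻¹ * ‖rlOp T hγ x‖ := by
  have h := (adjointCoercive_rlOp T hγ hγ2).norm_adjoint_le (coerConst_pos hγ hγ2) x
  rwa [adjoint_rlOp] at h

namespace ExtSeminorm

variable {E : Type*} [AddCommGroup E] [Module ℝ E]

theorem enorm_apply_le_opNorm {N : ExtSeminorm E} {F : N.space →ₗ[ℝ] ℝ} (hF : N.opNorm F < ∞)
    (w : N.space) : ‖F w‖ₑ ≤ N.opNorm F * N (w : E) := by
  have hw : N (w : E) < ∞ := w.2
  have hle : ∀ z : N.space, N (z : E) ≤ 1 → ‖F z‖ₑ ≤ N.opNorm F := fun z hz =>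
    le_iSup₂ (f := fun (w : N.space) (_ : N (w : E) ≤ 1) => ‖F w‖ₑ) z hz
  have hF' : ENNReal.ofReal (N.opNorm F).toReal = N.opNorm F := ENNReal.ofReal_toReal hF.ne
  have hN' : ENNReal.ofReal (N (w : E)).toReal = N (w : E) := ENNReal.ofReal_toReal hw.ne
  -- every `a > N w` gives `|F w| ≤ a ‖F‖`, including the case `N w = 0`
  have key : ∀ a : ℝ, (N (w : E)).toReal < a → |F w| ≤ (N.opNorm F).toReal * a := by
    intro a ha
    have ha0 : 0 < a := ENNReal.toReal_nonneg.trans_lt ha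
    have h1 : N ((a⁻¹ • w : N.space) : E) ≤ 1 := by
      refine (N.smul_le' a⁻¹ w).trans ?_
      rw [← hN', ← ofReal_norm, ← ENNReal.ofReal_mul (norm_nonneg _), ENNReal.ofReal_le_one,
        Real.norm_of_nonneg (by positivity), inv_mul_le_iff₀ ha0, mul_one]
      exact ha.le
    have h2 := hle _ h1
    rw [← hF', map_smul, smul_eq_mul, ← ofReal_norm, ENNReal.ofReal_le_ofReal_iff
      ENNReal.toReal_nonneg, norm_mul, Real.norm_of_nonneg (by positivity),
      inv_mul_le_iff₀ ha0, Real.norm_eq_abs] at h2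
    linarith
  have h3 : |F w| ≤ (N.opNorm F).toReal * (N (w : E)).toReal := by
    refine ge_of_tendsto (f := fun a : ℝ => (N.opNorm F).toReal * a)
      (x := 𝓝[>] (N (w : E)).toReal) ?_ (eventually_mem_nhdsWithin.mono key)
    exact (tendsto_id.const_mul _).mono_left nhdsWithin_le_nhds
  rw [← hF', ← hN', ← ENNReal.ofReal_mul ENNReal.toReal_nonneg, ← ofReal_norm]
  exact ENNReal.ofReal_le_ofReal h3

theorem opNorm_le {N : ExtSeminorm E} {F : N.space →ₗ[ℝ] ℝ} {M : ℝ≥0∞}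
    (h : ∀ w : N.space, ‖F w‖ₑ ≤ M * N (w : E)) : N.opNorm F ≤ M :=
  iSup₂_le fun w hw => (h w).trans (mul_le_of_le_one_right' hw)

theorem inter_le_add (N₀ N₁ : ExtSeminorm E) (u : E) : N₀.inter N₁ u ≤ N₀ u + N₁ u :=
  ENNReal.rpow_add_rpow_le_add _ _ one_le_two

theorem left_le_inter (N₀ N₁ : ExtSeminorm E) (u : E) : N₀ u ≤ N₀.inter N₁ u := by
  refine le_trans ?_ (ENNReal.rpow_le_rpow (le_self_add (a := N₀ u ^ (2 : ℝ))) (by norm_num))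
  rw [← ENNReal.rpow_mul]
  norm_num

theorem right_le_inter (N₀ N₁ : ExtSeminorm E) (u : E) : N₁ u ≤ N₀.inter N₁ u := by
  refine le_trans ?_ (ENNReal.rpow_le_rpow (le_add_self (a := N₁ u ^ (2 : ℝ))) (by norm_num))
  rw [← ENNReal.rpow_mul]
  norm_num

end ExtSeminorm

variable {d : ℕ} {Ω : Set (Sp d)} {φ : HilbertBasis ℕ ℝ (L2 Ω)} {ev : ℕ → ℝ}

theorem vecH_le {N : ExtSeminorm (L2Time T)} {s K : ℝ} {u : L2TS T Ω} {c : Seq (L2Time T)}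
    (h : ∀ n, ENNReal.ofReal (ev n ^ s) * N (coeff φ n u) ^ (2 : ℝ) ≤
      (ENNReal.ofReal K * ‖c n‖ₑ) ^ (2 : ℝ)) :
    vecH φ ev N s u ≤ ENNReal.ofReal K * ‖c‖ₑ := by
  have h1 : ∑' n, ENNReal.ofReal (ev n ^ s) * N (coeff φ n u) ^ (2 : ℝ) ≤
      (ENNReal.ofReal K * ‖c‖ₑ) ^ (2 : ℝ) := by
    refine (ENNReal.tsum_le_tsum h).trans (le_of_eq ?_)
    simp only [ENNReal.mul_rpow_of_nonneg _ _ (zero_le_two : (0 : ℝ) ≤ 2)]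
    rw [ENNReal.tsum_mul_left, enorm_sq_eq_tsum]
  refine (ENNReal.rpow_le_rpow h1 (by norm_num : (0 : ℝ) ≤ 1 / 2)).trans (le_of_eq ?_)
  rw [← ENNReal.rpow_mul]
  norm_num

theorem exists_seq_of_vecH {N : ExtSeminorm (L2Time T)} {s K : ℝ} {u : L2TS T Ω}
    (hu : vecH φ ev N s u < ∞) {c : ℕ → L2Time T}
    (h : ∀ n, ‖c n‖ₑ ^ (2 : ℝ) ≤
      ENNReal.ofReal K ^ (2 : ℝ) * (ENNReal.ofReal (ev n ^ s) * N (coeff φ n u) ^ (2 : ℝ))) :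
    ∃ c' : Seq (L2Time T), (∀ n, c' n = c n) ∧ ‖c'‖ₑ ≤ ENNReal.ofReal K * vecH φ ev N s u := by
  have h1 : ∑' n, ‖c n‖ₑ ^ (2 : ℝ) ≤ (ENNReal.ofReal K * vecH φ ev N s u) ^ (2 : ℝ) := by
    refine (ENNReal.tsum_le_tsum h).trans (le_of_eq ?_)
    rw [ENNReal.tsum_mul_left, ENNReal.mul_rpow_of_nonneg _ _ (by norm_num)]
    congr 1
    change _ = ((_ : ℝ≥0∞) ^ (1 / 2 : ℝ)) ^ (2 : ℝ)
    rw [← ENNReal.rpow_mul]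
    norm_num
  obtain ⟨c', hc'⟩ := exists_seq (h1.trans_lt (ENNReal.rpow_lt_top_of_nonneg (by norm_num)
    (ENNReal.mul_lt_top ENNReal.ofReal_lt_top hu).ne))
  refine ⟨c', hc', ?_⟩
  rw [← ENNReal.rpow_le_rpow_iff (zero_lt_two : (0 : ℝ) < 2), enorm_sq_eq_tsum]
  simpa only [hc'] using h1

end FracWave

namespace FracWave

/-! ### The spaces `W` and `Ŵ` in terms of Riemann-Liouville integrals -/

variable {T α : ℝ} {d : ℕ} {Ω : Set (Sp d)} {φ : HilbertBasis ℕ ℝ (L2 Ω)} {ev : ℕ → ℝ}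

theorem ofReal_mul_rpow_two {l : ℝ} (hl : 0 ≤ l) (a : ℝ≥0∞) :
    ENNReal.ofReal l * a ^ (2 : ℝ) = (ENNReal.ofReal √l * a) ^ (2 : ℝ) := by
  rw [ENNReal.mul_rpow_of_nonneg _ _ zero_le_two,
    ENNReal.ofReal_rpow_of_nonneg (Real.sqrt_nonneg _) zero_le_two, Real.rpow_two,
    Real.sq_sqrt hl]

theorem enorm_sqrt_smul {H : Type*} [NormedAddCommGroup H] [NormedSpace ℝ H] (l : ℝ) (x : H) :
    ‖√l • x‖ₑ = ENNReal.ofReal √l * ‖x‖ₑ := by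
  rw [enorm_smul, ← ofReal_norm, Real.norm_of_nonneg (Real.sqrt_nonneg _)]

theorem enorm_le_of_norm_le {H H' : Type*} [NormedAddCommGroup H] [NormedAddCommGroup H']
    {x : H} {y : H'} {K : ℝ} (hK : 0 ≤ K) (h : ‖x‖ ≤ K * ‖y‖) : ‖x‖ₑ ≤ ENNReal.ofReal K * ‖y‖ₑ := by
  rw [← ofReal_norm, ← ofReal_norm, ← ENNReal.ofReal_mul hK]
  exact ENNReal.ofReal_le_ofReal h

/-- The function `u` with coefficients `uₙ = D_{0+}^{-α/4} gₙ`, for a pair `(g, p)`. -/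
noncomputable def solFun (φ : HilbertBasis ℕ ℝ (L2 Ω)) (hγ : 0 < α / 4) :
    SeqPair (L2Time T) →ₗ[ℝ] L2TS T Ω :=
  (coordEquiv T φ).symm.toLinearEquiv.toLinearMap ∘ₗ
    (seqMap (rlOp T hγ : L2Time T →L[ℝ] L2Time T)).toLinearMap ∘ₗ
    (WithLp.fstL 2 ℝ (Seq (L2Time T)) (Seq (L2Time T))).toLinearMap

theorem coeff_solFun (hγ : 0 < α / 4) (x : SeqPair (L2Time T)) (n : ℕ) :
    coeff φ n (solFun φ hγ x) = rlOp T hγ (x.fst n) :=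
  coeff_coordEquiv_symm (φ := φ) (seqMap (rlOp T hγ : L2Time T →L[ℝ] L2Time T) x.fst) n

/-- The function with coefficients `D_{T-}^{-α/4} kₙ`. -/
noncomputable def rightFun (φ : HilbertBasis ℕ ℝ (L2 Ω)) (hγ : 0 < α / 4) :
    Seq (L2Time T) →ₗ[ℝ] L2TS T Ω :=
  (coordEquiv T φ).symm.toLinearEquiv.toLinearMap ∘ₗ
    (seqMap (rlOpR T hγ : L2Time T →L[ℝ] L2Time T)).toLinearMap

theorem coeff_rightFun (hγ : 0 < α / 4) (k : Seq (L2Time T)) (n : ℕ) :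
    coeff φ n (rightFun φ hγ k) = rlOpR T hγ (k n) :=
  coeff_coordEquiv_symm (φ := φ) (seqMap (rlOpR T hγ : L2Time T →L[ℝ] L2Time T) k) n

attribute [irreducible] solFun rightFun

theorem vecH_zero_le {N : ExtSeminorm (L2Time T)} {K : ℝ} {u : L2TS T Ω} {c : Seq (L2Time T)}
    (h : ∀ n, N (coeff φ n u) ≤ ENNReal.ofReal K * ‖c n‖ₑ) :
    vecH φ ev N 0 u ≤ ENNReal.ofReal K * ‖c‖ₑ := vecH_le fun n => by
  have e : ENNReal.ofReal (ev n ^ (0 : ℝ)) = 1 := by rw [Real.rpow_zero, ENNReal.ofReal_one]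
  rw [e, one_mul]
  exact ENNReal.rpow_le_rpow (h n) zero_le_two

theorem coeff_lt_top_of_vecH {N : ExtSeminorm (L2Time T)} {u : L2TS T Ω}
    (h0 : vecH φ ev N 0 u < ∞) (n : ℕ) : N (coeff φ n u) < ∞ := by
  have h2 : ∑' n, ENNReal.ofReal (ev n ^ (0 : ℝ)) * N (coeff φ n u) ^ (2 : ℝ) < ∞ := by
    by_contra hcon
    rw [not_lt, top_le_iff] at hcon
    change (_ : ℝ≥0∞) ^ (1 / 2 : ℝ) < ∞ at h0
    rw [hcon] at h0
    norm_num at h0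
  have h3 := (ENNReal.le_tsum n).trans_lt h2
  rw [Real.rpow_zero, ENNReal.ofReal_one, one_mul] at h3
  by_contra hcon
  rw [not_lt, top_le_iff] at hcon
  rw [hcon] at h3
  norm_num at h3

theorem exists_solFun_eq (hT : 0 < T) (hev : ∀ n, 0 < ev n) (hγ : 0 < α / 4) (hγ1 : α / 4 < 1)
    {u : L2TS T Ω} (hu : normW α T φ ev u < ∞) :
    ∃ x ∈ solSpace (rlOp T hγ : L2Time T →L[ℝ] L2Time T) ev, solFun φ hγ x = u := by
  have h0 := (ExtSeminorm.left_le_inter _ _ _).trans_lt hu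
  have h1 := (ExtSeminorm.right_le_inter _ _ _).trans_lt hu
  choose g hg hgn using fun n => exists_rlOp_eq_of_leftH hT hγ hγ1 (coeff_lt_top_of_vecH h0 n)
  obtain ⟨g', hg', -⟩ := exists_seq_of_vecH (K := loConst (α / 4)) h0 (c := g) fun n => by
    rw [Real.rpow_zero, ENNReal.ofReal_one, one_mul,
      ← ENNReal.mul_rpow_of_nonneg _ _ zero_le_two]
    exact ENNReal.rpow_le_rpow (hgn n) zero_le_two
  obtain ⟨p', hp', -⟩ := exists_seq_of_vecH (K := upConst (α / 4)) h1
    (c := fun n => √(ev n) • rlOp T hγ (coeff φ n u)) fun n => by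
    rw [Real.rpow_one, enorm_sqrt_smul, ← ofReal_mul_rpow_two (hev n).le, mul_left_comm,
      ← ENNReal.mul_rpow_of_nonneg _ _ zero_le_two]
    gcongr
    exact enorm_rlOp_le_leftH_neg hT hγ hγ1 _
  refine ⟨WithLp.toLp 2 (g', p'), fun n => ?_, coeff_ext (φ := φ) fun n => ?_⟩
  · change p' n = √(ev n) • rlOp T hγ (rlOp T hγ (g' n))
    rw [hp', hg', hg]
  · rw [coeff_solFun]
    change rlOp T hγ (g' n) = _
    rw [hg', hg]

theorem normW_solFun_le (hT : 0 < T) (hev : ∀ n, 0 < ev n) (hγ : 0 < α / 4) (hγ1 : α / 4 < 1)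
    {x : SeqPair (L2Time T)} (hx : x ∈ solSpace (rlOp T hγ : L2Time T →L[ℝ] L2Time T) ev) :
    normW α T φ ev (solFun φ hγ x) ≤
      ENNReal.ofReal (upConst (α / 4) + loConst (α / 4)) * ‖x‖ₑ := by
  have h0 : vecH φ ev (leftH T (α / 4)) 0 (solFun φ hγ x) ≤
      ENNReal.ofReal (upConst (α / 4)) * ‖x.fst‖ₑ := vecH_zero_le fun n => by
    rw [coeff_solFun]
    exact leftH_rlOp_le hT hγ hγ1 _
  have h1 : vecH φ ev (leftH T (-(α / 4))) 1 (solFun φ hγ x) ≤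
      ENNReal.ofReal (loConst (α / 4)) * ‖x.snd‖ₑ := vecH_le fun n => by
    rw [Real.rpow_one, coeff_solFun, hx n, enorm_sqrt_smul, mul_left_comm,
      ← ofReal_mul_rpow_two (hev n).le]
    gcongr
    exact leftH_neg_le hT hγ hγ1 _
  refine (ExtSeminorm.inter_le_add _ _ _).trans ((add_le_add h0 h1).trans ?_)
  rw [ENNReal.ofReal_add (upConst_pos _).le (loConst_pos _).le, add_mul]
  gcongr
  · exact WithLp.enorm_fst_le _ x
  · exact WithLp.enorm_snd_le _ x

/-- Bound for the norm of `D_{T-}^{-α/2} u` in `Ŵ`. -/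
noncomputable def hatConst (α : ℝ) : ℝ :=
  upConst₂ (3 * α / 4) * (coerConst (α / 4))⁻¹ + upConst (α / 4) * (coerConst (α / 4))⁻¹

theorem hatConst_nonneg (hγ : 0 < α / 4) (hγ2 : α / 4 < 1 / 2) : 0 ≤ hatConst α := by
  have h1 := coerConst_pos hγ hγ2
  have h2 := upConst_pos (α / 4)
  have h3 := upConst₂_pos (3 * α / 4)
  unfold hatConst; positivity

theorem rightH_rlOpR_rlOp_le (hT : 0 < T) (hγ : 0 < α / 4) (hγ2 : α / 4 < 1 / 2)
    (h2 : 0 < α / 2) (g : L2Time T) :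
    rightH T (3 * α / 4) (rlOpR T h2 (rlOp T hγ g)) ≤
      ENNReal.ofReal (upConst₂ (3 * α / 4) * (coerConst (α / 4))⁻¹) * ‖g‖ₑ := by
  have hμ : 0 < 3 * α / 4 := by linarith
  have e : rlOpR T h2 (rlOp T hγ g) = rlOpR T hμ (swapOp T hγ hγ2 g) := by
    rw [← rlOpR_swapOp hγ hγ2, rlOpR_rlOpR]
    exact rlOpR_congr _ _ (by ring) _
  rw [e, ENNReal.ofReal_mul (upConst₂_pos _).le, mul_assoc]
  refine (rightH_rlOpR_le_of_lt_two hT hμ (by linarith) _).trans ?_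
  gcongr
  exact enorm_le_of_norm_le (inv_pos.2 (coerConst_pos hγ hγ2)).le (norm_swapOp_le hγ hγ2 _)

theorem rightH_rlOpR_half_le (hT : 0 < T) (hγ : 0 < α / 4) (hγ2 : α / 4 < 1 / 2)
    (h2 : 0 < α / 2) (v : L2Time T) :
    rightH T (α / 4) (rlOpR T h2 v) ≤
      ENNReal.ofReal (upConst (α / 4) * (coerConst (α / 4))⁻¹) * ‖rlOp T hγ v‖ₑ := by
  have e : rlOpR T h2 v = rlOpR T hγ (rlOpR T hγ v) := by
    rw [rlOpR_rlOpR]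
    exact rlOpR_congr _ _ (by ring) _
  rw [e, ENNReal.ofReal_mul (upConst_pos _).le, mul_assoc]
  refine (rightH_rlOpR_le hT hγ (by linarith) _).trans ?_
  gcongr
  exact enorm_le_of_norm_le (inv_pos.2 (coerConst_pos hγ hγ2)).le (norm_rlOpR_le hγ hγ2 _)

theorem coeff_rlOpR_solFun (hγ : 0 < α / 4) (h2 : 0 < α / 2) (x : SeqPair (L2Time T)) (n : ℕ) :
    coeff φ n (rlOpR T h2 (solFun φ hγ x)) = rlOpR T h2 (rlOp T hγ (x.fst n)) := by
  rw [coeff_rlOpR, coeff_solFun]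

theorem vecH_rlOpR_solFun_zero_le (hT : 0 < T) (hγ : 0 < α / 4)
    (hγ2 : α / 4 < 1 / 2) (h2 : 0 < α / 2) (x : SeqPair (L2Time T)) :
    vecH φ ev (rightH T (3 * α / 4)) 0 (rlOpR T h2 (solFun φ hγ x)) ≤
      ENNReal.ofReal (upConst₂ (3 * α / 4) * (coerConst (α / 4))⁻¹) * ‖x.fst‖ₑ := by
  refine vecH_zero_le fun n => ?_
  rw [coeff_rlOpR_solFun]
  exact rightH_rlOpR_rlOp_le hT hγ hγ2 h2 _

theorem vecH_rlOpR_solFun_one_le (hT : 0 < T) (hev : ∀ n, 0 < ev n) (hγ : 0 < α / 4)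
    (hγ2 : α / 4 < 1 / 2) (h2 : 0 < α / 2) {x : SeqPair (L2Time T)}
    (hx : x ∈ solSpace (rlOp T hγ : L2Time T →L[ℝ] L2Time T) ev) :
    vecH φ ev (rightH T (α / 4)) 1 (rlOpR T h2 (solFun φ hγ x)) ≤
      ENNReal.ofReal (upConst (α / 4) * (coerConst (α / 4))⁻¹) * ‖x.snd‖ₑ := by
  refine vecH_le fun n => ?_
  rw [Real.rpow_one, coeff_rlOpR_solFun, hx n, enorm_sqrt_smul, mul_left_comm,
    ← ofReal_mul_rpow_two (hev n).le]
  gcongr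
  exact rightH_rlOpR_half_le hT hγ hγ2 h2 _

theorem normWhat_solFun_le (hT : 0 < T) (hev : ∀ n, 0 < ev n) (hγ : 0 < α / 4)
    (hγ2 : α / 4 < 1 / 2) (h2 : 0 < α / 2) {x : SeqPair (L2Time T)}
    (hx : x ∈ solSpace (rlOp T hγ : L2Time T →L[ℝ] L2Time T) ev) :
    normWhat α T φ ev (rlOpR T h2 (solFun φ hγ x)) ≤ ENNReal.ofReal (hatConst α) * ‖x‖ₑ := by
  have hc := (inv_pos.2 (coerConst_pos hγ hγ2)).le
  refine (ExtSeminorm.inter_le_add _ _ _).trans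
    ((add_le_add (vecH_rlOpR_solFun_zero_le hT hγ hγ2 h2 x)
      (vecH_rlOpR_solFun_one_le hT hev hγ hγ2 h2 hx)).trans ?_)
  rw [hatConst, ENNReal.ofReal_add (mul_nonneg (upConst₂_pos _).le hc)
    (mul_nonneg (upConst_pos _).le hc), add_mul]
  gcongr
  · exact WithLp.enorm_fst_le _ x
  · exact WithLp.enorm_snd_le _ x

theorem vecH_rightFun_le (hT : 0 < T) (hγ : 0 < α / 4) (hγ1 : α / 4 < 1) (k : Seq (L2Time T)) :
    vecH φ ev (rightH T (α / 4)) 0 (rightFun φ hγ k) ≤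
      ENNReal.ofReal (upConst (α / 4)) * ‖k‖ₑ := vecH_zero_le fun n => by
  rw [coeff_rightFun]
  exact rightH_rlOpR_le hT hγ hγ1 _

theorem exists_rightFun_eq (hT : 0 < T) (hγ : 0 < α / 4) (hγ1 : α / 4 < 1)
    {u : L2TS T Ω} (h0 : vecH φ ev (rightH T (α / 4)) 0 u < ∞) :
    ∃ k, rightFun φ hγ k = u ∧
      ‖k‖ₑ ≤ ENNReal.ofReal (loConst (α / 4)) * vecH φ ev (rightH T (α / 4)) 0 u := by
  choose g hg hgn using fun n => exists_rlOpR_eq_of_rightH hT hγ hγ1 (coeff_lt_top_of_vecH h0 n)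
  obtain ⟨g', hg', hn⟩ := exists_seq_of_vecH (K := loConst (α / 4)) h0 (c := g) fun n => by
    rw [Real.rpow_zero, ENNReal.ofReal_one, one_mul,
      ← ENNReal.mul_rpow_of_nonneg _ _ zero_le_two]
    exact ENNReal.rpow_le_rpow (hgn n) zero_le_two
  refine ⟨g', coeff_ext (φ := φ) fun n => ?_, hn⟩
  rw [coeff_rightFun, hg', hg]

theorem rightFun_injective (hγ : 0 < α / 4) (hγ1 : α / 4 < 1) :
    Function.Injective (rightFun φ hγ : Seq (L2Time T) →ₗ[ℝ] L2TS T Ω) := fun k l h =>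
  lp.ext (funext fun n => injective_rlOpR hγ hγ1 (by
    rw [← coeff_rightFun (φ := φ), ← coeff_rightFun (φ := φ), h]))

end FracWave

namespace FracWave

/-! ### The fractional derivative as a functional -/

variable {T α : ℝ} {d : ℕ} {Ω : Set (Sp d)} {φ : HilbertBasis ℕ ℝ (L2 Ω)} {ev : ℕ → ℝ}

section

variable {H E : Type*} [NormedAddCommGroup H] [InnerProductSpace ℝ H] [AddCommGroup E] [Module ℝ E]

/-- Linear isomorphisms of a Hilbert space with the space of `N`. -/
abbrev ParamEquiv (H : Type*) [NormedAddCommGroup H] [InnerProductSpace ℝ H]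
    (N : ExtSeminorm E) : Type _ := H ≃ₗ[ℝ] N.space

/-- `R` identifies the Hilbert space `H` with the space of `N`, up to equivalence of norms. -/
structure IsParam (N : ExtSeminorm E) (R : ParamEquiv H N) (C C' : ℝ) : Prop where
  le : ∀ k, N (R k : E) ≤ ENNReal.ofReal C * ‖k‖ₑ
  le_symm : ∀ k, ‖k‖ₑ ≤ ENNReal.ofReal C' * N (R k : E)

theorem exists_isParam {N : ExtSeminorm E} {f : H →ₗ[ℝ] E} {C C' : ℝ}
    (hf : ∀ k, N (f k) ≤ ENNReal.ofReal C * ‖k‖ₑ) (hi : Function.Injective f)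
    (hs : ∀ u, N u < ∞ → ∃ k, f k = u ∧ ‖k‖ₑ ≤ ENNReal.ofReal C' * N u) :
    ∃ R : ParamEquiv H N, (∀ k, (R k : E) = f k) ∧ IsParam N R C C' := by
  have hf' : ∀ k, f k ∈ N.space := fun k =>
    (hf k).trans_lt (ENNReal.mul_lt_top ENNReal.ofReal_lt_top enorm_lt_top)
  refine ⟨LinearEquiv.ofBijective (f.codRestrict N.space hf')
    ⟨fun _ _ h => hi (congrArg Subtype.val h), fun u => ?_⟩, fun _ => rfl, hf, fun k => ?_⟩
  · obtain ⟨k, hk, -⟩ := hs u u.2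
    exact ⟨k, Subtype.ext hk⟩
  · obtain ⟨l, hl, hn⟩ := hs (f k) (hf' k)
    rw [hi hl] at hn
    exact hn

variable {N : ExtSeminorm E} {R : ParamEquiv H N} {C C' : ℝ}

/-- The Riesz representation of a bounded functional on the space of `N`. -/
theorem IsParam.exists_inner_eq [CompleteSpace H] (hR : IsParam N R C C') (hC : 0 ≤ C)
    {L : N.space →ₗ[ℝ] ℝ} (hL : N.opNorm L < ∞) : ∃ e : H, ∀ k, L (R k) = inner ℝ e k := by
  have hb : ∀ k, |L (R k)| ≤ (N.opNorm L).toReal * C * ‖k‖ := fun k => by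
    have h2 := (ExtSeminorm.enorm_apply_le_opNorm hL (R k)).trans (mul_le_mul_right (hR.le k) _)
    rw [← ENNReal.ofReal_toReal hL.ne, ← ofReal_norm, ← ofReal_norm,
      ← ENNReal.ofReal_mul hC, ← ENNReal.ofReal_mul ENNReal.toReal_nonneg,
      ENNReal.ofReal_le_ofReal_iff (by positivity)] at h2
    rw [mul_assoc]
    exact h2
  exact ⟨(InnerProductSpace.toDual ℝ H).symm ((L ∘ₗ R.toLinearMap).mkContinuous _ hb),
    fun k => by
      rw [InnerProductSpace.toDual_symm_apply]
      rfl⟩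

theorem IsParam.exists_functional (hR : IsParam N R C C') (g : H) :
    ∃ L : N.space →ₗ[ℝ] ℝ, N.opNorm L < ∞ ∧ ∀ k, L (R k) = inner ℝ g k := by
  have e : ∀ k, ((innerₛₗ ℝ g) ∘ₗ R.symm.toLinearMap) (R k) = inner ℝ g k := fun k =>
    congrArg (fun z => inner ℝ g z) (R.symm_apply_apply k)
  refine ⟨(innerₛₗ ℝ g) ∘ₗ R.symm.toLinearMap, ?_, e⟩
  refine (ExtSeminorm.opNorm_le (M := ‖g‖ₑ * ENNReal.ofReal C')
    fun w => ?_).trans_lt (ENNReal.mul_lt_top enorm_lt_top ENNReal.ofReal_lt_top)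
  obtain ⟨k, rfl⟩ := R.surjective w
  rw [mul_assoc, e]
  refine le_trans ?_ (mul_le_mul_right (hR.le_symm k) _)
  rw [← ofReal_norm, ← ofReal_norm, ← ofReal_norm, ← ENNReal.ofReal_mul (norm_nonneg _)]
  exact ENNReal.ofReal_le_ofReal (norm_inner_le_norm _ _)

theorem inner_single_seq (g : Seq H) (n : ℕ) (x : H) :
    inner ℝ g (lp.single 2 n x) = inner ℝ (g n) x :=
  lp.inner_single_right (𝕜 := ℝ) (G := fun _ : ℕ => H) n x g

end

theorem rightFun_single (hγ : 0 < α / 4) (h1 : 0 < 1 - α / 4) (n : ℕ)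
    {ψ : ℝ → ℝ} (hψ : IsTest T ψ) :
    rightFun φ hγ (lp.single 2 n (-rlOpR T h1 hψ.derivLp)) = coordEmb T φ n hψ.toLp := by
  classical
  refine coeff_ext (φ := φ) fun m => ?_
  rw [coeff_rightFun, coeff_coordEmb]
  split_ifs with h
  · subst h
    rw [lp.single_apply_self, rlOpR_rlOpR_derivLp]
  · rw [lp.single_apply_ne _ _ _ h, map_zero]

theorem neg_integral_intLeft_mul_deriv (hγ : 0 < α / 4) (h1 : 0 < 1 - α / 4)
    (hα : 0 < 1 - α / 2) {v g : L2Time T} (hv : v = rlOp T hγ g) {ψ : ℝ → ℝ} (hψ : IsTest T ψ) :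
    -∫ t, intLeft (1 - α / 2) v t * deriv ψ t ∂(timeMeasure T) =
      inner ℝ g (-rlOpR T h1 hψ.derivLp) := by
  have e : ∫ t, intLeft (1 - α / 2) v t * deriv ψ t ∂(timeMeasure T) =
      ∫ t, rlOp T hα v t * deriv ψ t ∂(timeMeasure T) := by
    refine integral_congr_ae ?_
    filter_upwards [rlOp_ae hα v] with t ht
    rw [ht]
  rw [e, integral_mul_eq_inner _ _ hψ.derivLp_ae, hv, rlOp_rlOp, rlOp_congr _ h1 (by ring),
    inner_rlOp_left, inner_neg_right]

variable {N : ExtSeminorm (L2TS T Ω)} {R : ParamEquiv (Seq (L2Time T)) N} {C C' : ℝ}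

theorem rightFun_single_ae (hγ : 0 < α / 4) (h1 : 0 < 1 - α / 4)
    (n : ℕ) {ψ : ℝ → ℝ} (hψ : IsTest T ψ) :
    ∀ᵐ t ∂(timeMeasure T),
      rightFun φ hγ (lp.single 2 n (-rlOpR T h1 hψ.derivLp)) t = ψ t • φ n := by
  rw [rightFun_single]
  filter_upwards [coordEmb_ae (φ := φ) n hψ.toLp, hψ.memLp.coeFn_toLp] with t a b
  rw [a]
  exact congrArg (· • φ n) b

set_option maxHeartbeats 1000000 in
/-- A functional on `⁰H^{α/4}(0, T; L²(Ω))` that is the derivative of order `α/2` of the function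
with coefficients `D_{0+}^{-α/4} gₙ` is the pairing of `g` with `D_{T-}^{α/4}`; it is determined by
its values on test functions since the derivatives `D_{T-}^{α/4} ψ` are dense for `α/4 < 1/2`. -/
theorem IsFracDeriv.apply_param (hT : 0 < T) {hγ : 0 < α / 4} (hγ2 : α / 4 < 1 / 2)
    (hα : 0 < 1 - α / 2) (hC : 0 ≤ C) (hR : IsParam N R C C')
    (hRf : ∀ k, (R k : L2TS T Ω) = rightFun φ hγ k) {u : L2TS T Ω} {g : Seq (L2Time T)}
    (hu : ∀ n, coeff φ n u = rlOp T hγ (g n)) {L : N.space →ₗ[ℝ] ℝ} (hL : N.opNorm L < ∞)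
    (hD : IsFracDeriv φ (α / 2) (fun n t => coeff φ n u t) N L) (k : Seq (L2Time T)) :
    L (R k) = inner ℝ g k := by
  have h1 : 0 < 1 - α / 4 := by linarith
  obtain ⟨e, hM⟩ := hR.exists_inner_eq hC hL
  have heg : ∀ n, e n = g n := by
    intro n
    rw [← sub_eq_zero]
    refine eq_zero_of_inner_rlOpR_derivLp hT hγ hγ2 h1 fun ψ hψ => ?_
    have h3 := hD n ψ hψ (R (lp.single 2 n (-rlOpR T h1 hψ.derivLp)))
      ((hRf _).symm ▸ rightFun_single_ae hγ h1 n hψ)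
    have h4 := (hM _).symm.trans h3
    have h5 := (inner_single_seq e n _).symm.trans
      (h4.trans (neg_integral_intLeft_mul_deriv hγ h1 hα (hu n) hψ))
    have h6 := neg_inj.1 ((inner_neg_right _ _).symm.trans (h5.trans (inner_neg_right _ _)))
    rw [inner_sub_left, h6, sub_self]
  have heg' : e = g := lp.ext (funext heg)
  rw [hM, heg']

theorem exists_isFracDeriv {hγ : 0 < α / 4} (hγ1 : α / 4 < 1)
    (hα : 0 < 1 - α / 2) (hR : IsParam N R C C')
    (hRf : ∀ k, (R k : L2TS T Ω) = rightFun φ hγ k) {u : L2TS T Ω} {g : Seq (L2Time T)}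
    (hu : ∀ n, coeff φ n u = rlOp T hγ (g n)) :
    ∃ L : N.space →ₗ[ℝ] ℝ, N.opNorm L < ∞ ∧
      IsFracDeriv φ (α / 2) (fun n t => coeff φ n u t) N L := by
  have h1 : 0 < 1 - α / 4 := by linarith
  obtain ⟨L, hL, hLR⟩ := hR.exists_functional g
  refine ⟨L, hL, fun n ψ hψ w hw => ?_⟩
  have hk : R (lp.single 2 n (-rlOpR T h1 hψ.derivLp)) = w := by
    refine Subtype.ext ((hRf _).trans (Lp.ext ?_))
    filter_upwards [hw, rightFun_single_ae hγ h1 n hψ] with t a b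
    exact b.trans a.symm
  exact (congrArg L hk).symm.trans ((hLR _).trans ((inner_single_seq g n _).trans
    (neg_integral_intLeft_mul_deriv hγ h1 hα (hu n) hψ).symm))

end FracWave

namespace FracWave

/-! ### The weak formulation as a variational equation -/

variable {T α : ℝ} {d : ℕ} {Ω : Set (Sp d)} {φ : HilbertBasis ℕ ℝ (L2 Ω)} {ev : ℕ → ℝ}

theorem isSpaceGrad_congr {U V : ℝ → L2 Ω} {P : L2TSVec T Ω} (h : U =ᵐ[timeMeasure T] V) :
    IsSpaceGrad U P ↔ IsSpaceGrad V P :=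
  eventually_congr (h.mono fun t ht => by rw [ht])

theorem solFun_eq_rightFun (hγ : 0 < α / 4) (hγ2 : α / 4 < 1 / 2) (y : SeqPair (L2Time T)) :
    solFun φ hγ y = rightFun φ hγ (seqMap (swapOp T hγ hγ2) y.fst) :=
  coeff_ext (φ := φ) fun n => by
    rw [coeff_solFun, coeff_rightFun, seqMap_apply, rlOpR_swapOp]

theorem coeff_eq_smul_iff {q u : L2TS T Ω} {c : Seq (L2Time T)}
    (hc : ∀ n, c n = √(ev n) • coeff φ n u) :
    (∀ n, coeff φ n q = √(ev n) • coeff φ n u) ↔ q = (coordEquiv T φ).symm c := by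
  refine ⟨fun h => (coordEquiv_symm_eq fun n => (hc n).trans (h n).symm).symm, fun h n => ?_⟩
  rw [h, coeff_coordEquiv_symm, hc]

set_option maxHeartbeats 1000000 in
/-- The spatial gradients of `D_{0+}^{-α/4} u` and `D_{T-}^{-α/4} v`, in the coordinates of
`solSpace`. -/
theorem exists_grad_solFun (hΩ : IsOpen Ω) (hφ : IsDirichletEigenbasis Ω φ ev) (hγ : 0 < α / 4)
    (hγ2 : α / 4 < 1 / 2) :
    ∃ Ψ : Seq (L2Time T) → L2TSVec T Ω, (∀ p q, inner ℝ (Ψ p) (Ψ q) = inner ℝ p q) ∧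
      ∀ x ∈ solSpace (rlOp T hγ : L2Time T →L[ℝ] L2Time T) ev, ∀ P,
        (IsSpaceGrad (intLeft (α / 4) (solFun φ hγ x : L2TS T Ω)) P ↔ P = Ψ x.snd) ∧
        (IsSpaceGrad (intRight T (α / 4) (solFun φ hγ x : L2TS T Ω)) P ↔
          P = Ψ (seqMap (swapOp T hγ hγ2).adjoint x.snd)) := by
  obtain ⟨Ψ, hΨ, hg⟩ := exists_spaceGrad T hΩ hφ
  refine ⟨fun c => Ψ ((coordEquiv T φ).symm c), fun p q => ?_, fun x hx P => ⟨?_, ?_⟩⟩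
  · rw [hΨ, LinearIsometryEquiv.inner_map_map]
  · have hc : ∀ n, x.snd n = √(ev n) • coeff φ n (rlOp T hγ (solFun φ hγ x)) := fun n => by
      rw [coeff_rlOp, coeff_solFun, hx n]
    rw [isSpaceGrad_congr (rlOp_ae hγ (solFun φ hγ x)).symm, hg]
    simp only [coeff_eq_smul_iff hc, exists_eq_right]
  · have hc : ∀ n, seqMap (swapOp T hγ hγ2).adjoint x.snd n =
        √(ev n) • coeff φ n (rlOpR T hγ (solFun φ hγ x)) := fun n => by
      rw [coeff_rlOpR, coeff_solFun, seqMap_apply, hx n, map_smul, adjoint_swapOp_rlOp]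
    rw [isSpaceGrad_congr (rlOpR_ae hγ (solFun φ hγ x)).symm, hg]
    simp only [coeff_eq_smul_iff hc, exists_eq_right]

theorem solFun_mem_space (hT : 0 < T) (hev : ∀ n, 0 < ev n) (hγ : 0 < α / 4) (hγ1 : α / 4 < 1)
    {x : SeqPair (L2Time T)} (hx : x ∈ solSpace (rlOp T hγ : L2Time T →L[ℝ] L2Time T) ev) :
    solFun φ hγ x ∈ (normW α T φ ev).space :=
  (normW_solFun_le hT hev hγ hγ1 hx).trans_lt
    (ENNReal.mul_lt_top ENNReal.ofReal_lt_top enorm_lt_top)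

theorem rlOpR_solFun_mem_space (hT : 0 < T) (hev : ∀ n, 0 < ev n) (hγ : 0 < α / 4)
    (hγ2 : α / 4 < 1 / 2) (h2 : 0 < α / 2) {x : SeqPair (L2Time T)}
    (hx : x ∈ solSpace (rlOp T hγ : L2Time T →L[ℝ] L2Time T) ev) :
    rlOpR T h2 (solFun φ hγ x) ∈ (normWhat α T φ ev).space :=
  (normWhat_solFun_le hT hev hγ hγ2 h2 hx).trans_lt
    (ENNReal.mul_lt_top ENNReal.ofReal_lt_top enorm_lt_top)

set_option maxHeartbeats 2000000 in
/-- In the coordinates of `solSpace` the weak formulation is the variational equation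
`⟪g, S h⟫ + ⟪p, S^* q⟫ = ⟨f, D_{T-}^{-α/2} v⟩ + ⟨G, v⟩`, where `(g, p)` and `(h, q)` are the
coordinates of `u` and `v`. -/
theorem isWeakSolution_iff (hT : 0 < T) (hΩ : IsOpen Ω) (hφ : IsDirichletEigenbasis Ω φ ev)
    (hγ : 0 < α / 4) (hγ2 : α / 4 < 1 / 2) (h2 : 0 < α / 2)
    (f : (normWhat α T φ ev).space →ₗ[ℝ] ℝ) (G : (normW α T φ ev).space →ₗ[ℝ] ℝ)
    {x : SeqPair (L2Time T)} (hx : x ∈ solSpace (rlOp T hγ : L2Time T →L[ℝ] L2Time T) ev)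
    (u : (normW α T φ ev).space) (hu : (u : L2TS T Ω) = solFun φ hγ x) :
    IsWeakSolution α T φ ev f G u ↔
      ∀ (y : SeqPair (L2Time T)) (hy : y ∈ solSpace (rlOp T hγ : L2Time T →L[ℝ] L2Time T) ev),
        inner ℝ x (pairMap (swapOp T hγ hγ2) y) =
          f ⟨rlOpR T h2 (solFun φ hγ y), rlOpR_solFun_mem_space hT hφ.pos hγ hγ2 h2 hy⟩ +
          G ⟨solFun φ hγ y, solFun_mem_space hT hφ.pos hγ (by linarith) hy⟩ := by
  have hγ1 : α / 4 < 1 := by linarith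
  have hα : 0 < 1 - α / 2 := by linarith
  obtain ⟨Ψ, hΨ, hg⟩ := exists_grad_solFun (T := T) hΩ hφ hγ hγ2
  have hR0 := exists_isParam (vecH_rightFun_le (φ := φ) (ev := ev) hT hγ hγ1)
    (rightFun_injective hγ hγ1) (fun u hu => exists_rightFun_eq hT hγ hγ1 hu)
  obtain ⟨R, hRf, hR⟩ := hR0
  have hun : ∀ n, coeff φ n (u : L2TS T Ω) = rlOp T hγ (x.fst n) := fun n => by
    rw [hu, coeff_solFun]
  have hint : ∀ p q, ∫ t, inner ℝ (Ψ p t) (Ψ q t) ∂(timeMeasure T) = inner ℝ p q := fun p q => by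
    rw [← hΨ, L2.inner_def]
  have hv : ∀ y, (R (seqMap (swapOp T hγ hγ2) y.fst) : L2TS T Ω) = solFun φ hγ y := fun y => by
    rw [hRf, solFun_eq_rightFun]
  constructor
  · rintro ⟨L, P, hL, hD, hP, hw⟩ y hy
    have hm : solFun φ hγ y ∈ (normW α T φ ev).space := solFun_mem_space hT hφ.pos hγ hγ1 hy
    have hm' : rlOpR T h2 (solFun φ hγ y) ∈ (normWhat α T φ ev).space :=
      rlOpR_solFun_mem_space hT hφ.pos hγ hγ2 h2 hy
    have hw1 := hw ⟨solFun φ hγ y, hm⟩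
    obtain ⟨v', hw1⟩ := hw1
    obtain ⟨Q, hw1⟩ := hw1
    obtain ⟨w, hw1⟩ := hw1
    obtain ⟨hv', hQ, hwt, heq⟩ := hw1
    have hLR := hD.apply_param hT hγ2 hα (upConst_pos _).le hR hRf hun hL
    rw [hu] at hP
    have e1 : v' = R (seqMap (swapOp T hγ hγ2) y.fst) := Subtype.ext (hv'.trans (hv y).symm)
    have e2 : w = ⟨rlOpR T h2 (solFun φ hγ y), hm'⟩ := by
      refine Subtype.ext (Lp.ext ?_)
      filter_upwards [hwt, rlOpR_ae h2 (solFun φ hγ y : L2TS T Ω)] with t a b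
      exact a.trans b.symm
    have e3 : L v' = inner ℝ x.fst (seqMap (swapOp T hγ hγ2) y.fst) :=
      (congrArg L e1).trans (hLR _)
    have e4 : P = Ψ x.snd := ((hg x hx P).1).1 hP
    have e5 : Q = Ψ (seqMap (swapOp T hγ hγ2).adjoint y.snd) := ((hg y hy Q).2).1 hQ
    subst e4 e5
    exact (inner_pairMap _ _ _).trans ((congrArg₂ (· + ·) e3.symm (hint _ _).symm).trans
      (heq.trans (congrArg (fun z => f z + G ⟨solFun φ hγ y, hm⟩) e2)))
  · intro h
    obtain ⟨L, hL, hD⟩ := exists_isFracDeriv hγ1 hα hR hRf hun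
    have hLR := hD.apply_param hT hγ2 hα (upConst_pos _).le hR hRf hun hL
    refine ⟨L, Ψ x.snd, hL, hD, ?_, fun v => ?_⟩
    · rw [hu]
      exact ((hg x hx _).1).2 rfl
    · obtain ⟨y, hy, hyv⟩ := exists_solFun_eq hT hφ.pos hγ hγ1 v.2
      have hm : solFun φ hγ y ∈ (normW α T φ ev).space := solFun_mem_space hT hφ.pos hγ hγ1 hy
      obtain rfl : (⟨solFun φ hγ y, hm⟩ : (normW α T φ ev).space) = v := Subtype.ext hyv
      exact ⟨R (seqMap (swapOp T hγ hγ2) y.fst), Ψ (seqMap (swapOp T hγ hγ2).adjoint y.snd),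
        ⟨rlOpR T h2 (solFun φ hγ y), rlOpR_solFun_mem_space hT hφ.pos hγ hγ2 h2 hy⟩, hv y,
        ((hg y hy _).2).2 rfl, rlOpR_ae h2 _,
        (congrArg₂ (· + ·) (hLR _) (hint _ _)).trans ((inner_pairMap _ _ _).symm.trans (h y hy))⟩

end FracWave

namespace FracWave

/-! ### Existence, uniqueness and the a priori bound -/

theorem eq_of_coercive {H : Type*} [NormedAddCommGroup H] [InnerProductSpace ℝ H]
    {A : H →L[ℝ] H} {κ : ℝ} (hκ : 0 < κ) (hA : ∀ x, κ * ‖x‖ ^ 2 ≤ inner ℝ x (A x))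
    {K : Submodule ℝ H} {x x' : H} (hx : x ∈ K) (hx' : x' ∈ K)
    (h : ∀ y ∈ K, inner ℝ x (A y) = inner ℝ x' (A y)) : x = x' := by
  have h0 : inner ℝ (x - x') (A (x - x')) = 0 := by
    rw [inner_sub_left, h _ (K.sub_mem hx hx'), sub_self]
  have h1 : ‖x - x'‖ ^ 2 ≤ 0 := by nlinarith [hA (x - x'), sq_nonneg ‖x - x'‖]
  exact sub_eq_zero.1 (norm_eq_zero.1 (pow_eq_zero_iff two_ne_zero |>.1
    (le_antisymm h1 (sq_nonneg _))))

theorem norm_le_of_coercive {H : Type*} [NormedAddCommGroup H] [InnerProductSpace ℝ H]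
    {A : H →L[ℝ] H} {κ M : ℝ} (hκ : 0 < κ) {x : H} (hA : κ * ‖x‖ ^ 2 ≤ inner ℝ x (A x))
    (hM : 0 ≤ M) (h : inner ℝ x (A x) ≤ M * ‖x‖) : ‖x‖ ≤ κ⁻¹ * M := by
  rcases (norm_nonneg x).eq_or_lt with h0 | h0
  · rw [← h0]; positivity
  · rw [inv_mul_eq_div, le_div_iff₀ hκ]
    exact le_of_mul_le_mul_right (by nlinarith) h0

/-- A functional on `N.space`, pulled back along a bounded linear parametrization. -/
theorem ExtSeminorm.exists_pullback {E H : Type*} [AddCommGroup E] [Module ℝ E]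
    [NormedAddCommGroup H] [InnerProductSpace ℝ H] {N : ExtSeminorm E} {F : N.space →ₗ[ℝ] ℝ}
    (hF : N.opNorm F < ∞) (K : Submodule ℝ H) (S : H →ₗ[ℝ] E) {C : ℝ} (hC : 0 ≤ C)
    (hS : ∀ y ∈ K, N (S y) ≤ ENNReal.ofReal C * ‖y‖ₑ) :
    ∃ F' : K →ₗ[ℝ] ℝ, (∀ y (hy : y ∈ K) (hm : S y ∈ N.space), F' ⟨y, hy⟩ = F ⟨S y, hm⟩) ∧
      ∀ y, |F' y| ≤ C * (N.opNorm F).toReal * ‖y‖ := by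
  have hm : ∀ y : K, S y ∈ N.space := fun y => (hS y y.2).trans_lt
    (ENNReal.mul_lt_top ENNReal.ofReal_lt_top enorm_lt_top)
  refine ⟨F.comp ((S.comp K.subtype).codRestrict _ hm), fun y hy hm => rfl, fun y => ?_⟩
  have h := (ExtSeminorm.enorm_apply_le_opNorm hF ⟨S y, hm y⟩).trans
    (mul_le_mul_right (hS y y.2) _)
  have h' := ENNReal.toReal_mono (ENNReal.mul_ne_top hF.ne
    (ENNReal.mul_ne_top ENNReal.ofReal_ne_top enorm_ne_top)) h
  rw [ENNReal.toReal_mul, ENNReal.toReal_mul, ENNReal.toReal_ofReal hC,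
    toReal_enorm, toReal_enorm] at h'
  exact h'.trans_eq (by rw [Submodule.coe_norm]; ring)

variable {T α : ℝ} {d : ℕ} {Ω : Set (Sp d)} {φ : HilbertBasis ℕ ℝ (L2 Ω)} {ev : ℕ → ℝ}

set_option maxHeartbeats 2000000 in
/-- The right-hand side of the weak formulation, as a functional of the coordinates of the test
function. -/
theorem exists_rhs_functional (hT : 0 < T) (hev : ∀ n, 0 < ev n) (hγ : 0 < α / 4)
    (hγ2 : α / 4 < 1 / 2) (h2 : 0 < α / 2)
    {f : (normWhat α T φ ev).space →ₗ[ℝ] ℝ} {G : (normW α T φ ev).space →ₗ[ℝ] ℝ}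
    (hf : (normWhat α T φ ev).opNorm f < ∞) (hG : (normW α T φ ev).opNorm G < ∞) :
    ∃ (F : solSpace (rlOp T hγ : L2Time T →L[ℝ] L2Time T) ev →ₗ[ℝ] ℝ) (M : ℝ), 0 ≤ M ∧
      M ≤ (hatConst α + (upConst (α / 4) + loConst (α / 4))) *
        (((normWhat α T φ ev).opNorm f).toReal + ((normW α T φ ev).opNorm G).toReal) ∧
      (∀ (y : SeqPair (L2Time T))
        (hy : y ∈ solSpace (rlOp T hγ : L2Time T →L[ℝ] L2Time T) ev), F ⟨y, hy⟩ =
          f ⟨rlOpR T h2 (solFun φ hγ y), rlOpR_solFun_mem_space hT hev hγ hγ2 h2 hy⟩ +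
          G ⟨solFun φ hγ y, solFun_mem_space hT hev hγ (by linarith) hy⟩) ∧
      ∀ y, |F y| ≤ M * ‖y‖ := by
  have hH := hatConst_nonneg hγ hγ2
  have hC : 0 ≤ upConst (α / 4) + loConst (α / 4) :=
    (add_pos (upConst_pos _) (loConst_pos _)).le
  obtain ⟨F₁, h₁, b₁⟩ := ExtSeminorm.exists_pullback hf
    (solSpace (rlOp T hγ : L2Time T →L[ℝ] L2Time T) ev)
    ((rlOpR T h2 : L2TS T Ω →L[ℝ] L2TS T Ω).toLinearMap.comp (solFun φ hγ))
    (hatConst_nonneg hγ hγ2) fun y hy => normWhat_solFun_le hT hev hγ hγ2 h2 hy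
  obtain ⟨F₂, h₂, b₂⟩ := ExtSeminorm.exists_pullback hG
    (solSpace (rlOp T hγ : L2Time T →L[ℝ] L2Time T) ev) (solFun φ hγ) hC
    fun y hy => normW_solFun_le hT hev hγ (by linarith) hy
  refine ⟨F₁ + F₂, hatConst α * ((normWhat α T φ ev).opNorm f).toReal +
    (upConst (α / 4) + loConst (α / 4)) * ((normW α T φ ev).opNorm G).toReal, by positivity, ?_,
    fun y hy => congrArg₂ (· + ·) (h₁ y hy _) (h₂ y hy _), fun y => ?_⟩
  · have p1 := mul_nonneg hH (ENNReal.toReal_nonneg (a := (normW α T φ ev).opNorm G))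
    have p2 := mul_nonneg hC (ENNReal.toReal_nonneg (a := (normWhat α T φ ev).opNorm f))
    linarith
  calc |F₁ y + F₂ y| ≤ |F₁ y| + |F₂ y| := abs_add_le _ _
    _ ≤ _ := add_le_add (b₁ y) (b₂ y)
    _ = _ := by ring

/-- The constant `C_α` of the a priori bound. -/
noncomputable def solConst (α : ℝ) : ℝ :=
  (upConst (α / 4) + loConst (α / 4)) * (coerConst (α / 4))⁻¹ *
    (hatConst α + (upConst (α / 4) + loConst (α / 4)))

theorem solConst_pos (hγ : 0 < α / 4) (hγ2 : α / 4 < 1 / 2) : 0 < solConst α := by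
  have h1 := add_pos (upConst_pos (α / 4)) (loConst_pos (α / 4))
  have h2 := coerConst_pos hγ hγ2
  have h3 := hatConst_nonneg hγ hγ2
  unfold solConst
  positivity

set_option maxHeartbeats 2000000 in
/-- Well-posedness for an arbitrary data functional `G` in the dual space of `W`. -/
theorem existsUnique_isWeakSolution_and_norm_le (hT : 0 < T) (hΩ : IsOpen Ω)
    (hφ : IsDirichletEigenbasis Ω φ ev) (hγ : 0 < α / 4) (hγ2 : α / 4 < 1 / 2) (h2 : 0 < α / 2)
    {f : (normWhat α T φ ev).space →ₗ[ℝ] ℝ} {G : (normW α T φ ev).space →ₗ[ℝ] ℝ}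
    (hf : (normWhat α T φ ev).opNorm f < ∞) (hG : (normW α T φ ev).opNorm G < ∞) :
    (∃! u : (normW α T φ ev).space, IsWeakSolution α T φ ev f G u) ∧
      ∀ u : (normW α T φ ev).space, IsWeakSolution α T φ ev f G u →
        normW α T φ ev (u : L2TS T Ω) ≤ ENNReal.ofReal (solConst α) *
          ((normWhat α T φ ev).opNorm f + (normW α T φ ev).opNorm G) := by
  have hγ1 : α / 4 < 1 := by linarith
  have hκ := coerConst_pos hγ hγ2
  have hA := le_inner_pairMap (le_inner_swapOp (T := T) hγ hγ2)
  have hC : 0 < upConst (α / 4) + loConst (α / 4) := add_pos (upConst_pos _) (loConst_pos _)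
  obtain ⟨F, M, hM0, hMle, hF, hFM⟩ := exists_rhs_functional hT hφ.pos hγ hγ2 h2 hf hG
  have hiff : ∀ (x : SeqPair (L2Time T))
      (_ : x ∈ solSpace (rlOp T hγ : L2Time T →L[ℝ] L2Time T) ev)
      (u : (normW α T φ ev).space), (u : L2TS T Ω) = solFun φ hγ x →
      (IsWeakSolution α T φ ev f G u ↔ ∀ y hy,
        inner ℝ x (pairMap (swapOp T hγ hγ2) y) = F ⟨y, hy⟩) := fun x hx u hu =>
    (isWeakSolution_iff hT hΩ hφ hγ hγ2 h2 f G hx u hu).trans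
      (forall₂_congr fun y hy => by rw [hF y hy])
  have hex : ∀ u : (normW α T φ ev).space, ∃ x,
      x ∈ solSpace (rlOp T hγ : L2Time T →L[ℝ] L2Time T) ev ∧ (u : L2TS T Ω) = solFun φ hγ x :=
    fun u => by
      obtain ⟨x, hx, hxu⟩ := exists_solFun_eq hT hφ.pos hγ hγ1 u.2
      exact ⟨x, hx, hxu.symm⟩
  refine ⟨existsUnique_of_exists_of_unique ?_ fun u u' h h' => ?_, fun u h => ?_⟩
  · obtain ⟨x, hx⟩ := exists_inner_eq_of_coercive hκ hA (isClosed_solSpace _ _) F hFM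
    exact ⟨⟨solFun φ hγ (x : SeqPair (L2Time T)), solFun_mem_space hT hφ.pos hγ hγ1 x.2⟩,
      (hiff x x.2 _ rfl).2 fun y hy => hx ⟨y, hy⟩⟩
  · obtain ⟨x, hx, hxu⟩ := hex u
    obtain ⟨x', hx', hxu'⟩ := hex u'
    have e := eq_of_coercive hκ hA hx hx' fun y hy =>
      ((hiff x hx u hxu).1 h y hy).trans ((hiff x' hx' u' hxu').1 h' y hy).symm
    exact Subtype.ext (hxu.trans ((congrArg _ e).trans hxu'.symm))
  · obtain ⟨x, hx, hxu⟩ := hex u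
    have hb : inner ℝ x (pairMap (swapOp T hγ hγ2) x) ≤ M * ‖x‖ :=
      ((hiff x hx u hxu).1 h x hx).trans_le ((le_abs_self _).trans (hFM ⟨x, hx⟩))
    have hx1 := norm_le_of_coercive hκ (hA x) hM0 hb
    have hr : (upConst (α / 4) + loConst (α / 4)) * ‖x‖ ≤ solConst α *
        (((normWhat α T φ ev).opNorm f).toReal + ((normW α T φ ev).opNorm G).toReal) := by
      refine (mul_le_mul_of_nonneg_left (hx1.trans
        (mul_le_mul_of_nonneg_left hMle (inv_nonneg.2 hκ.le))) hC.le).trans_eq ?_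
      rw [solConst]
      ring
    rw [hxu]
    refine (normW_solFun_le hT hφ.pos hγ hγ1 hx).trans ?_
    rw [← ofReal_norm, ← ENNReal.ofReal_mul hC.le]
    refine (ENNReal.ofReal_le_ofReal hr).trans_eq ?_
    rw [ENNReal.ofReal_mul (solConst_pos hγ hγ2).le,
      ENNReal.ofReal_add ENNReal.toReal_nonneg ENNReal.toReal_nonneg,
      ENNReal.ofReal_toReal hf.ne, ENNReal.ofReal_toReal hG.ne]

end FracWave

theorem mainTheorem4 (α : ℝ) (hα₁ : 1 < α) (hα₂ : α < 2) :
    ∃ C : ℝ, 0 < C ∧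
      ∀ (T : ℝ), 0 < T →
      ∀ (d : ℕ), 1 ≤ d → d ≤ 3 →
      ∀ (Ω : Set (Sp d)), IsConvexPolytope Ω →
      ∀ (φ : HilbertBasis ℕ ℝ (L2 Ω)) (ev : ℕ → ℝ), IsDirichletEigenbasis Ω φ ev →
      ∀ (r s : ℝ) (u₀ u₁ : ℕ → ℝ), u₀ ∈ dotH ev r → u₁ ∈ dotH ev s →
      ∀ (f : (normWhat α T φ ev).space →ₗ[ℝ] ℝ) (G : (normW α T φ ev).space →ₗ[ℝ] ℝ),
        (normWhat α T φ ev).opNorm f < ∞ →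
        (normW α T φ ev).opNorm G < ∞ →
        IsFracDeriv φ (α / 2) (fun n t => u₀ n + t * u₁ n) (normW α T φ ev) G →
        (∃! u : (normW α T φ ev).space, IsWeakSolution α T φ ev f G u) ∧
        ∀ u : (normW α T φ ev).space, IsWeakSolution α T φ ev f G u →
          normW α T φ ev (u : L2TS T Ω) ≤
            ENNReal.ofReal C *
              ((normWhat α T φ ev).opNorm f + (normW α T φ ev).opNorm G) := by
  have hγ : 0 < α / 4 := by linarith
  have hγ2 : α / 4 < 1 / 2 := by linarith
  refine ⟨solConst α, solConst_pos hγ hγ2, ?_⟩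
  intro T hT d _ _ Ω hΩ φ ev hφ r s u₀ u₁ _ _ f G hf hG _
  obtain ⟨-, s, rfl⟩ := hΩ
  exact existsUnique_isWeakSolution_and_norm_le hT isOpen_interior hφ hγ hγ2 (by linarith) hf hG
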